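/- **Setting.** An $L$-density is the law of a log-likelihood ratio given input $+1$: a probability measure $m$ on $(-\infty,+\infty]$. It is symmetric if its finite part satisfies $m(-dy)=e^{-y}m(dy)$. Write $\Delta_x$ for the unit mass at $x$, $\star$ for convolution and $\boxast$ for the check-node convolution, i.e. the law of $2\tanh^{-1}(\tanh(x/2)\tanh(y/2))$ for independent $x,y$; empty $\star$- and $\boxast$-powers are $\Delta_0$ and $\Delta_\infty$. The entropy is $H(m)=\int\log_2(1+e^{-w})\,m(dw)$. For a family $\{a_\alpha\}$ and a symmetric density $m$ the GEXIT functional is $$G(a_\alpha,m)=\int\frac{\partial_\alpha\int\log_2(1+e^{-z-w})\,a_\alpha(dw)}{\partial_\alpha H(a_\alpha)}\,m(dz),$$ where $\partial_\alpha$ is the left derivative (the ordinary derivative wherever that exists). Let $\lambda(x)=\sum_i\lambda_ix^{i-1}$ and $\rho(x)=\sum_i\rho_ix^{i-1}$ be polynomials with nonnegative coefficients, $\lambda(1)=\rho(1)=1$ and $\rho_1=0$ (no check nodes of degree one). Put $\int\lambda=\int_0^1\lambda(x)\,dx$, similarly $\int\rho$, and $r(\lambda,\rho)=1-\int\rho/\int\lambda$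 (the design rate). Let $c$ be the symmetric $L$-density of a BMS channel. Density evolution is the sequence of densities $c,\,T(c),\,T(T(c)),\dots$ with $T(a)=\sum_i\lambda_i\,c\star\big(\sum_j\rho_j\,a^{\boxast(j-1)}\big)^{\star(i-1)}$. Interpolate it by $a_\alpha=-\alpha\Delta_0+(1+\alpha)c$ for $\alpha\in[-1,0]$ and, for $\alpha\ge0$, $$b_\alpha=\sum_i\rho_i\,a_{\alpha-1}^{\boxast(i-1)},\qquad a_\alpha=\sum_i\lambda_i\,c\star b_\alpha^{\star(i-1)}.$$ **Lemma.** Assume that density evolution converges weakly to $\Delta_\infty$. Consider the check-node GEXIT curve $(H(a_\alpha),G(a_\alpha,b_{\alpha+1}))$, $\alpha>-1$, and the inverse dual variable-node GEXIT curve $(H(a_\alpha),G(a_\alpha,b_\alpha))$, $\alpha\ge0$. 1. (Well-definedness.) For all $\alpha>-1$ and all $z$, the function $t\mapsto\int\log_2(1+e^{-z-w})\,a_t(dw)$ has a left derivative at $t=\alpha$, and is differentiable there if $\alpha\notin\mathbb Z$; moreover $\partial_\alpha H(a_\alpha)<0$ whenever $H(a_\alpha)\neq0$. The kernel of $G(a_\alpha,\cdot)$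 is integrable with respect to $b_{\alpha+1}$ for $\alpha>-1$ and with respect to $b_\alpha$ for $\alpha\ge0$. (In the degenerate case $c=\Delta_\infty$, where both derivatives vanish for $\alpha>0$, the quotient $0/0$ is read as $0$.) 2. The curves do not cross: at points of the two curves with the same abscissa, the ordinate of the check-node curve is at most that of the variable-node curve. 3. The curves represent density evolution faithfully: $a_n$, $n\in\mathbb N$, are the densities of density evolution; $b_{\alpha+1}=\sum_i\rho_i a_\alpha^{\boxast(i-1)}$ for $\alpha\ge-1$ and $a_\alpha=\sum_i\lambda_i\,c\star b_\alpha^{\star(i-1)}$ for $\alpha\ge0$; the function $\alpha\mapsto H(a_\alpha)$ is continuous and non-increasing on $[-1,\infty)$; and every $x\in(0,1]$ equals $H(a_\alpha)$ for exactly one $\alpha\ge-1$. 4. The area under the check-node curve is $1-\int\rho$. The area in the unit box to the left of (equivalently, above) the variable-node curve is $H(c)\int\lambda$. 5. Consequently $r(\lambda,\rho)\le1-H(c)$. More precisely, the part of the unit box that lies neither under the check-node curve nor to the left of the variable-node curve has area $\big(1-H(c)-r(\lambda,\rho)\big)\int\lambda$ (matching condition: the design rate equals capacity exactly when the two curves leave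 no area between them). -/

import Mathlib

open MeasureTheory Set Filter Topology Polynomial

noncomputable section

namespace Gexit

/-! ### Symmetric `L`-densities

An `L`-density is the law, conditioned on the input `+1`, of a log-likelihood ratio. It is a
probability measure on `EReal`; `dirac ⊤` is the perfect channel and `dirac 0` the useless one. -/

/-- `m` is a symmetric `L`-density: a probability measure without mass at `-∞` whose finite part
satisfies `m(-dy) = e^{-y} m(dy)`. The mass at `+∞` is unrestricted. -/
structure IsSymmetricLDensity (m : Measure EReal) : Prop where
  isProbability : IsProbabilityMeasure m
  bot_null : m {⊥} = 0
  symm : (m.restrict {⊤}ᶜ).map (fun y => -y) =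
    (m.restrict {⊤}ᶜ).withDensity (fun y => EReal.exp (-y))

/-- The kernel `log₂ (1 + e^{-y})`, equal to `0` at `y = +∞`. (The value at `-∞` is irrelevant.) -/
def exitKernel (y : EReal) : ℝ := Real.logb 2 (1 + (EReal.exp (-y)).toReal)

/-- `z ↦ ∫ log₂ (1 + e^{-z-w}) m(dw)`. -/
def softEntropy (m : Measure EReal) (z : EReal) : ℝ := ∫ w, exitKernel (z + w) ∂m

/-- The entropy operator `H(m) = ∫ log₂ (1 + e^{-w}) m(dw)`. -/
def entropy (m : Measure EReal) : ℝ := ∫ w, exitKernel w ∂m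

/-- `tanh (x / 2)`, extended to `±∞`. -/
def tanhHalf (x : EReal) : ℝ := EReal.rec (-1) (fun r : ℝ => Real.tanh (r / 2)) 1 x

/-- The log-likelihood ratio `log ((1 + d) / (1 - d)) = 2 artanh d`, for `d ∈ [-1, 1]`. -/
def llrOfD (d : ℝ) : EReal := ENNReal.log (ENNReal.ofReal (1 + d) / ENNReal.ofReal (1 - d))

/-- The check node rule `2 artanh (tanh (x / 2) tanh (y / 2))`. -/
def checkOp (x y : EReal) : EReal := llrOfD (tanhHalf x * tanhHalf y)

/-- The density at the output of a check node with independent inputs of laws `m₁`, `m₂`. -/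
def checkConv (m₁ m₂ : Measure EReal) : Measure EReal :=
  (m₁.prod m₂).map (fun p => checkOp p.1 p.2)

/-- `k`-fold check node convolution; the empty one is `Δ_∞`. -/
def checkPow (m : Measure EReal) : ℕ → Measure EReal
  | 0 => Measure.dirac ⊤
  | k + 1 => checkConv (checkPow m k) m

/-- `k`-fold convolution; the empty one is `Δ_0`. -/
def convPow (m : Measure EReal) : ℕ → Measure EReal
  | 0 => Measure.dirac 0
  | k + 1 => (convPow m k).conv m

theorem measurable_tanhHalf : Measurable tanhHalf := by
  apply EReal.measurable_of_measurable_real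
  show Measurable fun r : ℝ => Real.tanh (r / 2)
  have h : (fun r : ℝ => Real.tanh (r / 2)) =
      fun r : ℝ => Real.sinh (r / 2) / Real.cosh (r / 2) := by
    funext r; exact Real.tanh_eq_sinh_div_cosh _
  rw [h]
  fun_prop

theorem measurable_checkOp : Measurable fun p : EReal × EReal => checkOp p.1 p.2 := by
  have h : Measurable llrOfD := by
    unfold llrOfD
    exact ENNReal.measurable_log.comp (by fun_prop)
  exact h.comp ((measurable_tanhHalf.comp measurable_fst).mul
    (measurable_tanhHalf.comp measurable_snd))

/-! ### Degree distributions and density evolution -/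

/-- An edge-perspective degree distribution `∑ i, p_i x^(i-1)`: the coefficient of `x^k` is the
fraction of edges that are attached to nodes of degree `k + 1`. -/
structure IsDegreeDistribution (p : ℝ[X]) : Prop where
  coeff_nonneg : ∀ k, 0 ≤ p.coeff k
  eval_one : p.eval 1 = 1

/-- `∫₀¹ p(x) dx`. -/
def polyIntegral (p : ℝ[X]) : ℝ := ∫ x in (0 : ℝ)..1, p.eval x

/-- The design rate `1 - ∫ρ / ∫λ`. -/
def designRate (lam rho : ℝ[X]) : ℝ := 1 - polyIntegral rho / polyIntegral lam

/-- The check node side: `∑ i, ρ_i m^{⊞ (i-1)}`. -/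
def checkMap (rho : ℝ[X]) (m : Measure EReal) : Measure EReal :=
  ∑ k ∈ rho.support, ENNReal.ofReal (rho.coeff k) • checkPow m k

/-- The variable node side: `∑ i, λ_i c ⋆ m^{⋆ (i-1)}`. -/
def variableMap (c : Measure EReal) (lam : ℝ[X]) (m : Measure EReal) : Measure EReal :=
  ∑ k ∈ lam.support, ENNReal.ofReal (lam.coeff k) • c.conv (convPow m k)

/-- One full iteration of density evolution. -/
def deStep (c : Measure EReal) (lam rho : ℝ[X]) (m : Measure EReal) : Measure EReal :=
  variableMap c lam (checkMap rho m)

/-- Density evolution: the variable-to-check density in iteration `n`, started from `c`. -/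
def densityEvolution (c : Measure EReal) (lam rho : ℝ[X]) (n : ℕ) : Measure EReal :=
  (deStep c lam rho)^[n] c

/-- Density evolution converges (weakly) to the perfect density `Δ_∞`. -/
def ConvergesToPerfect (c : Measure EReal) (lam rho : ℝ[X]) : Prop :=
  ∀ f : BoundedContinuousFunction EReal ℝ,
    Tendsto (fun n => ∫ x, f x ∂(densityEvolution c lam rho n)) atTop (𝓝 (f ⊤))

/-! ### The interpolating families -/

/-- `-t Δ_0 + (1 + t) c`, for `t ∈ [-1, 0]`. -/
def initialMix (c : Measure EReal) (t : ℝ) : Measure EReal :=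
  ENNReal.ofReal (-t) • Measure.dirac 0 + ENNReal.ofReal (1 + t) • c

/-- The family `a_α`, `α ≥ -1`: equal to `-α Δ_0 + (1 + α) c` on `[-1, 0]`, and continued by
`a_α = variableMap (checkMap a_{α-1})`. -/
def interpA (c : Measure EReal) (lam rho : ℝ[X]) (α : ℝ) : Measure EReal :=
  (deStep c lam rho)^[⌈α⌉₊] (initialMix c (α - ⌈α⌉₊))

/-- The family `b_α = ∑ i, ρ_i a_{α-1}^{⊞ (i-1)}`, `α ≥ 0`. -/
def interpB (c : Measure EReal) (lam rho : ℝ[X]) (α : ℝ) : Measure EReal :=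
  checkMap rho (interpA c lam rho (α - 1))

theorem interpA_of_nonpos (c : Measure EReal) (lam rho : ℝ[X]) {α : ℝ} (hα : α ≤ 0) :
    interpA c lam rho α = initialMix c α := by
  simp [interpA, Nat.ceil_eq_zero.2 hα]

theorem interpA_of_pos (c : Measure EReal) (lam rho : ℝ[X]) {α : ℝ} (hα : 0 < α) :
    interpA c lam rho α = variableMap c lam (interpB c lam rho α) := by
  have h : ⌈α⌉₊ = ⌈α - 1⌉₊ + 1 := by
    have h1 : ⌈α⌉₊ ≠ 0 := (Nat.ceil_pos.2 hα).ne'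
    have h2 : ⌈α - 1⌉₊ = ⌈α⌉₊ - 1 := by
      exact_mod_cast Nat.ceil_sub_natCast α 1
    omega
  have e : α - ((⌈α - 1⌉₊ + 1 : ℕ) : ℝ) = α - 1 - (⌈α - 1⌉₊ : ℝ) := by push_cast; ring
  unfold interpB interpA
  rw [h, Function.iterate_succ_apply', e]
  rfl

/-! ### The GEXIT functional and the two curves -/

/-- The left derivative of `f` at `t`. -/
def leftDeriv (f : ℝ → ℝ) (t : ℝ) : ℝ := derivWithin f (Iic t) t

/-- The normalized GEXIT kernel of the family `a` at the parameter `α`: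
`(∫ ∂a_α/∂α(w) log (1 + e^{-z-w}) dw) / (∫ ∂a_α/∂α(w) log (1 + e^{-w}) dw)`, where
`∫ ∂a_α/∂α(w) f(w) dw` stands for the derivative of `∫ a_α(w) f(w) dw`. The derivative is taken
from the left, since an interpolating family may have kinks at the integers; elsewhere
it is the ordinary derivative. -/
def gexitKernel (a : ℝ → Measure EReal) (α : ℝ) (z : EReal) : ℝ :=
  leftDeriv (fun t => softEntropy (a t) z) α / leftDeriv (fun t => entropy (a t)) α

/-- The GEXIT functional `G(a_α, m)`, the integral of the kernel of `a` at `α` against `m`. -/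
def gexit (a : ℝ → Measure EReal) (α : ℝ) (m : Measure EReal) : ℝ :=
  ∫ z, gexitKernel a α z ∂m

/-- The GEXIT curve of the check nodes, `(H(a_α), G(a_α, b_{α+1}))`, `α > -1`. -/
def checkCurve (c : Measure EReal) (lam rho : ℝ[X]) : Set (ℝ × ℝ) :=
  (fun α => (entropy (interpA c lam rho α),
    gexit (interpA c lam rho) α (interpB c lam rho (α + 1)))) '' Ioi (-1)

/-- The inverse of the dual GEXIT curve of the variable nodes, `(H(a_α), G(a_α, b_α))`, `α ≥ 0`. -/
def variableCurve (c : Measure EReal) (lam rho : ℝ[X]) : Set (ℝ × ℝ) :=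
  (fun α => (entropy (interpA c lam rho α),
    gexit (interpA c lam rho) α (interpB c lam rho α))) '' Ici 0

/-- The region between the horizontal axis and a curve. -/
def regionUnder (C : Set (ℝ × ℝ)) : Set (ℝ × ℝ) :=
  {p | 0 ≤ p.2 ∧ ∃ q ∈ C, p.1 = q.1 ∧ p.2 ≤ q.2}

/-- The region of the unit box to the left of a curve that rises from the bottom of the
box to its top edge and is a graph over the horizontal axis: the points of the box that lie
over the horizontal extent of the curve, on or above the curve. -/
def regionLeft (C : Set (ℝ × ℝ)) : Set (ℝ × ℝ) :=
  {p | p.2 ≤ 1 ∧ ∃ q ∈ C, p.1 = q.1 ∧ q.2 ≤ p.2}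

end Gexit

end

noncomputable section

namespace Gexit

/-! ### Pointwise identities -/

/-! Work with `D = tanh (x / 2)`. For a symmetric law the sign of `x` given `|x|` is that of a
binary symmetric channel, so the entropy is the mean of the binary entropy function of `D`. The
power series of that function writes the entropy as a positive combination of the gap moments `1 -
E[D^(2k+2)]` (`SymmLaw.hasSum_entropy`). At a check node `D` is multiplicative. The pointwise
identity `exitKernel_add` transfers this to variable nodes: the entropy of `m ⋆ n` is the same
combination of the products of the gap moments of `m` and `n` (`SymmLaw.hasSum_entropy_conv`). If `e
k` is the derivative of the `k`-th gap moment along the family, the GEXIT functional of `m` is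
therefore the quotient of two series: the numerator weighs each `e k` by the gap moment of `m`, and
the denominator does not.

The signs come from degradation, tested by even convex functions of `D`. Both node operations
preserve it, and the first segment of the family is ordered, so all gap moments decrease along the
family and `e k ≤ 0`. Strictness passes from one unit interval to the next
(`Ensemble.exists_deriv_gapMoment_neg`), so the entropy has negative left derivative until it
reaches zero and determines the parameter up to there. At a common abscissa with positive entropy
both ordinates belong to one parameter and have the same negative denominator; the gap moments of
`b_{α+1}` are at most those of `b_α`, so the curves do not cross (`Ensemble.gexit_le_gexit`).

On each interval between consecutive integers the family is a finite mixture of fixed symmetric laws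
with polynomial weights. All derivatives exist, and the product rule is a finite computation. It
yields explicit antiderivatives of ordinate times `-dH` (check side) and of one minus ordinate times
`-dH` (variable side): `checkPotential` and `variablePotential`. Both tend to zero along the
integers because density evolution converges to the perfect density. Their initial values, taken
where the incoming density is useless, give the two areas. The passage from parameter integrals to
planar measure is a change of variables by `t ↦ H(a_t)`, which ignores a null set of vertical lines.

Finally both regions lie in the unit box, and non-crossing makes them disjoint up to a null set.
Their areas therefore add up to at most one, which is `H(c) ∫λ ≤ ∫ρ`; the remainder of the box is
the gap to capacity. -/

@[simp] theorem tanhHalf_bot : tanhHalf ⊥ = -1 := rfl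

@[simp] theorem tanhHalf_top : tanhHalf ⊤ = 1 := rfl

theorem tanhHalf_coe (r : ℝ) : tanhHalf r = (Real.exp r - 1) / (Real.exp r + 1) := by
  change Real.tanh (r / 2) = _
  have h : Real.exp r = Real.exp (r / 2) * Real.exp (r / 2) := by
    rw [← Real.exp_add]; congr 1; ring
  have h2 : Real.exp (-(r / 2)) = (Real.exp (r / 2))⁻¹ := Real.exp_neg _
  have h3 := Real.exp_pos (r / 2)
  rw [Real.tanh_eq_sinh_div_cosh, Real.sinh_eq, Real.cosh_eq, h2, h]
  field_simp

theorem tanhHalf_coe_mem (r : ℝ) : tanhHalf r ∈ Ioo (-1 : ℝ) 1 := by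
  have h := Real.exp_pos r
  rw [tanhHalf_coe]
  constructor
  · rw [lt_div_iff₀ (by positivity)]; linarith
  · rw [div_lt_iff₀ (by positivity)]; linarith

theorem tanhHalf_mem (x : EReal) : tanhHalf x ∈ Icc (-1 : ℝ) 1 := by
  induction x using EReal.rec with
  | bot => simp
  | top => simp
  | coe r => exact Ioo_subset_Icc_self (tanhHalf_coe_mem r)

theorem neg_one_lt_tanhHalf {x : EReal} (hx : x ≠ ⊥) : -1 < tanhHalf x := by
  induction x using EReal.rec with
  | bot => exact absurd rfl hx
  | top => simp
  | coe r => exact (tanhHalf_coe_mem r).1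

theorem tanhHalf_neg (x : EReal) : tanhHalf (-x) = -tanhHalf x := by
  induction x using EReal.rec with
  | bot => simp
  | top => simp
  | coe r =>
    rw [← EReal.coe_neg, tanhHalf_coe, tanhHalf_coe, Real.exp_neg]
    have := Real.exp_pos r
    field_simp
    ring

@[simp] theorem tanhHalf_zero : tanhHalf 0 = 0 := by
  have := tanhHalf_coe 0
  simpa using this

theorem tanhHalf_eq_zero {x : EReal} (h : tanhHalf x = 0) : x = 0 := by
  induction x using EReal.rec with
  | bot => simp at h
  | top => simp at h
  | coe r =>
    have h0 := Real.exp_pos r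
    rw [tanhHalf_coe, div_eq_zero_iff] at h
    have h1 : Real.exp r = 1 := by rcases h with h | h <;> linarith
    rw [Real.exp_eq_one_iff] at h1
    simp [h1]

theorem tanhHalf_add {x y : EReal} (hx : x ≠ ⊥) (hy : y ≠ ⊥) :
    tanhHalf (x + y) = (tanhHalf x + tanhHalf y) / (1 + tanhHalf x * tanhHalf y) := by
  induction x using EReal.rec with
  | bot => exact absurd rfl hx
  | top =>
    have h := neg_one_lt_tanhHalf hy
    rw [EReal.top_add_of_ne_bot hy, tanhHalf_top, one_mul, div_self (by linarith)]
  | coe r =>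
    induction y using EReal.rec with
    | bot => exact absurd rfl hy
    | top =>
      have h := neg_one_lt_tanhHalf hx
      rw [EReal.add_top_of_ne_bot hx, tanhHalf_top, mul_one, add_comm _ (1 : ℝ),
        div_self (by linarith)]
    | coe s =>
      rw [← EReal.coe_add, tanhHalf_coe, tanhHalf_coe, tanhHalf_coe, Real.exp_add]
      have h1 := Real.exp_pos r
      have h2 := Real.exp_pos s
      have h3 : 1 + (Real.exp r - 1) / (Real.exp r + 1) * ((Real.exp s - 1) / (Real.exp s + 1)) =
          2 * (Real.exp r * Real.exp s + 1) / ((Real.exp r + 1) * (Real.exp s + 1)) := by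
        field_simp; ring
      rw [h3]
      field_simp
      ring

theorem llrOfD_neg (d : ℝ) : llrOfD (-d) = -llrOfD d := by
  unfold llrOfD
  rw [← ENNReal.log_inv, ENNReal.inv_div, sub_neg_eq_add, ← sub_eq_add_neg]
  · left; exact ENNReal.ofReal_ne_top
  · by_cases h : 0 < 1 - d
    · left; simpa using h
    · right; simp; linarith

theorem tanhHalf_llrOfD {d : ℝ} (hd : d ∈ Icc (-1 : ℝ) 1) : tanhHalf (llrOfD d) = d := by
  obtain ⟨h1, h2⟩ := hd
  unfold llrOfD
  rcases eq_or_lt_of_le h1 with h | h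
  · subst h; norm_num
  rcases eq_or_lt_of_le h2 with h' | h'
  · subst h'; norm_num [ENNReal.div_zero]
  have h3 : 0 < 1 + d := by linarith
  have h4 : 0 < 1 - d := by linarith
  rw [← ENNReal.ofReal_div_of_pos h4, ENNReal.log_ofReal_of_pos (by positivity), tanhHalf_coe,
    Real.exp_log (by positivity)]
  field_simp
  ring

theorem mul_mem_Icc_neg_one_one {u v : ℝ} (hu : u ∈ Icc (-1 : ℝ) 1) (hv : v ∈ Icc (-1 : ℝ) 1) :
    u * v ∈ Icc (-1 : ℝ) 1 := by
  rw [mem_Icc, ← abs_le] at *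
  rw [abs_mul]
  exact mul_le_one₀ hu (abs_nonneg _) hv

theorem tanhHalf_checkOp (x y : EReal) : tanhHalf (checkOp x y) = tanhHalf x * tanhHalf y :=
  tanhHalf_llrOfD (mul_mem_Icc_neg_one_one (tanhHalf_mem x) (tanhHalf_mem y))

theorem checkOp_neg_left (x y : EReal) : checkOp (-x) y = -checkOp x y := by
  unfold checkOp
  rw [tanhHalf_neg, neg_mul, llrOfD_neg]

theorem checkOp_neg_right (x y : EReal) : checkOp x (-y) = -checkOp x y := by
  unfold checkOp
  rw [tanhHalf_neg, mul_neg, llrOfD_neg]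

/-- This is `1 + D = 2 / (1 + e^{-x})`. The point `⊥` is excluded because `toReal` sends the
infinite exponential to zero there. -/
theorem exitKernel_eq {x : EReal} (hx : x ≠ ⊥) :
    exitKernel x = 1 - Real.logb 2 (1 + tanhHalf x) := by
  have h2 : Real.logb 2 2 = 1 := Real.logb_self_eq_one (by norm_num)
  unfold exitKernel
  induction x using EReal.rec with
  | bot => exact absurd rfl hx
  | top => norm_num
  | coe r =>
    have h5 := Real.exp_pos r
    rw [← EReal.coe_neg, EReal.exp_coe, ENNReal.toReal_ofReal (Real.exp_pos _).le, tanhHalf_coe,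
      Real.exp_neg]
    have h3 : 1 + (Real.exp r - 1) / (Real.exp r + 1) = 2 * Real.exp r / (Real.exp r + 1) := by
      field_simp; ring
    rw [h3]
    conv_rhs => lhs; rw [← h2]
    rw [← Real.logb_div (by norm_num) (by positivity)]
    congr 1
    field_simp

@[simp] theorem exitKernel_bot : exitKernel ⊥ = 0 := by simp [exitKernel]

@[simp] theorem exitKernel_top : exitKernel ⊤ = 0 := by simp [exitKernel]

theorem exitKernel_nonneg (x : EReal) : 0 ≤ exitKernel x :=
  Real.logb_nonneg (by norm_num) (by simp)

theorem measurable_exitKernel : Measurable exitKernel := by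
  unfold exitKernel
  have h : Measurable fun y : EReal => (EReal.exp (-y)).toReal :=
    (EReal.measurable_exp.comp measurable_neg).ennreal_toReal
  exact (Real.measurable_log.comp (measurable_const.add h)).div_const _

theorem checkOp_ne_bot {x y : EReal} (hx : x ≠ ⊥) (hy : y ≠ ⊥) : checkOp x y ≠ ⊥ := by
  intro h
  have h1 := tanhHalf_checkOp x y
  rw [h, tanhHalf_bot] at h1
  have := neg_one_lt_tanhHalf hx
  have := neg_one_lt_tanhHalf hy
  have := (tanhHalf_mem x).2
  have := (tanhHalf_mem y).2
  nlinarith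

/-- The pointwise form of the duality between variable and check nodes. -/
theorem exitKernel_add {x y : EReal} (hx : x ≠ ⊥) (hy : y ≠ ⊥) :
    exitKernel (x + y) = exitKernel x + exitKernel y - exitKernel (checkOp x y) := by
  have hu := neg_one_lt_tanhHalf hx
  have hv := neg_one_lt_tanhHalf hy
  have hu' := (tanhHalf_mem x).2
  have hv' := (tanhHalf_mem y).2
  have hxy : x + y ≠ ⊥ := by simp [EReal.add_eq_bot_iff, hx, hy]
  have h1 : 0 < 1 + tanhHalf x * tanhHalf y := by nlinarith
  rw [exitKernel_eq hx, exitKernel_eq hy, exitKernel_eq (checkOp_ne_bot hx hy),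
    exitKernel_eq hxy, tanhHalf_add hx hy, tanhHalf_checkOp]
  have h2 : 1 + (tanhHalf x + tanhHalf y) / (1 + tanhHalf x * tanhHalf y) =
      (1 + tanhHalf x) * (1 + tanhHalf y) / (1 + tanhHalf x * tanhHalf y) := by
    field_simp; ring
  rw [h2, Real.logb_div (by nlinarith) h1.ne', Real.logb_mul (by linarith) (by linarith)]
  ring

theorem continuous_tanhHalf : Continuous tanhHalf := by
  -- In this form the points `±∞` need no separate treatment: exponential and inversion are
  -- continuous in `ENNReal`, and the inverse stays finite.
  have h : tanhHalf = fun x => 1 - 2 * ((1 + EReal.exp x)⁻¹).toReal := by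
    funext x
    induction x using EReal.rec with
    | bot => simp; norm_num
    | top => simp
    | coe r =>
      have := Real.exp_pos r
      rw [tanhHalf_coe, EReal.exp_coe, ENNReal.toReal_inv, ENNReal.toReal_add (by simp) (by simp),
        ENNReal.toReal_ofReal this.le, ENNReal.toReal_one]
      field_simp
      ring
  rw [h]
  have h1 : Continuous fun x : EReal => (1 + EReal.exp x)⁻¹ :=
    (continuous_const.add ENNReal.continuous_exp).inv
  refine continuous_const.sub (continuous_const.mul ?_)
  refine ENNReal.continuousOn_toReal.comp_continuous h1 fun x => ?_
  simp

/-! ### The power series of the binary entropy function -/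

/-- The coefficients `1 / (log 2 · (2k+1)(2k+2))` of the expansion of the binary entropy
function. -/
def entropyCoeff (k : ℕ) : ℝ := 1 / (Real.log 2 * ((2 * k + 1) * (2 * k + 2)))

theorem entropyCoeff_pos (k : ℕ) : 0 < entropyCoeff k := by
  have : 0 < Real.log 2 := Real.log_pos (by norm_num)
  unfold entropyCoeff
  positivity

theorem summable_entropyCoeff : Summable entropyCoeff := by
  have h2 : 0 < Real.log 2 := Real.log_pos (by norm_num)
  have h : Summable fun n : ℕ => (1 / Real.log 2) * (1 / ((n + 1 : ℕ) : ℝ) ^ 2) :=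
    (((summable_nat_add_iff 1).2 (Real.summable_one_div_nat_pow.2 (by norm_num : 1 < 2)))).mul_left _
  refine Summable.of_nonneg_of_le (fun k => (entropyCoeff_pos k).le) (fun k => ?_) h
  unfold entropyCoeff
  rw [one_div_mul_one_div]
  apply one_div_le_one_div_of_le (by positivity)
  gcongr
  push_cast
  have : (0 : ℝ) ≤ k := by positivity
  nlinarith

/-- The binary entropy (in bits) of a binary symmetric channel with `|D| = d`. -/
def symEntropy (d : ℝ) : ℝ :=
  1 - ((1 + d) * Real.logb 2 (1 + d) + (1 - d) * Real.logb 2 (1 - d)) / 2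

theorem continuous_symEntropy : Continuous symEntropy := by
  unfold symEntropy Real.logb
  simp_rw [← mul_div_assoc]
  have h1 : Continuous fun d : ℝ => (1 + d) * Real.log (1 + d) :=
    Real.continuous_mul_log.comp (continuous_const.add continuous_id)
  have h2 : Continuous fun d : ℝ => (1 - d) * Real.log (1 - d) :=
    Real.continuous_mul_log.comp (continuous_const.sub continuous_id)
  fun_prop

/-- Up to the factor `1 / (2 log 2)`, the function is `log (1 - d²) + d (log (1 + d) - log (1 -
d))`. The two logarithmic series combine through `2 / (2k+1) - 1 / (k+1) = 1 / ((2k+1)(k+1))`. -/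
theorem hasSum_symEntropy_of_abs_lt_one {d : ℝ} (hd : |d| < 1) :
    HasSum (fun k => entropyCoeff k * d ^ (2 * (k + 1))) (1 - symEntropy d) := by
  have h2 : 0 < Real.log 2 := Real.log_pos (by norm_num)
  obtain ⟨hl, hr⟩ := abs_lt.1 hd
  have hd2 : |d ^ 2| < 1 := by
    rw [abs_pow]; exact pow_lt_one₀ (abs_nonneg _) hd (by norm_num)
  have e1 := (Real.hasSum_pow_div_log_of_abs_lt_one hd2).neg
  have e2 := (Real.hasSum_log_sub_log_of_abs_lt_one hd).mul_left d
  have e3 := (e1.add e2).mul_left (1 / (2 * Real.log 2))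
  have hlog : Real.log (1 - d ^ 2) = Real.log (1 + d) + Real.log (1 - d) := by
    rw [← Real.log_mul (by linarith) (by linarith)]; congr 1; ring
  convert! e3 using 1
  · funext k
    unfold entropyCoeff
    have : (0 : ℝ) ≤ k := by positivity
    field_simp
    ring
  · unfold symEntropy Real.logb
    rw [neg_neg, hlog]
    field_simp
    ring

/-- The endpoints, which correspond to perfect knowledge, are reached by continuity: the series
converges uniformly on the closed interval and agrees with a continuous function on the interior. -/
theorem tsum_symEntropy {d : ℝ} (hd : d ∈ Icc (-1 : ℝ) 1) :
    ∑' k, entropyCoeff k * d ^ (2 * (k + 1)) = 1 - symEntropy d := by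
  have hb : ∀ x ∈ Icc (-1 : ℝ) 1, ∀ n : ℕ, ‖entropyCoeff n * x ^ (2 * (n + 1))‖ ≤ entropyCoeff n := by
    intro x hx n
    rw [norm_mul, norm_pow, Real.norm_of_nonneg (entropyCoeff_pos n).le]
    exact mul_le_of_le_one_right (entropyCoeff_pos n).le
      (pow_le_one₀ (norm_nonneg _) (abs_le.2 hx))
  have hc : ContinuousOn (fun d : ℝ => ∑' k, entropyCoeff k * d ^ (2 * (k + 1))) (Icc (-1) 1) :=
    continuousOn_tsum (fun n => by fun_prop) summable_entropyCoeff (fun n x hx => hb x hx n)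
  have heq : EqOn (fun d : ℝ => ∑' k, entropyCoeff k * d ^ (2 * (k + 1)))
      (fun d => 1 - symEntropy d) (Ioo (-1) 1) := fun x hx =>
    (hasSum_symEntropy_of_abs_lt_one (abs_lt.2 hx)).tsum_eq
  exact heq.of_subset_closure hc (continuous_const.sub continuous_symEntropy).continuousOn
    Ioo_subset_Icc_self (by rw [closure_Ioo (by norm_num)]) hd

theorem symEntropy_one : symEntropy 1 = 0 := by
  unfold symEntropy; norm_num

theorem hasSum_entropyCoeff : HasSum entropyCoeff 1 := by
  have h := tsum_symEntropy (d := 1) (by norm_num)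
  simp only [one_pow, mul_one, symEntropy_one, sub_zero] at h
  exact h ▸ summable_entropyCoeff.hasSum

theorem hasSum_symEntropy {d : ℝ} (hd : d ∈ Icc (-1 : ℝ) 1) :
    HasSum (fun k => entropyCoeff k * (1 - d ^ (2 * (k + 1)))) (symEntropy d) := by
  have hs : Summable fun k => entropyCoeff k * d ^ (2 * (k + 1)) := by
    refine Summable.of_nonneg_of_le (fun k => mul_nonneg (entropyCoeff_pos k).le ?_) (fun k => ?_)
      summable_entropyCoeff
    · rw [pow_mul]; positivity
    · refine mul_le_of_le_one_right (entropyCoeff_pos k).le ?_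
      rw [pow_mul]
      exact pow_le_one₀ (sq_nonneg d) ((sq_le_one_iff_abs_le_one d).2 (abs_le.2 hd))
  have h := hasSum_entropyCoeff.sub (tsum_symEntropy hd ▸ hs.hasSum)
  convert! h using 1
  · funext k; ring
  · ring

theorem symEntropy_nonneg {d : ℝ} (hd : d ∈ Icc (-1 : ℝ) 1) : 0 ≤ symEntropy d := by
  refine (hasSum_symEntropy hd).nonneg fun k => mul_nonneg (entropyCoeff_pos k).le ?_
  rw [pow_mul, sub_nonneg]
  exact pow_le_one₀ (sq_nonneg d) ((sq_le_one_iff_abs_le_one d).2 (abs_le.2 hd))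

theorem symEntropy_le_one {d : ℝ} (hd : d ∈ Icc (-1 : ℝ) 1) : symEntropy d ≤ 1 := by
  refine hasSum_le (fun k => ?_) (hasSum_symEntropy hd) hasSum_entropyCoeff
  refine mul_le_of_le_one_right (entropyCoeff_pos k).le ?_
  rw [pow_mul]
  have : 0 ≤ (d ^ 2) ^ (k + 1) := by positivity
  linarith

/-! ### Symmetric laws -/

/-- The symmetry of an `L`-density, expressed in the `D`-domain. -/
structure SymmLaw (m : Measure EReal) : Prop where
  isProbability : IsProbabilityMeasure m
  lintegral_flip : ∀ f : EReal → ENNReal, Measurable f →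
    ∫⁻ x, ENNReal.ofReal (1 - tanhHalf x) * f (-x) ∂m =
      ∫⁻ x, ENNReal.ofReal (1 - tanhHalf x) * f x ∂m

theorem measurable_ofReal_one_sub : Measurable fun x => ENNReal.ofReal (1 - tanhHalf x) :=
  (measurable_const.sub measurable_tanhHalf).ennreal_ofReal

theorem measurable_ofReal_one_add : Measurable fun x => ENNReal.ofReal (1 + tanhHalf x) :=
  (measurable_const.add measurable_tanhHalf).ennreal_ofReal


/-- Test the flip identity on the indicator of `⊥`. After the flip only `x = ⊤` counts, where the
weight `1 - D` vanishes; before it the weight is `2`. -/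
theorem SymmLaw.bot_null {m : Measure EReal} (h : SymmLaw m) : m {⊥} = 0 := by
  have h1 := h.lintegral_flip (({⊥} : Set EReal).indicator 1)
    (measurable_one.indicator (measurableSet_singleton _))
  have e1 : ∀ x : EReal, ENNReal.ofReal (1 - tanhHalf x) *
      ({⊥} : Set EReal).indicator (1 : EReal → ENNReal) (-x) = 0 := by
    intro x
    by_cases hx : x = ⊤
    · simp [hx]
    · have : -x ∉ ({⊥} : Set EReal) := by simpa using hx
      simp [indicator_of_notMem this]
  have e2 : ∀ x : EReal, ENNReal.ofReal (1 - tanhHalf x) *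
      ({⊥} : Set EReal).indicator (1 : EReal → ENNReal) x =
      ({⊥} : Set EReal).indicator (fun _ => 2) x := by
    intro x
    by_cases hx : x = ⊥
    · subst hx; norm_num
    · simp [hx]
  simp_rw [e1, e2] at h1
  rw [lintegral_zero, lintegral_indicator_const (measurableSet_singleton _)] at h1
  simpa using h1.symm

theorem SymmLaw.ae_ne_bot {m : Measure EReal} (h : SymmLaw m) : ∀ᵐ x ∂m, x ≠ ⊥ := by
  rw [ae_iff]
  simpa using h.bot_null

theorem ofReal_half_add_half {x : EReal} :
    ENNReal.ofReal ((1 + tanhHalf x) / 2) + ENNReal.ofReal ((1 - tanhHalf x) / 2) = 1 := by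
  obtain ⟨h1, h2⟩ := tanhHalf_mem x
  rw [← ENNReal.ofReal_add (by linarith) (by linarith), ← add_div]
  norm_num

/-- Symmetrization: given `|x|`, the sign has the probabilities `(1 ± D) / 2`. The flip identity
turns the second summand into `(1 - D) / 2 * f x`, and the two weights add up to one. -/
theorem SymmLaw.lintegral_eq {m : Measure EReal} (h : SymmLaw m) {f : EReal → ENNReal}
    (hf : Measurable f) :
    ∫⁻ x, f x ∂m = ∫⁻ x, (ENNReal.ofReal ((1 + tanhHalf x) / 2) * f x +
      ENNReal.ofReal ((1 - tanhHalf x) / 2) * f (-x)) ∂m := by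
  have hm1 : Measurable fun x => ENNReal.ofReal ((1 + tanhHalf x) / 2) :=
    ((measurable_const.add measurable_tanhHalf).div_const _).ennreal_ofReal
  have hflip : ∫⁻ x, ENNReal.ofReal ((1 - tanhHalf x) / 2) * f (-x) ∂m =
      ∫⁻ x, ENNReal.ofReal ((1 - tanhHalf x) / 2) * f x ∂m := by
    have h1 := h.lintegral_flip (fun x => ENNReal.ofReal (1 / 2) * f x) (hf.const_mul _)
    simp only [← mul_assoc] at h1
    have e : ∀ x, ENNReal.ofReal ((1 - tanhHalf x) / 2) =
        ENNReal.ofReal (1 - tanhHalf x) * ENNReal.ofReal (1 / 2) := by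
      intro x
      rw [← ENNReal.ofReal_mul (by linarith [(tanhHalf_mem x).2])]
      congr 1; ring
    simpa only [e] using h1
  have hm2 : Measurable fun x => ENNReal.ofReal ((1 + tanhHalf x) / 2) * f x := hm1.mul hf
  rw [lintegral_add_left hm2, hflip, ← lintegral_add_left hm2]
  refine lintegral_congr fun x => ?_
  rw [← add_mul, ofReal_half_add_half, one_mul]

/-- The measure with density `1 - D` is invariant under negation, so no integrability of `f` is
needed. -/
theorem SymmLaw.integral_flip {m : Measure EReal} (h : SymmLaw m) {f : EReal → ℝ}
    (hf : Measurable f) :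
    ∫ x, (1 - tanhHalf x) * f (-x) ∂m = ∫ x, (1 - tanhHalf x) * f x ∂m := by
  have hmap : (m.withDensity fun x => ENNReal.ofReal (1 - tanhHalf x)).map (fun x => -x) =
      m.withDensity fun x => ENNReal.ofReal (1 - tanhHalf x) := by
    refine Measure.ext_of_lintegral _ fun g hg => ?_
    have hg' : Measurable fun x => g (-x) := hg.comp measurable_neg
    rw [lintegral_map hg measurable_neg,
      lintegral_withDensity_eq_lintegral_mul _ measurable_ofReal_one_sub hg,
      lintegral_withDensity_eq_lintegral_mul _ measurable_ofReal_one_sub hg']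
    exact h.lintegral_flip g hg
  have e : ∀ x, (ENNReal.ofReal (1 - tanhHalf x)).toReal = 1 - tanhHalf x := fun x =>
    ENNReal.toReal_ofReal (by linarith [(tanhHalf_mem x).2])
  have h1 := integral_map (μ := m.withDensity fun x => ENNReal.ofReal (1 - tanhHalf x))
    measurable_neg.aemeasurable (f := f) hf.aestronglyMeasurable
  rw [hmap, integral_withDensity_eq_integral_toReal_smul measurable_ofReal_one_sub (by simp),
    integral_withDensity_eq_integral_toReal_smul measurable_ofReal_one_sub (by simp)] at h1
  simpa only [e, smul_eq_mul] using h1.symm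

theorem integrable_of_bounded {m : Measure EReal} [IsFiniteMeasure m] {f : EReal → ℝ}
    (hf : Measurable f) {C : ℝ} (hC : ∀ x, |f x| ≤ C) : Integrable f m :=
  Integrable.of_bound hf.aestronglyMeasurable C (ae_of_all _ hC)

theorem SymmLaw.integral_eq {m : Measure EReal} (h : SymmLaw m) {f : EReal → ℝ}
    (hf : Measurable f) {C : ℝ} (hC : ∀ x, |f x| ≤ C) :
    ∫ x, f x ∂m = ∫ x, ((1 + tanhHalf x) / 2 * f x + (1 - tanhHalf x) / 2 * f (-x)) ∂m := by
  have := h.isProbability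
  have hi : ∀ g : EReal → ℝ, Measurable g → (∀ x, |g x| ≤ 1) → ∀ f' : EReal → ℝ,
      Measurable f' → (∀ x, |f' x| ≤ C) → Integrable (fun x => g x * f' x) m := by
    intro g hg hg1 f' hf' hC'
    refine integrable_of_bounded (hg.mul hf') (C := 1 * C) fun x => ?_
    rw [abs_mul]
    exact mul_le_mul (hg1 x) (hC' x) (abs_nonneg _) zero_le_one
  have hb : ∀ x, |(1 + tanhHalf x) / 2| ≤ 1 ∧ |(1 - tanhHalf x) / 2| ≤ 1 := by
    intro x
    obtain ⟨h1, h2⟩ := tanhHalf_mem x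
    constructor <;> rw [abs_le] <;> constructor <;> linarith
  have m1 : Measurable fun x => (1 + tanhHalf x) / 2 :=
    (measurable_const.add measurable_tanhHalf).div_const _
  have m2 : Measurable fun x => (1 - tanhHalf x) / 2 :=
    (measurable_const.sub measurable_tanhHalf).div_const _
  have hflip := h.integral_flip (f := fun x => f x / 2) (hf.div_const _)
  rw [integral_add (hi _ m1 (fun x => (hb x).1) f hf hC)
    (hi _ m2 (fun x => (hb x).2) (fun x => f (-x)) (hf.comp measurable_neg) fun x => hC _)]
  have e : ∀ x y : EReal, (1 - tanhHalf x) / 2 * f y = (1 - tanhHalf x) * (f y / 2) := by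
    intros; ring
  simp_rw [e]
  rw [hflip]
  simp_rw [← e]
  rw [← integral_add (hi _ m1 (fun x => (hb x).1) f hf hC)
    (hi _ m2 (fun x => (hb x).2) f hf hC)]
  congr 1
  funext x
  ring

/-- The atom at `⊤` has weight `1 - D = 0`, so only the finite part matters. There `e^{-x} (1 + D) =
1 - D` converts one form of symmetry into the other. -/
theorem IsSymmetricLDensity.symmLaw {m : Measure EReal} (h : IsSymmetricLDensity m) :
    SymmLaw m where
  isProbability := h.isProbability
  lintegral_flip f hf := by
    have hs : MeasurableSet ({⊤}ᶜ : Set EReal) := (measurableSet_singleton _).compl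
    have hres : ∀ g : EReal → ENNReal, ∫⁻ x, ENNReal.ofReal (1 - tanhHalf x) * g x ∂m =
        ∫⁻ x, ENNReal.ofReal (1 - tanhHalf x) * g x ∂(m.restrict {⊤}ᶜ) := by
      intro g
      rw [← lintegral_indicator hs]
      refine lintegral_congr fun x => ?_
      by_cases hx : x = ⊤
      · simp [hx]
      · rw [indicator_of_mem (by simpa using hx)]
    rw [hres f, hres (fun x => f (-x))]
    have hm : Measurable fun x => ENNReal.ofReal (1 + tanhHalf x) * f x :=
      measurable_ofReal_one_add.mul hf
    have h1 := lintegral_map (μ := m.restrict {⊤}ᶜ) hm measurable_neg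
    have hexp : Measurable fun y : EReal => EReal.exp (-y) :=
      EReal.measurable_exp.comp measurable_neg
    rw [h.symm, lintegral_withDensity_eq_lintegral_mul _ hexp hm] at h1
    simp only [tanhHalf_neg, ← sub_eq_add_neg] at h1
    rw [← h1]
    refine lintegral_congr_ae ?_
    have hbot : ∀ᵐ x ∂(m.restrict {⊤}ᶜ), x ≠ ⊥ := by
      refine ae_restrict_of_ae ?_
      rw [ae_iff]
      simpa using h.bot_null
    filter_upwards [hbot, ae_restrict_mem hs] with x hx hx'
    induction x using EReal.rec with
    | bot => exact absurd rfl hx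
    | top => simp at hx'
    | coe r =>
      have h0 := Real.exp_pos r
      simp only [Pi.mul_apply]
      rw [← mul_assoc, ← EReal.coe_neg, EReal.exp_coe, ← ENNReal.ofReal_mul (Real.exp_pos _).le]
      congr 2
      rw [tanhHalf_coe, Real.exp_neg]
      field_simp
      ring

/-! ### Convolutions -/

/-- The law of `op x y` for independent `x`, `y` of laws `m₁`, `m₂`. -/
def opConv (op : EReal → EReal → EReal) (m₁ m₂ : Measure EReal) : Measure EReal :=
  (m₁.prod m₂).map fun p => op p.1 p.2

theorem conv_eq_opConv (m₁ m₂ : Measure EReal) : m₁.conv m₂ = opConv (· + ·) m₁ m₂ := rfl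

theorem checkConv_eq_opConv (m₁ m₂ : Measure EReal) :
    checkConv m₁ m₂ = opConv checkOp m₁ m₂ := rfl

theorem measurable_add_ereal : Measurable fun p : EReal × EReal => p.1 + p.2 := measurable_add

theorem lintegral_opConv {op : EReal → EReal → EReal}
    (hop : Measurable fun p : EReal × EReal => op p.1 p.2) (m₁ m₂ : Measure EReal) [SFinite m₂]
    {f : EReal → ENNReal} (hf : Measurable f) :
    ∫⁻ x, f x ∂(opConv op m₁ m₂) = ∫⁻ x, ∫⁻ y, f (op x y) ∂m₂ ∂m₁ := by
  unfold opConv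
  have h : Measurable fun p : EReal × EReal => f (op p.1 p.2) := hf.comp hop
  rw [lintegral_map hf hop, lintegral_prod _ h.aemeasurable]

theorem isProbability_opConv {op : EReal → EReal → EReal}
    (hop : Measurable fun p : EReal × EReal => op p.1 p.2) (m₁ m₂ : Measure EReal)
    [IsProbabilityMeasure m₁] [IsProbabilityMeasure m₂] :
    IsProbabilityMeasure (opConv op m₁ m₂) :=
  Measure.isProbabilityMeasure_map hop.aemeasurable


theorem lintegral_flip_fst {m n : Measure EReal} (hm : SymmLaw m) [SFinite n]
    {F : EReal × EReal → ENNReal} (hF : Measurable F) :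
    ∫⁻ x, ∫⁻ y, ENNReal.ofReal (1 - tanhHalf x) * F (-x, y) ∂n ∂m =
      ∫⁻ x, ∫⁻ y, ENNReal.ofReal (1 - tanhHalf x) * F (x, y) ∂n ∂m := by
  have h1 : ∀ x, Measurable fun y => F (x, y) := fun x => hF.comp (by fun_prop)
  have h2 : Measurable fun x => ∫⁻ y, F (x, y) ∂n := hF.lintegral_prod_right'
  simp_rw [fun x => lintegral_const_mul (μ := n) (ENNReal.ofReal (1 - tanhHalf x)) (h1 x),
    fun x => lintegral_const_mul (μ := n) (ENNReal.ofReal (1 - tanhHalf x)) (h1 (-x))]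
  exact hm.lintegral_flip _ h2

theorem lintegral_flip_snd {m n : Measure EReal} (hn : SymmLaw n)
    {F : EReal × EReal → ENNReal} (hF : Measurable F) :
    ∫⁻ x, ∫⁻ y, ENNReal.ofReal (1 - tanhHalf y) * F (x, -y) ∂n ∂m =
      ∫⁻ x, ∫⁻ y, ENNReal.ofReal (1 - tanhHalf y) * F (x, y) ∂n ∂m :=
  lintegral_congr fun x => hn.lintegral_flip (fun y => F (x, y)) (hF.comp (by fun_prop))

/-- With `u`, `v` the two values of `D`, `1 - u v = (1 - u)(1 + v) / 2 + (1 - v)(1 + u) / 2`. Each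
summand carries the flip weight of one variable, and negating that variable negates the output. -/
theorem SymmLaw.checkConv {m n : Measure EReal} (hm : SymmLaw m) (hn : SymmLaw n) :
    SymmLaw (checkConv m n) := by
  have := hm.isProbability
  have := hn.isProbability
  rw [checkConv_eq_opConv]
  refine ⟨isProbability_opConv measurable_checkOp m n, fun f hf => ?_⟩
  have mu : Measurable fun p : EReal × EReal => tanhHalf p.1 :=
    measurable_tanhHalf.comp measurable_fst
  have mv : Measurable fun p : EReal × EReal => tanhHalf p.2 :=
    measurable_tanhHalf.comp measurable_snd
  have key : ∀ g : EReal → ENNReal, Measurable g →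
      ∫⁻ x, ENNReal.ofReal (1 - tanhHalf x) * g x ∂(opConv checkOp m n) =
      (∫⁻ x, ∫⁻ y, ENNReal.ofReal (1 - tanhHalf x) *
        (ENNReal.ofReal ((1 + tanhHalf y) / 2) * g (checkOp x y)) ∂n ∂m) +
      ∫⁻ x, ∫⁻ y, ENNReal.ofReal (1 - tanhHalf y) *
        (ENNReal.ofReal ((1 + tanhHalf x) / 2) * g (checkOp x y)) ∂n ∂m := by
    intro g hg
    have hg1 : Measurable fun x => ENNReal.ofReal (1 - tanhHalf x) * g x :=
      measurable_ofReal_one_sub.mul hg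
    rw [lintegral_opConv measurable_checkOp _ _ hg1]
    have hgc : Measurable fun p : EReal × EReal => g (checkOp p.1 p.2) :=
      hg.comp measurable_checkOp
    have h1 : Measurable fun p : EReal × EReal => ENNReal.ofReal (1 - tanhHalf p.1) *
        (ENNReal.ofReal ((1 + tanhHalf p.2) / 2) * g (checkOp p.1 p.2)) :=
      Measurable.mul (by fun_prop) (Measurable.mul (by fun_prop) hgc)
    rw [← lintegral_add_left h1.lintegral_prod_right']
    refine lintegral_congr fun x => ?_
    have h1x : Measurable fun y => ENNReal.ofReal (1 - tanhHalf x) *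
        (ENNReal.ofReal ((1 + tanhHalf y) / 2) * g (checkOp x y)) :=
      h1.comp (measurable_const.prodMk measurable_id)
    rw [← lintegral_add_left h1x]
    refine lintegral_congr fun y => ?_
    obtain ⟨hu1, hu2⟩ := tanhHalf_mem x
    obtain ⟨hv1, hv2⟩ := tanhHalf_mem y
    rw [← mul_assoc, ← mul_assoc, ← ENNReal.ofReal_mul (by linarith),
      ← ENNReal.ofReal_mul (by linarith), ← add_mul, ← ENNReal.ofReal_add, tanhHalf_checkOp]
    · congr 2; ring
    · exact mul_nonneg (by linarith) (by linarith)
    · exact mul_nonneg (by linarith) (by linarith)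
  have hfc : Measurable fun p : EReal × EReal => f (checkOp p.1 p.2) :=
    hf.comp measurable_checkOp
  have F1 : Measurable fun p : EReal × EReal =>
      ENNReal.ofReal ((1 + tanhHalf p.2) / 2) * f (checkOp p.1 p.2) :=
    Measurable.mul (by fun_prop) hfc
  have F2 : Measurable fun p : EReal × EReal =>
      ENNReal.ofReal ((1 + tanhHalf p.1) / 2) * f (checkOp p.1 p.2) :=
    Measurable.mul (by fun_prop) hfc
  rw [key f hf, key (fun x => f (-x)) (hf.comp measurable_neg)]
  have e1 := lintegral_flip_fst (n := n) hm F1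
  have e2 := lintegral_flip_snd (m := m) hn F2
  simp only [checkOp_neg_left] at e1
  simp only [checkOp_neg_right] at e2
  rw [e1, e2]

/-- Here `1 - D(x + y) = (1 - u)(1 - v) / (1 + u v)` carries both flip weights. Negating `x` and
then `y` negates the sum; the denominator becomes `1 - u v` after one flip and is restored by the
other. -/
theorem SymmLaw.conv {m n : Measure EReal} (hm : SymmLaw m) (hn : SymmLaw n) :
    SymmLaw (m.conv n) := by
  have := hm.isProbability
  have := hn.isProbability
  rw [conv_eq_opConv]
  refine ⟨isProbability_opConv measurable_add_ereal m n, fun f hf => ?_⟩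
  have mu : Measurable fun p : EReal × EReal => tanhHalf p.1 :=
    measurable_tanhHalf.comp measurable_fst
  have mv : Measurable fun p : EReal × EReal => tanhHalf p.2 :=
    measurable_tanhHalf.comp measurable_snd
  have key : ∀ g : EReal → ENNReal, Measurable g →
      ∫⁻ x, ENNReal.ofReal (1 - tanhHalf x) * g x ∂(opConv (· + ·) m n) =
      ∫⁻ x, ∫⁻ y, ENNReal.ofReal (1 - tanhHalf x) * (ENNReal.ofReal (1 - tanhHalf y) *
        (ENNReal.ofReal (1 / (1 + tanhHalf x * tanhHalf y)) * g (x + y))) ∂n ∂m := by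
    intro g hg
    have hg1 : Measurable fun x => ENNReal.ofReal (1 - tanhHalf x) * g x :=
      measurable_ofReal_one_sub.mul hg
    rw [lintegral_opConv measurable_add_ereal _ _ hg1]
    refine lintegral_congr_ae ?_
    filter_upwards [hm.ae_ne_bot] with x hx
    refine lintegral_congr_ae ?_
    filter_upwards [hn.ae_ne_bot] with y hy
    have hu1 := neg_one_lt_tanhHalf hx
    have hv1 := neg_one_lt_tanhHalf hy
    have hu2 := (tanhHalf_mem x).2
    have hv2 := (tanhHalf_mem y).2
    have hpos : 0 < 1 + tanhHalf x * tanhHalf y := by nlinarith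
    rw [← mul_assoc, ← mul_assoc, ← ENNReal.ofReal_mul (by linarith),
      ← ENNReal.ofReal_mul (mul_nonneg (by linarith) (by linarith)), tanhHalf_add hx hy]
    congr 2
    field_simp
    ring
  have hfc : Measurable fun p : EReal × EReal => f (p.1 + p.2) := hf.comp measurable_add
  have hfc' : Measurable fun p : EReal × EReal => f (p.1 + -p.2) :=
    hf.comp (measurable_fst.add measurable_snd.neg)
  have F1 : Measurable fun p : EReal × EReal => ENNReal.ofReal (1 - tanhHalf p.2) *
      (ENNReal.ofReal (1 / (1 + tanhHalf p.1 * -tanhHalf p.2)) * f (p.1 + -p.2)) := by fun_prop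
  have F2 : Measurable fun p : EReal × EReal => ENNReal.ofReal (1 - tanhHalf p.1) *
      (ENNReal.ofReal (1 / (1 + tanhHalf p.1 * tanhHalf p.2)) * f (p.1 + p.2)) := by fun_prop
  rw [key f hf, key (fun x => f (-x)) (hf.comp measurable_neg)]
  have e1 := lintegral_flip_fst (n := n) hm F1
  have e2 := lintegral_flip_snd (m := m) hn F2
  simp only [tanhHalf_neg, neg_mul_neg] at e1 e2
  calc _ = ∫⁻ x, ∫⁻ y, ENNReal.ofReal (1 - tanhHalf x) * (ENNReal.ofReal (1 - tanhHalf y) *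
        (ENNReal.ofReal (1 / (1 + tanhHalf x * tanhHalf y)) * f (-x + -y))) ∂n ∂m := by
        refine lintegral_congr_ae ?_
        filter_upwards [hm.ae_ne_bot] with x hx
        refine lintegral_congr_ae ?_
        filter_upwards [hn.ae_ne_bot] with y hy
        rw [EReal.neg_add (Or.inl hx) (Or.inr hy), sub_eq_add_neg (-x)]
    _ = _ := e1
    _ = ∫⁻ x, ∫⁻ y, ENNReal.ofReal (1 - tanhHalf y) * (ENNReal.ofReal (1 - tanhHalf x) *
        (ENNReal.ofReal (1 / (1 + tanhHalf x * -tanhHalf y)) * f (x + -y))) ∂n ∂m := by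
        exact lintegral_congr fun x => lintegral_congr fun y => mul_left_comm _ _ _
    _ = _ := e2
    _ = _ := lintegral_congr fun x => lintegral_congr fun y => mul_left_comm _ _ _

theorem symmLaw_dirac_zero : SymmLaw (Measure.dirac 0) := by
  refine ⟨inferInstance, fun f hf => ?_⟩
  rw [lintegral_dirac, lintegral_dirac, neg_zero]

theorem symmLaw_dirac_top : SymmLaw (Measure.dirac ⊤) := by
  refine ⟨inferInstance, fun f hf => ?_⟩
  rw [lintegral_dirac, lintegral_dirac]
  simp

theorem SymmLaw.sum_smul {ι : Type*} (s : Finset ι) (w : ι → ℝ) (ν : ι → Measure EReal)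
    (hν : ∀ i ∈ s, SymmLaw (ν i)) (hw : ∀ i ∈ s, 0 ≤ w i) (h1 : ∑ i ∈ s, w i = 1) :
    SymmLaw (∑ i ∈ s, ENNReal.ofReal (w i) • ν i) := by
  constructor
  · constructor
    rw [Measure.finsetSum_apply]
    have : ∀ i ∈ s, (ENNReal.ofReal (w i) • ν i) univ = ENNReal.ofReal (w i) := by
      intro i hi
      have := (hν i hi).isProbability
      simp
    rw [Finset.sum_congr rfl this, ← ENNReal.ofReal_sum_of_nonneg hw, h1, ENNReal.ofReal_one]
  · intro f hf
    rw [lintegral_finsetSum_measure, lintegral_finsetSum_measure]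
    refine Finset.sum_congr rfl fun i hi => ?_
    rw [lintegral_smul_measure, lintegral_smul_measure, (hν i hi).lintegral_flip f hf]

theorem SymmLaw.checkPow {m : Measure EReal} (hm : SymmLaw m) (k : ℕ) :
    SymmLaw (checkPow m k) := by
  induction k with
  | zero => exact symmLaw_dirac_top
  | succ k ih => exact ih.checkConv hm

theorem SymmLaw.convPow {m : Measure EReal} (hm : SymmLaw m) (k : ℕ) :
    SymmLaw (convPow m k) := by
  induction k with
  | zero => exact symmLaw_dirac_zero
  | succ k ih => exact ih.conv hm

theorem IsDegreeDistribution.sum_coeff {p : ℝ[X]} (hp : IsDegreeDistribution p) :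
    ∑ k ∈ p.support, p.coeff k = 1 := by
  have h := hp.eval_one
  rw [eval_eq_sum, Polynomial.sum_def] at h
  simpa using h

theorem SymmLaw.checkMap {m : Measure EReal} (hm : SymmLaw m) {rho : ℝ[X]}
    (hrho : IsDegreeDistribution rho) : SymmLaw (checkMap rho m) :=
  SymmLaw.sum_smul _ _ _ (fun k _ => hm.checkPow k) (fun k _ => hrho.coeff_nonneg k)
    hrho.sum_coeff

theorem SymmLaw.variableMap {c m : Measure EReal} (hc : SymmLaw c) (hm : SymmLaw m) {lam : ℝ[X]}
    (hlam : IsDegreeDistribution lam) : SymmLaw (variableMap c lam m) :=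
  SymmLaw.sum_smul _ _ _ (fun k _ => hc.conv (hm.convPow k)) (fun k _ => hlam.coeff_nonneg k)
    hlam.sum_coeff

/-! ### Moments and entropy -/

/-- The moments `∫ (1 - D^{2k+2}) dm`, all equal to `1` for the useless and to `0` for the perfect
density. -/
def gapMoment (k : ℕ) (m : Measure EReal) : ℝ := ∫ x, (1 - tanhHalf x ^ (2 * (k + 1))) ∂m

theorem tanhHalf_pow_mem (k : ℕ) (x : EReal) : tanhHalf x ^ (2 * (k + 1)) ∈ Icc (0 : ℝ) 1 := by
  rw [pow_mul]
  have h := (sq_le_one_iff_abs_le_one _).2 (abs_le.2 (tanhHalf_mem x))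
  exact ⟨by positivity, pow_le_one₀ (sq_nonneg _) h⟩

theorem measurable_tanhHalf_pow (k : ℕ) : Measurable fun x => tanhHalf x ^ (2 * (k + 1)) :=
  measurable_tanhHalf.pow_const _

/-- Functions that are integrable against every symmetric density. -/
structure SymmIntegrable (f : EReal → ℝ) : Prop where
  integrable : ∀ m, SymmLaw m → Integrable f m

theorem SymmIntegrable.of_bounded {f : EReal → ℝ} (hf : Measurable f) {C : ℝ}
    (hC : ∀ x, |f x| ≤ C) : SymmIntegrable f :=
  ⟨fun _ hm => have := hm.isProbability; integrable_of_bounded hf hC⟩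

theorem symmIntegrable_pow (k : ℕ) : SymmIntegrable fun x => tanhHalf x ^ (2 * (k + 1)) :=
  .of_bounded (measurable_tanhHalf_pow k) (C := 1) fun x => by
    rw [abs_of_nonneg (tanhHalf_pow_mem k x).1]; exact (tanhHalf_pow_mem k x).2

theorem symmIntegrable_gap (k : ℕ) : SymmIntegrable fun x => 1 - tanhHalf x ^ (2 * (k + 1)) :=
  .of_bounded (measurable_const.sub (measurable_tanhHalf_pow k)) (C := 1) fun x => by
    obtain ⟨h1, h2⟩ := tanhHalf_pow_mem k x
    rw [abs_le]; constructor <;> linarith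

theorem SymmLaw.gapMoment_eq {m : Measure EReal} (hm : SymmLaw m) (k : ℕ) :
    gapMoment k m = 1 - ∫ x, tanhHalf x ^ (2 * (k + 1)) ∂m := by
  have := hm.isProbability
  unfold gapMoment
  rw [integral_sub (integrable_const _) ((symmIntegrable_pow k).integrable m hm)]
  simp

theorem SymmLaw.gapMoment_nonneg {m : Measure EReal} (_ : SymmLaw m) (k : ℕ) :
    0 ≤ gapMoment k m :=
  integral_nonneg fun x => sub_nonneg.2 (tanhHalf_pow_mem k x).2

theorem SymmLaw.gapMoment_le_one {m : Measure EReal} (hm : SymmLaw m) (k : ℕ) :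
    gapMoment k m ≤ 1 := by
  rw [hm.gapMoment_eq, sub_le_self_iff]
  exact integral_nonneg fun x => (tanhHalf_pow_mem k x).1

/-- `D` is multiplicative at a check node, so by independence its even moments are multiplicative
too. -/
theorem SymmLaw.gapMoment_checkConv {m n : Measure EReal} (hm : SymmLaw m) (hn : SymmLaw n)
    (k : ℕ) : 1 - gapMoment k (Gexit.checkConv m n) = (1 - gapMoment k m) * (1 - gapMoment k n) := by
  have := hm.isProbability
  have := hn.isProbability
  rw [(hm.checkConv hn).gapMoment_eq, hm.gapMoment_eq, hn.gapMoment_eq]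
  unfold Gexit.checkConv
  rw [integral_map measurable_checkOp.aemeasurable
    (measurable_tanhHalf_pow k).aestronglyMeasurable]
  simp only [tanhHalf_checkOp, mul_pow, sub_sub_cancel]
  exact integral_prod_mul (μ := m) (ν := n) (fun x => tanhHalf x ^ (2 * (k + 1)))
    fun x => tanhHalf x ^ (2 * (k + 1))

theorem exitKernel_symmetrize (x : EReal) :
    (1 + tanhHalf x) / 2 * exitKernel x + (1 - tanhHalf x) / 2 * exitKernel (-x) =
      symEntropy (tanhHalf x) := by
  induction x using EReal.rec with
  | bot => norm_num [symEntropy]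
  | top => norm_num [symEntropy]
  | coe r =>
    rw [exitKernel_eq (by simp), exitKernel_eq (by simp), tanhHalf_neg]
    unfold symEntropy
    rw [← sub_eq_add_neg]
    ring

theorem measurable_symEntropy_tanhHalf : Measurable fun x => symEntropy (tanhHalf x) :=
  continuous_symEntropy.measurable.comp measurable_tanhHalf

theorem symmIntegrable_symEntropy : SymmIntegrable fun x => symEntropy (tanhHalf x) :=
  .of_bounded measurable_symEntropy_tanhHalf (C := 1) fun x => by
    rw [abs_of_nonneg (symEntropy_nonneg (tanhHalf_mem x))]
    exact symEntropy_le_one (tanhHalf_mem x)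

theorem SymmLaw.lintegral_exitKernel {m : Measure EReal} (hm : SymmLaw m) :
    ∫⁻ x, ENNReal.ofReal (exitKernel x) ∂m = ∫⁻ x, ENNReal.ofReal (symEntropy (tanhHalf x)) ∂m := by
  rw [hm.lintegral_eq measurable_exitKernel.ennreal_ofReal]
  refine lintegral_congr fun x => ?_
  obtain ⟨h1, h2⟩ := tanhHalf_mem x
  rw [← ENNReal.ofReal_mul (by linarith), ← ENNReal.ofReal_mul (by linarith),
    ← ENNReal.ofReal_add, exitKernel_symmetrize]
  · exact mul_nonneg (by linarith) (exitKernel_nonneg _)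
  · exact mul_nonneg (by linarith) (exitKernel_nonneg _)

/-- The kernel is unbounded for very negative arguments. Symmetry makes those rare: the symmetrized
kernel is the binary entropy function, which is bounded. -/
theorem symmIntegrable_exitKernel : SymmIntegrable exitKernel := by
  refine ⟨fun m hm => ⟨measurable_exitKernel.aestronglyMeasurable, ?_⟩⟩
  rw [hasFiniteIntegral_iff_ofReal (ae_of_all _ exitKernel_nonneg), hm.lintegral_exitKernel,
    ← hasFiniteIntegral_iff_ofReal
      (ae_of_all _ fun x => symEntropy_nonneg (tanhHalf_mem x))]
  exact (symmIntegrable_symEntropy.integrable m hm).2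

theorem SymmLaw.entropy_eq {m : Measure EReal} (hm : SymmLaw m) :
    entropy m = ∫ x, symEntropy (tanhHalf x) ∂m := by
  unfold entropy
  rw [integral_eq_lintegral_of_nonneg_ae (ae_of_all _ exitKernel_nonneg)
    measurable_exitKernel.aestronglyMeasurable, hm.lintegral_exitKernel,
    ← integral_eq_lintegral_of_nonneg_ae
      (ae_of_all _ fun x => symEntropy_nonneg (tanhHalf_mem x))
      measurable_symEntropy_tanhHalf.aestronglyMeasurable]

theorem SymmLaw.hasSum_entropy {m : Measure EReal} (hm : SymmLaw m) :
    HasSum (fun k => entropyCoeff k * gapMoment k m) (entropy m) := by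
  have := hm.isProbability
  have hF : ∀ k, Integrable (fun x => entropyCoeff k * (1 - tanhHalf x ^ (2 * (k + 1)))) m :=
    fun k => ((symmIntegrable_gap k).integrable m hm).const_mul _
  have h := hasSum_integral_of_summable_integral_norm (μ := m) hF ?_
  · simp_rw [integral_const_mul] at h
    convert! h using 1
    rw [hm.entropy_eq]
    exact integral_congr_ae (ae_of_all _ fun x => (hasSum_symEntropy (tanhHalf_mem x)).tsum_eq.symm)
  · refine Summable.of_nonneg_of_le (fun k => integral_nonneg fun x => norm_nonneg _) (fun k => ?_)
      summable_entropyCoeff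
    have : ∀ x, ‖entropyCoeff k * (1 - tanhHalf x ^ (2 * (k + 1)))‖ =
        entropyCoeff k * (1 - tanhHalf x ^ (2 * (k + 1))) := fun x =>
      Real.norm_of_nonneg (mul_nonneg (entropyCoeff_pos k).le
        (sub_nonneg.2 (tanhHalf_pow_mem k x).2))
    simp_rw [this, integral_const_mul]
    exact mul_le_of_le_one_right (entropyCoeff_pos k).le (hm.gapMoment_le_one k)

theorem SymmLaw.entropy_nonneg {m : Measure EReal} (_ : SymmLaw m) : 0 ≤ entropy m :=
  integral_nonneg exitKernel_nonneg

theorem SymmLaw.entropy_le_one {m : Measure EReal} (hm : SymmLaw m) : entropy m ≤ 1 :=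
  hasSum_le (fun k => mul_le_of_le_one_right (entropyCoeff_pos k).le (hm.gapMoment_le_one k))
    hm.hasSum_entropy hasSum_entropyCoeff

theorem integrable_exitKernel_add {m n : Measure EReal} (hm : SymmLaw m) (hn : SymmLaw n) :
    Integrable (fun p : EReal × EReal => exitKernel (p.1 + p.2)) (m.prod n) := by
  have h := symmIntegrable_exitKernel.integrable _ (hm.conv hn)
  rw [conv_eq_opConv] at h
  exact (integrable_map_measure measurable_exitKernel.aestronglyMeasurable
    measurable_add_ereal.aemeasurable).1 h

theorem integrable_exitKernel_checkOp {m n : Measure EReal} (hm : SymmLaw m) (hn : SymmLaw n) :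
    Integrable (fun p : EReal × EReal => exitKernel (checkOp p.1 p.2)) (m.prod n) :=
  (integrable_map_measure measurable_exitKernel.aestronglyMeasurable
    measurable_checkOp.aemeasurable).1 (symmIntegrable_exitKernel.integrable _ (hm.checkConv hn))

theorem entropy_conv_eq_integral_prod (m n : Measure EReal) :
    entropy (m.conv n) = ∫ p, exitKernel (p.1 + p.2) ∂(m.prod n) := by
  rw [conv_eq_opConv]
  exact integral_map measurable_add_ereal.aemeasurable measurable_exitKernel.aestronglyMeasurable

theorem SymmLaw.entropy_conv_eq_integral {m n : Measure EReal} (hm : SymmLaw m) (hn : SymmLaw n) :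
    entropy (m.conv n) = ∫ z, softEntropy n z ∂m := by
  have := hm.isProbability
  have := hn.isProbability
  rw [entropy_conv_eq_integral_prod, integral_prod _ (integrable_exitKernel_add hm hn)]
  rfl

theorem SymmLaw.symmIntegrable_softEntropy {n : Measure EReal} (hn : SymmLaw n) :
    SymmIntegrable (softEntropy n) :=
  ⟨fun _ hm => have := hm.isProbability; have := hn.isProbability
    (integrable_exitKernel_add hm hn).integral_prod_left⟩

theorem symmIntegrable_exitKernel_add (z : EReal) : SymmIntegrable fun w => exitKernel (z + w) := by
  refine ⟨fun m hm => ?_⟩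
  have := hm.isProbability
  by_cases hz : z = ⊥
  -- `⊥` absorbs addition and the kernel has the value `0` there, so the integrand is identically
  -- zero.
  · simp [hz]
  · refine ((integrable_const (exitKernel z)).add
      (symmIntegrable_exitKernel.integrable m hm)).mono'
      (measurable_exitKernel.comp (measurable_const.add measurable_id)).aestronglyMeasurable ?_
    filter_upwards [hm.ae_ne_bot] with w hw
    rw [Real.norm_of_nonneg (exitKernel_nonneg _), exitKernel_add hz hw]
    simpa using exitKernel_nonneg _

/-- The duality between variable and check nodes. -/
theorem SymmLaw.entropy_conv_add_entropy_checkConv {m n : Measure EReal} (hm : SymmLaw m)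
    (hn : SymmLaw n) :
    entropy (m.conv n) = entropy m + entropy n - entropy (Gexit.checkConv m n) := by
  have := hm.isProbability
  have := hn.isProbability
  have h1 : Integrable (fun p : EReal × EReal => exitKernel p.1) (m.prod n) :=
    (symmIntegrable_exitKernel.integrable m hm).comp_fst n
  have h2 : Integrable (fun p : EReal × EReal => exitKernel p.2) (m.prod n) :=
    (symmIntegrable_exitKernel.integrable n hn).comp_snd m
  have hb1 : ∀ᵐ p ∂(m.prod n), p.1 ≠ ⊥ := Measure.quasiMeasurePreserving_fst.ae hm.ae_ne_bot
  have hb2 : ∀ᵐ p ∂(m.prod n), p.2 ≠ ⊥ := Measure.quasiMeasurePreserving_snd.ae hn.ae_ne_bot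
  have e3 : entropy (Gexit.checkConv m n) = ∫ p, exitKernel (checkOp p.1 p.2) ∂(m.prod n) :=
    integral_map measurable_checkOp.aemeasurable measurable_exitKernel.aestronglyMeasurable
  have e1 : ∫ p, exitKernel p.1 ∂(m.prod n) = entropy m := by
    rw [integral_fun_fst]; simp [entropy]
  have e2 : ∫ p, exitKernel p.2 ∂(m.prod n) = entropy n := by
    rw [integral_fun_snd]; simp [entropy]
  have h12 : Integrable (fun p : EReal × EReal => exitKernel p.1 + exitKernel p.2) (m.prod n) :=
    h1.add h2
  rw [entropy_conv_eq_integral_prod, e3, ← e1, ← e2, ← integral_add h1 h2,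
    ← integral_sub h12 (integrable_exitKernel_checkOp hm hn)]
  refine integral_congr_ae ?_
  filter_upwards [hb1, hb2] with p hp1 hp2
  exact exitKernel_add hp1 hp2

/-- Duality makes the expansion bilinear in the gap moments `p`, `q` of the factors: `p + q - (1 -
(1 - p)(1 - q)) = p q`. All later signs and comparisons rest on this. -/
theorem SymmLaw.hasSum_entropy_conv {m n : Measure EReal} (hm : SymmLaw m) (hn : SymmLaw n) :
    HasSum (fun k => entropyCoeff k * (gapMoment k m * gapMoment k n)) (entropy (m.conv n)) := by
  rw [hm.entropy_conv_add_entropy_checkConv hn]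
  convert! (hm.hasSum_entropy.add hn.hasSum_entropy).sub (hm.checkConv hn).hasSum_entropy using 1
  funext k
  have := hm.gapMoment_checkConv hn k
  linear_combination -entropyCoeff k * this

/-! ### Degradation -/

theorem opConv_comm {op : EReal → EReal → EReal}
    (hop : Measurable fun p : EReal × EReal => op p.1 p.2) (hc : ∀ x y, op x y = op y x)
    (m n : Measure EReal) [SFinite m] [SFinite n] : opConv op m n = opConv op n m := by
  unfold opConv
  rw [← Measure.prod_swap, Measure.map_map hop measurable_swap]
  congr 1
  funext p
  exact hc _ _

theorem checkOp_comm (x y : EReal) : checkOp x y = checkOp y x := by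
  unfold checkOp; rw [mul_comm]

theorem checkConv_comm (m n : Measure EReal) [SFinite m] [SFinite n] :
    checkConv m n = checkConv n m :=
  opConv_comm measurable_checkOp checkOp_comm m n

/-- Even functions that are convex on `[-1, 1]`. -/
structure EvenConvex (φ : ℝ → ℝ) : Prop where
  measurable : Measurable φ
  convexOn : ConvexOn ℝ (Icc (-1) 1) φ
  even : ∀ u, φ (-u) = φ u

/-- `m` is degraded with respect to `n`. -/
def Degraded (m n : Measure EReal) : Prop :=
  ∀ φ, EvenConvex φ → ∫ x, φ (tanhHalf x) ∂m ≤ ∫ x, φ (tanhHalf x) ∂n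

theorem EvenConvex.map_combo_le {φ : ℝ → ℝ} (hφ : EvenConvex φ) {x y a b : ℝ}
    (hx : x ∈ Icc (-1 : ℝ) 1) (hy : y ∈ Icc (-1 : ℝ) 1) (ha : 0 ≤ a) (hb : 0 ≤ b)
    (hab : a + b = 1) : φ (a * x + b * y) ≤ a * φ x + b * φ y :=
  hφ.convexOn.2 hx hy ha hb hab

theorem EvenConvex.zero_le {φ : ℝ → ℝ} (hφ : EvenConvex φ) {u : ℝ} (hu : u ∈ Icc (-1 : ℝ) 1) :
    φ 0 ≤ φ u := by
  have hu' : -u ∈ Icc (-1 : ℝ) 1 := ⟨by linarith [hu.2], by linarith [hu.1]⟩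
  have h := hφ.map_combo_le hu hu' (a := 1 / 2) (b := 1 / 2) (by norm_num) (by norm_num)
    (by norm_num)
  simp only [hφ.even] at h
  calc φ 0 = φ (1 / 2 * u + 1 / 2 * -u) := by congr 1; ring
    _ ≤ _ := h
    _ = φ u := by ring

theorem EvenConvex.le_one {φ : ℝ → ℝ} (hφ : EvenConvex φ) {u : ℝ} (hu : u ∈ Icc (-1 : ℝ) 1) :
    φ u ≤ φ 1 := by
  have h := hφ.map_combo_le (x := 1) (y := -1) (by norm_num) (by norm_num) (a := (1 + u) / 2)
    (b := (1 - u) / 2) (by linarith [hu.1]) (by linarith [hu.2]) (by ring)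
  simp only [hφ.even] at h
  calc φ u = φ ((1 + u) / 2 * 1 + (1 - u) / 2 * -1) := by congr 1; ring
    _ ≤ _ := h
    _ = φ 1 := by ring

theorem EvenConvex.abs_le {φ : ℝ → ℝ} (hφ : EvenConvex φ) {u : ℝ} (hu : u ∈ Icc (-1 : ℝ) 1) :
    |φ u| ≤ max |φ 0| |φ 1| :=
  abs_le_max_abs_abs (hφ.zero_le hu) (hφ.le_one hu)

theorem EvenConvex.symmIntegrable {φ : ℝ → ℝ} (hφ : EvenConvex φ) :
    SymmIntegrable fun x => φ (tanhHalf x) :=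
  .of_bounded (hφ.measurable.comp measurable_tanhHalf) fun x => hφ.abs_le (tanhHalf_mem x)

theorem evenConvex_pow (k : ℕ) : EvenConvex fun u => u ^ (2 * (k + 1)) where
  measurable := measurable_id.pow_const _
  convexOn := (Even.convexOn_pow (even_two_mul _)).subset (subset_univ _) (convex_Icc _ _)
  even u := (even_two_mul _).neg_pow u

theorem Degraded.refl (m : Measure EReal) : Degraded m m := fun _ _ => le_rfl

theorem Degraded.trans {m n p : Measure EReal} (h : Degraded m n) (h' : Degraded n p) :
    Degraded m p := fun φ hφ => (h φ hφ).trans (h' φ hφ)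

theorem Degraded.gapMoment_le {m n : Measure EReal} (h : Degraded m n) (hm : SymmLaw m)
    (hn : SymmLaw n) (k : ℕ) : gapMoment k n ≤ gapMoment k m := by
  rw [hm.gapMoment_eq, hn.gapMoment_eq]
  linarith [h _ (evenConvex_pow k)]

/-- The value of the variable node operation in the `D`-domain. -/
def addD (u v : ℝ) : ℝ := (u + v) / (1 + u * v)

theorem measurable_addD : Measurable fun p : ℝ × ℝ => addD p.1 p.2 := by
  unfold addD
  fun_prop

theorem one_add_mul_nonneg {u v : ℝ} (hu : u ∈ Icc (-1 : ℝ) 1) (hv : v ∈ Icc (-1 : ℝ) 1) :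
    0 ≤ 1 + u * v := by
  linarith [(mul_mem_Icc_neg_one_one hu hv).1]

theorem addD_mem {u v : ℝ} (hu : u ∈ Icc (-1 : ℝ) 1) (hv : v ∈ Icc (-1 : ℝ) 1) :
    addD u v ∈ Icc (-1 : ℝ) 1 := by
  unfold addD
  have h := one_add_mul_nonneg hu hv
  obtain ⟨a, b⟩ := hu
  obtain ⟨c, d⟩ := hv
  -- If the denominator vanishes, division by zero gives `0`, which also lies in the interval.
  rcases eq_or_lt_of_le h with h0 | h0
  · rw [← h0]; norm_num
  · constructor
    · rw [le_div_iff₀ h0]; nlinarith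
    · rw [div_le_iff₀ h0]; nlinarith

theorem one_add_mul_mul_addD {u v : ℝ} (hu : u ∈ Icc (-1 : ℝ) 1) (hv : v ∈ Icc (-1 : ℝ) 1) :
    (1 + u * v) * addD u v = u + v := by
  unfold addD
  by_cases h : 1 + u * v = 0
  · rw [h, zero_mul]
    obtain ⟨a, b⟩ := hu
    obtain ⟨c, d⟩ := hv
    -- When `u v = -1`, both `u + v` and its negative are products of nonnegative factors. So the
    -- numerator vanishes as well, in agreement with the zero on the left.
    have h1 : (1 - u) * (1 - v) = -(u + v) := by linear_combination h
    have h2 : (1 + u) * (1 + v) = u + v := by linear_combination h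
    have h3 := mul_nonneg (sub_nonneg.2 b) (sub_nonneg.2 d)
    have h4 : 0 ≤ (1 + u) * (1 + v) := mul_nonneg (by linarith) (by linarith)
    linarith
  · field_simp

theorem addD_neg_neg (u v : ℝ) : addD (-u) (-v) = -addD u v := by
  unfold addD
  rw [neg_mul_neg, ← neg_add, neg_div]

/-- The perspective of an even convex function is convex. -/
theorem EvenConvex.convexOn_perspective {φ : ℝ → ℝ} (hφ : EvenConvex φ) {v : ℝ}
    (hv : v ∈ Icc (-1 : ℝ) 1) :
    ConvexOn ℝ (Icc (-1) 1) fun u => (1 + u * v) * φ (addD u v) := by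
  refine ⟨convex_Icc _ _, fun x hx y hy a b ha hb hab => ?_⟩
  have hz := convex_Icc (-1 : ℝ) 1 hx hy ha hb hab
  simp only [smul_eq_mul] at hz ⊢
  have w1 := one_add_mul_nonneg hx hv
  have w2 := one_add_mul_nonneg hy hv
  have w := one_add_mul_nonneg hz hv
  have e : 1 + (a * x + b * y) * v = a * (1 + x * v) + b * (1 + y * v) := by
    linear_combination -hab
  rcases eq_or_lt_of_le w with h0 | h0
  · rw [← h0, zero_mul]
    have h1 : a * (1 + x * v) = 0 := by nlinarith [mul_nonneg ha w1, mul_nonneg hb w2]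
    have h2 : b * (1 + y * v) = 0 := by nlinarith [mul_nonneg ha w1, mul_nonneg hb w2]
    rw [← mul_assoc, ← mul_assoc, h1, h2]
    simp
  -- Convexity is applied with the weights `a`, `b` tilted by the factors `1 + x v`, `1 + y v`.
  -- Numerator and denominator of `addD` are affine in the first variable, so the tilted mean of its
  -- values is its value at the mean.
  · have key := hφ.map_combo_le (addD_mem hx hv) (addD_mem hy hv)
      (a := a * (1 + x * v) / (1 + (a * x + b * y) * v))
      (b := b * (1 + y * v) / (1 + (a * x + b * y) * v)) (by positivity) (by positivity)
      (by rw [← add_div, ← e, div_self h0.ne'])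
    have e2 : a * (1 + x * v) / (1 + (a * x + b * y) * v) * addD x v +
        b * (1 + y * v) / (1 + (a * x + b * y) * v) * addD y v = addD (a * x + b * y) v := by
      have i1 := one_add_mul_mul_addD hx hv
      have i2 := one_add_mul_mul_addD hy hv
      rw [div_mul_eq_mul_div, div_mul_eq_mul_div, ← add_div, mul_assoc, mul_assoc, i1, i2]
      unfold addD
      congr 1
      linear_combination v * hab
    rw [e2] at key
    calc _ ≤ (1 + (a * x + b * y) * v) *
          (a * (1 + x * v) / (1 + (a * x + b * y) * v) * φ (addD x v) +
          b * (1 + y * v) / (1 + (a * x + b * y) * v) * φ (addD y v)) :=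
          mul_le_mul_of_nonneg_left key h0.le
      _ = _ := by field_simp

/-- Averages of even convex functions. -/
theorem evenConvex_integral {n : Measure EReal} [IsProbabilityMeasure n] {R : ℝ → EReal → ℝ}
    (hR : Measurable fun p : ℝ × EReal => R p.1 p.2) {C : ℝ}
    (hC : ∀ u ∈ Icc (-1 : ℝ) 1, ∀ y, |R u y| ≤ C)
    (hconv : ∀ y, ConvexOn ℝ (Icc (-1) 1) fun u => R u y) (heven : ∀ u y, R (-u) y = R u y) :
    EvenConvex fun u => ∫ y, R u y ∂n where
  measurable := (hR.stronglyMeasurable.integral_prod_right').measurable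
  even u := by simp only [heven]
  convexOn := by
    have hi : ∀ u ∈ Icc (-1 : ℝ) 1, Integrable (R u) n := fun u hu =>
      integrable_of_bounded (hR.comp (measurable_const.prodMk measurable_id)) (hC u hu)
    refine ⟨convex_Icc _ _, fun x hx y hy a b ha hb hab => ?_⟩
    simp only [smul_eq_mul]
    rw [← integral_const_mul, ← integral_const_mul,
      ← integral_add ((hi x hx).const_mul _) ((hi y hy).const_mul _)]
    refine integral_mono (hi _ (convex_Icc _ _ hx hy ha hb hab))
      (((hi x hx).const_mul _).add ((hi y hy).const_mul _)) fun z => ?_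
    exact (hconv z).2 hx hy ha hb hab

/-- Symmetrize in both variables; evenness of `φ` folds the four sign patterns into two. Without
symmetrization the integrand would lack the weights that make it even and convex in the `D`-value of
`x`. -/
theorem EvenConvex.integral_conv {φ : ℝ → ℝ} (hφ : EvenConvex φ) {m n : Measure EReal}
    (hm : SymmLaw m) (hn : SymmLaw n) :
    ∫ x, φ (tanhHalf x) ∂(m.conv n) = ∫ x, ∫ y,
      ((1 + tanhHalf x * tanhHalf y) * φ (addD (tanhHalf x) (tanhHalf y)) +
      (1 + tanhHalf x * -tanhHalf y) * φ (addD (tanhHalf x) (-tanhHalf y))) / 2 ∂n ∂m := by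
  have := hm.isProbability
  have := hn.isProbability
  set C := max |φ 0| |φ 1|
  set g : EReal → EReal → ℝ := fun x y => φ (addD (tanhHalf x) (tanhHalf y)) with hg
  have hgm : Measurable fun p : EReal × EReal => g p.1 p.2 :=
    hφ.measurable.comp (measurable_addD.comp ((measurable_tanhHalf.comp measurable_fst).prodMk
      (measurable_tanhHalf.comp measurable_snd)))
  have hgx : ∀ x, Measurable (g x) := fun x => hgm.comp (measurable_const.prodMk measurable_id)
  have hgC : ∀ x y, |g x y| ≤ C := fun x y => hφ.abs_le (addD_mem (tanhHalf_mem x) (tanhHalf_mem y))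
  have hgi : Integrable (fun p : EReal × EReal => g p.1 p.2) (m.prod n) :=
    Integrable.of_bound hgm.aestronglyMeasurable C (ae_of_all _ fun p => hgC _ _)
  have hb1 : ∀ᵐ p ∂(m.prod n), p.1 ≠ ⊥ := Measure.quasiMeasurePreserving_fst.ae hm.ae_ne_bot
  have hb2 : ∀ᵐ p ∂(m.prod n), p.2 ≠ ⊥ := Measure.quasiMeasurePreserving_snd.ae hn.ae_ne_bot
  have e1 : ∫ x, φ (tanhHalf x) ∂(m.conv n) = ∫ x, ∫ y, g x y ∂n ∂m := by
    have hmeas : AEStronglyMeasurable (fun x => φ (tanhHalf x)) (opConv (· + ·) m n) :=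
      (hφ.measurable.comp measurable_tanhHalf).aestronglyMeasurable
    rw [← integral_prod _ hgi, conv_eq_opConv, opConv,
      integral_map measurable_add_ereal.aemeasurable hmeas]
    refine integral_congr_ae ?_
    filter_upwards [hb1, hb2] with p hp1 hp2
    rw [tanhHalf_add hp1 hp2]
    rfl
  have hf1 : Measurable fun x => ∫ y, g x y ∂n :=
    (hgm.stronglyMeasurable.integral_prod_right').measurable
  rw [e1, hm.integral_eq hf1 (C := C)]
  · congr 1
    funext x
    rw [hn.integral_eq (hgx x) (hgC x), hn.integral_eq (hgx (-x)) (hgC (-x)),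
      ← integral_const_mul, ← integral_const_mul, ← integral_add]
    · congr 1
      funext y
      have s1 : g (-x) (-y) = g x y := by
        simp only [hg, tanhHalf_neg, addD_neg_neg, hφ.even]
      have s2 : g (-x) y = g x (-y) := by
        simp only [hg, tanhHalf_neg]
        rw [← hφ.even, ← addD_neg_neg, neg_neg]
      have s3 : φ (addD (tanhHalf x) (-tanhHalf y)) = g x (-y) := by simp only [hg, tanhHalf_neg]
      have s4 : φ (addD (tanhHalf x) (tanhHalf y)) = g x y := rfl
      rw [s1, s2, s3, s4]
      ring
    all_goals
      refine Integrable.const_mul (integrable_of_bounded (C := C + C) ?_ fun y => ?_) _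
      · have m1 := hgx x
        have m2 := hgx (-x)
        have m3 := measurable_tanhHalf
        fun_prop
      · obtain ⟨h1, h2⟩ := tanhHalf_mem y
        refine (abs_add_le _ _).trans (add_le_add ?_ ?_) <;>
        · rw [abs_mul]
          refine (mul_le_of_le_one_left (abs_nonneg _) ?_).trans (hgC _ _)
          rw [_root_.abs_le]; constructor <;> linarith
  · intro x
    have h := norm_integral_le_of_norm_le_const (μ := n) (f := g x) (C := C)
      (ae_of_all _ fun y => hgC x y)
    simpa using h

/-- After integrating out the second variable, the test function is again even and convex in the
first one, by convexity of the perspective. So the assumption on `m`, `m'` applies to it. -/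
theorem Degraded.conv_right {m m' n : Measure EReal} (h : Degraded m m') (hm : SymmLaw m)
    (hm' : SymmLaw m') (hn : SymmLaw n) : Degraded (m.conv n) (m'.conv n) := by
  intro φ hφ
  have := hn.isProbability
  rw [hφ.integral_conv hm hn, hφ.integral_conv hm' hn]
  refine h (fun u => ∫ y, ((1 + u * tanhHalf y) * φ (addD u (tanhHalf y)) +
      (1 + u * -tanhHalf y) * φ (addD u (-tanhHalf y))) / 2 ∂n)
    (evenConvex_integral (C := 2 * max |φ 0| |φ 1|) ?_ ?_ ?_ ?_)
  · have m1 : Measurable fun p : ℝ × EReal => φ (addD p.1 (tanhHalf p.2)) :=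
      hφ.measurable.comp (measurable_addD.comp (measurable_fst.prodMk
        (measurable_tanhHalf.comp measurable_snd)))
    have m2 : Measurable fun p : ℝ × EReal => φ (addD p.1 (-tanhHalf p.2)) :=
      hφ.measurable.comp (measurable_addD.comp (measurable_fst.prodMk
        (measurable_tanhHalf.comp measurable_snd).neg))
    have m3 : Measurable fun p : ℝ × EReal => tanhHalf p.2 :=
      measurable_tanhHalf.comp measurable_snd
    exact (((measurable_const.add (measurable_fst.mul m3)).mul m1).add
      ((measurable_const.add (measurable_fst.mul m3.neg)).mul m2)).div_const _
  · intro u hu y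
    have hv := tanhHalf_mem y
    have hv' : -tanhHalf y ∈ Icc (-1 : ℝ) 1 := ⟨by linarith [hv.2], by linarith [hv.1]⟩
    have a1 : |(1 + u * tanhHalf y) * φ (addD u (tanhHalf y))| ≤ 2 * max |φ 0| |φ 1| := by
      rw [abs_mul]
      refine mul_le_mul ?_ (hφ.abs_le (addD_mem hu hv)) (abs_nonneg _) (by norm_num)
      rw [abs_of_nonneg (one_add_mul_nonneg hu hv)]
      linarith [(mul_mem_Icc_neg_one_one hu hv).2]
    have a2 : |(1 + u * -tanhHalf y) * φ (addD u (-tanhHalf y))| ≤ 2 * max |φ 0| |φ 1| := by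
      rw [abs_mul]
      refine mul_le_mul ?_ (hφ.abs_le (addD_mem hu hv')) (abs_nonneg _) (by norm_num)
      rw [abs_of_nonneg (one_add_mul_nonneg hu hv')]
      linarith [(mul_mem_Icc_neg_one_one hu hv').2]
    rw [_root_.abs_le] at *
    constructor <;> linarith [a1.1, a1.2, a2.1, a2.2]
  · intro y
    have hv := tanhHalf_mem y
    have hv' : -tanhHalf y ∈ Icc (-1 : ℝ) 1 := ⟨by linarith [hv.2], by linarith [hv.1]⟩
    have h1 := ((hφ.convexOn_perspective hv).add (hφ.convexOn_perspective hv')).smul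
      (c := (1 / 2 : ℝ)) (by norm_num)
    refine h1.congr fun u _ => ?_
    simp only [Pi.add_apply, smul_eq_mul]
    ring
  · intro u y
    have s1 : φ (addD (-u) (tanhHalf y)) = φ (addD u (-tanhHalf y)) := by
      rw [← hφ.even, ← addD_neg_neg, neg_neg]
    have s2 : φ (addD (-u) (-tanhHalf y)) = φ (addD u (tanhHalf y)) := by
      rw [addD_neg_neg, hφ.even]
    rw [s1, s2]
    ring

/-- `u ↦ φ (u v)` is even and convex, and averaging over `v` keeps both properties. -/
theorem Degraded.checkConv_right {m m' n : Measure EReal} (h : Degraded m m') (hm : SymmLaw m)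
    (hm' : SymmLaw m') (hn : SymmLaw n) : Degraded (checkConv m n) (checkConv m' n) := by
  intro φ hφ
  have := hn.isProbability
  have key : ∀ p : Measure EReal, SymmLaw p → ∫ x, φ (tanhHalf x) ∂(checkConv p n) =
      ∫ x, ∫ y, φ (tanhHalf x * tanhHalf y) ∂n ∂p := by
    intro p hp
    have := hp.isProbability
    have hmeas : Measurable fun x => φ (tanhHalf x) := hφ.measurable.comp measurable_tanhHalf
    unfold checkConv
    rw [integral_map measurable_checkOp.aemeasurable hmeas.aestronglyMeasurable]
    simp only [tanhHalf_checkOp]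
    refine integral_prod _ (Integrable.of_bound (C := max |φ 0| |φ 1|) ?_ (ae_of_all _ fun q => ?_))
    · exact (hφ.measurable.comp ((measurable_tanhHalf.comp measurable_fst).mul
        (measurable_tanhHalf.comp measurable_snd))).aestronglyMeasurable
    · exact hφ.abs_le (mul_mem_Icc_neg_one_one (tanhHalf_mem _) (tanhHalf_mem _))
  rw [key m hm, key m' hm']
  refine h (fun u => ∫ y, φ (u * tanhHalf y) ∂n)
    (evenConvex_integral (C := max |φ 0| |φ 1|) ?_ ?_ ?_ ?_)
  · exact hφ.measurable.comp (measurable_fst.mul (measurable_tanhHalf.comp measurable_snd))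
  · exact fun u hu y => hφ.abs_le (mul_mem_Icc_neg_one_one hu (tanhHalf_mem y))
  · intro y
    refine ⟨convex_Icc _ _, fun u hu w hw a b ha hb hab => ?_⟩
    have h1 := hφ.convexOn.2 (mul_mem_Icc_neg_one_one hu (tanhHalf_mem y))
      (mul_mem_Icc_neg_one_one hw (tanhHalf_mem y)) ha hb hab
    simp only [smul_eq_mul] at h1 ⊢
    convert h1 using 2
    ring
  · intro u y
    rw [neg_mul, hφ.even]

theorem Degraded.convPow {m n : Measure EReal} (h : Degraded m n) (hm : SymmLaw m)
    (hn : SymmLaw n) (k : ℕ) : Degraded (convPow m k) (convPow n k) := by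
  induction k with
  | zero => exact Degraded.refl _
  | succ k ih =>
    have := hm.isProbability
    have := hn.isProbability
    have := (hn.convPow k).isProbability
    -- Hybrid argument: replace the first `k` factors, then the last one; commutativity brings that
    -- one to the left.
    have h1 := ih.conv_right (hm.convPow k) (hn.convPow k) hm
    have h2 := h.conv_right hm hn (hn.convPow k)
    rw [Measure.conv_comm m, Measure.conv_comm n] at h2
    exact h1.trans h2

theorem Degraded.checkPow {m n : Measure EReal} (h : Degraded m n) (hm : SymmLaw m)
    (hn : SymmLaw n) (k : ℕ) : Degraded (checkPow m k) (checkPow n k) := by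
  induction k with
  | zero => exact Degraded.refl _
  | succ k ih =>
    have := hm.isProbability
    have := hn.isProbability
    have := (hn.checkPow k).isProbability
    have h1 := ih.checkConv_right (hm.checkPow k) (hn.checkPow k) hm
    have h2 := h.checkConv_right hm hn (hn.checkPow k)
    rw [checkConv_comm m, checkConv_comm n] at h2
    exact h1.trans h2

theorem integral_sum_smul {ι : Type*} (s : Finset ι) (w : ι → ℝ) (ν : ι → Measure EReal)
    (hw : ∀ i ∈ s, 0 ≤ w i) {f : EReal → ℝ} (hf : ∀ i ∈ s, Integrable f (ν i)) :
    ∫ x, f x ∂(∑ i ∈ s, ENNReal.ofReal (w i) • ν i) = ∑ i ∈ s, w i * ∫ x, f x ∂(ν i) := by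
  rw [integral_finsetSum_measure fun i hi => (hf i hi).smul_measure ENNReal.ofReal_ne_top]
  refine Finset.sum_congr rfl fun i hi => ?_
  rw [integral_smul_measure, ENNReal.toReal_ofReal (hw i hi), smul_eq_mul]

theorem Degraded.sum_smul {ι : Type*} (s : Finset ι) (w : ι → ℝ) (ν ν' : ι → Measure EReal)
    (hν : ∀ i ∈ s, SymmLaw (ν i)) (hν' : ∀ i ∈ s, SymmLaw (ν' i)) (hw : ∀ i ∈ s, 0 ≤ w i)
    (h : ∀ i ∈ s, Degraded (ν i) (ν' i)) :
    Degraded (∑ i ∈ s, ENNReal.ofReal (w i) • ν i) (∑ i ∈ s, ENNReal.ofReal (w i) • ν' i) := by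
  intro φ hφ
  rw [integral_sum_smul s w ν hw fun i hi => hφ.symmIntegrable.integrable _ (hν i hi),
    integral_sum_smul s w ν' hw fun i hi => hφ.symmIntegrable.integrable _ (hν' i hi)]
  exact Finset.sum_le_sum fun i hi => mul_le_mul_of_nonneg_left (h i hi φ hφ) (hw i hi)

theorem Degraded.checkMap {m n : Measure EReal} (h : Degraded m n) (hm : SymmLaw m)
    (hn : SymmLaw n) {rho : ℝ[X]} (hrho : IsDegreeDistribution rho) :
    Degraded (checkMap rho m) (checkMap rho n) :=
  Degraded.sum_smul _ _ _ _ (fun k _ => hm.checkPow k) (fun k _ => hn.checkPow k)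
    (fun k _ => hrho.coeff_nonneg k) fun k _ => h.checkPow hm hn k

theorem Degraded.variableMap {c m n : Measure EReal} (hc : SymmLaw c) (h : Degraded m n)
    (hm : SymmLaw m) (hn : SymmLaw n) {lam : ℝ[X]} (hlam : IsDegreeDistribution lam) :
    Degraded (variableMap c lam m) (variableMap c lam n) := by
  refine Degraded.sum_smul _ _ _ _ (fun k _ => hc.conv (hm.convPow k))
    (fun k _ => hc.conv (hn.convPow k)) (fun k _ => hlam.coeff_nonneg k) fun k _ => ?_
  have := hc.isProbability
  have := (hm.convPow k).isProbability
  have := (hn.convPow k).isProbability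
  rw [Measure.conv_comm c, Measure.conv_comm c]
  exact (h.convPow hm hn k).conv_right (hm.convPow k) (hn.convPow k) hc

/-! ### Polynomial families of symmetric densities -/

/-- On `I`, the family `a` is a finite mixture of symmetric densities whose weights are polynomials
in the parameter. -/
def PolyMix (I : Set ℝ) (a : ℝ → Measure EReal) : Prop :=
  ∃ (ι : Type) (_ : Fintype ι) (p : ι → ℝ[X]) (ν : ι → Measure EReal), (∀ i, SymmLaw (ν i)) ∧
    (∀ t ∈ I, ∀ i, 0 ≤ (p i).eval t) ∧
    ∀ t ∈ I, a t = ∑ i, ENNReal.ofReal ((p i).eval t) • ν i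

theorem PolyMix.const (I : Set ℝ) {m : Measure EReal} (hm : SymmLaw m) :
    PolyMix I fun _ => m :=
  ⟨Unit, inferInstance, fun _ => 1, fun _ => m, fun _ => hm, by simp, by simp⟩

theorem PolyMix.zero (I : Set ℝ) : PolyMix I fun _ => 0 :=
  ⟨Empty, inferInstance, Empty.elim, Empty.elim, fun i => i.elim, fun _ _ i => i.elim, by simp⟩

theorem PolyMix.add {I : Set ℝ} {a b : ℝ → Measure EReal} (ha : PolyMix I a) (hb : PolyMix I b) :
    PolyMix I fun t => a t + b t := by
  obtain ⟨ι, _, p, ν, h1, h2, h3⟩ := ha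
  obtain ⟨κ, _, q, μ, k1, k2, k3⟩ := hb
  refine ⟨ι ⊕ κ, inferInstance, Sum.elim p q, Sum.elim ν μ, ?_, ?_, ?_⟩
  · rintro (i | i)
    exacts [h1 i, k1 i]
  · rintro t ht (i | i)
    exacts [h2 t ht i, k2 t ht i]
  · intro t ht
    simp [h3 t ht, k3 t ht, Fintype.sum_sum_type]

theorem PolyMix.smul {I : Set ℝ} {a : ℝ → Measure EReal} (ha : PolyMix I a) {q : ℝ[X]}
    (hq : ∀ t ∈ I, 0 ≤ q.eval t) : PolyMix I fun t => ENNReal.ofReal (q.eval t) • a t := by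
  obtain ⟨ι, _, p, ν, h1, h2, h3⟩ := ha
  refine ⟨ι, inferInstance, fun i => q * p i, ν, h1, fun t ht i => ?_, fun t ht => ?_⟩
  · rw [eval_mul]; exact mul_nonneg (hq t ht) (h2 t ht i)
  · simp only [h3 t ht, Finset.smul_sum, smul_smul, eval_mul, ENNReal.ofReal_mul (hq t ht)]

theorem PolyMix.sum_smul {I : Set ℝ} {ι : Type*} (s : Finset ι) {w : ι → ℝ}
    {a : ι → ℝ → Measure EReal} (hw : ∀ i ∈ s, 0 ≤ w i) (ha : ∀ i ∈ s, PolyMix I (a i)) :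
    PolyMix I fun t => ∑ i ∈ s, ENNReal.ofReal (w i) • a i t := by
  classical
  induction s using Finset.induction_on with
  | empty => simpa using PolyMix.zero I
  | insert i s hi ih =>
    simp only [Finset.sum_insert hi]
    refine PolyMix.add ?_ (ih (fun j hj => hw j (Finset.mem_insert_of_mem hj))
      fun j hj => ha j (Finset.mem_insert_of_mem hj))
    simpa using (ha i (Finset.mem_insert_self i s)).smul (q := C (w i))
      fun t _ => by simpa using hw i (Finset.mem_insert_self i s)

theorem opConv_sum_smul {op : EReal → EReal → EReal}
    (hop : Measurable fun p : EReal × EReal => op p.1 p.2) {ι κ : Type*} [Fintype ι] [Fintype κ]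
    (w : ι → ENNReal) (w' : κ → ENNReal) (ν : ι → Measure EReal) (μ : κ → Measure EReal)
    [∀ j, IsProbabilityMeasure (μ j)] (hw' : ∀ j, w' j ≠ ⊤) :
    opConv op (∑ i, w i • ν i) (∑ j, w' j • μ j) =
      ∑ q : ι × κ, (w q.1 * w' q.2) • opConv op (ν q.1) (μ q.2) := by
  have : ∀ j, IsFiniteMeasure (w' j • μ j) := fun j => (μ j).smul_finite (hw' j)
  refine Measure.ext_of_lintegral _ fun f hf => ?_
  have hfm : Measurable fun q : EReal × EReal => f (op q.1 q.2) := hf.comp hop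
  have hj : ∀ j, Measurable fun x => ∫⁻ y, f (op x y) ∂(μ j) := fun j =>
    hfm.lintegral_prod_right'
  rw [lintegral_opConv hop _ _ hf]
  simp only [lintegral_finsetSum_measure, lintegral_smul_measure, lintegral_opConv hop _ _ hf,
    Fintype.sum_prod_type, smul_eq_mul]
  refine Finset.sum_congr rfl fun i _ => ?_
  rw [lintegral_finsetSum _ fun j _ => (hj j).const_mul _, Finset.mul_sum]
  refine Finset.sum_congr rfl fun j _ => ?_
  rw [lintegral_const_mul _ (hj j), mul_assoc]

theorem PolyMix.opConv {op : EReal → EReal → EReal}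
    (hop : Measurable fun p : EReal × EReal => op p.1 p.2)
    (hsymm : ∀ m n, SymmLaw m → SymmLaw n → SymmLaw (opConv op m n)) {I : Set ℝ}
    {a b : ℝ → Measure EReal} (ha : PolyMix I a) (hb : PolyMix I b) :
    PolyMix I fun t => opConv op (a t) (b t) := by
  obtain ⟨ι, _, p, ν, h1, h2, h3⟩ := ha
  obtain ⟨κ, _, q, μ, k1, k2, k3⟩ := hb
  refine ⟨ι × κ, inferInstance, fun i => p i.1 * q i.2, fun i => Gexit.opConv op (ν i.1) (μ i.2),
    fun i => hsymm _ _ (h1 _) (k1 _), fun t ht i => ?_, fun t ht => ?_⟩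
  · rw [eval_mul]; exact mul_nonneg (h2 t ht _) (k2 t ht _)
  · have := fun j => (k1 j).isProbability
    simp only [h3 t ht, k3 t ht, eval_mul, ENNReal.ofReal_mul (h2 t ht _)]
    exact opConv_sum_smul hop _ _ _ _ fun j => ENNReal.ofReal_ne_top

theorem PolyMix.conv {I : Set ℝ} {a b : ℝ → Measure EReal} (ha : PolyMix I a)
    (hb : PolyMix I b) : PolyMix I fun t => (a t).conv (b t) :=
  PolyMix.opConv measurable_add_ereal (fun _ _ h h' => h.conv h') ha hb

theorem PolyMix.checkConv {I : Set ℝ} {a b : ℝ → Measure EReal} (ha : PolyMix I a)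
    (hb : PolyMix I b) : PolyMix I fun t => checkConv (a t) (b t) :=
  PolyMix.opConv measurable_checkOp (fun _ _ h h' => h.checkConv h') ha hb

theorem PolyMix.checkPow {I : Set ℝ} {a : ℝ → Measure EReal} (ha : PolyMix I a) (k : ℕ) :
    PolyMix I fun t => checkPow (a t) k := by
  induction k with
  | zero => exact PolyMix.const I symmLaw_dirac_top
  | succ k ih => exact ih.checkConv ha

theorem PolyMix.convPow {I : Set ℝ} {a : ℝ → Measure EReal} (ha : PolyMix I a) (k : ℕ) :
    PolyMix I fun t => convPow (a t) k := by
  induction k with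
  | zero => exact PolyMix.const I symmLaw_dirac_zero
  | succ k ih => exact ih.conv ha

theorem PolyMix.checkMap {I : Set ℝ} {a : ℝ → Measure EReal} (ha : PolyMix I a) {rho : ℝ[X]}
    (hrho : IsDegreeDistribution rho) : PolyMix I fun t => checkMap rho (a t) :=
  PolyMix.sum_smul _ (fun k _ => hrho.coeff_nonneg k) fun k _ => ha.checkPow k

theorem PolyMix.variableMap {I : Set ℝ} {c : Measure EReal} (hc : SymmLaw c)
    {a : ℝ → Measure EReal} (ha : PolyMix I a) {lam : ℝ[X]}
    (hlam : IsDegreeDistribution lam) : PolyMix I fun t => variableMap c lam (a t) :=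
  PolyMix.sum_smul _ (fun k _ => hlam.coeff_nonneg k)
    fun k _ => (PolyMix.const I hc).conv (ha.convPow k)

theorem PolyMix.comp_sub_one {I J : Set ℝ} {a : ℝ → Measure EReal} (ha : PolyMix I a)
    (h : ∀ t ∈ J, t - 1 ∈ I) : PolyMix J fun t => a (t - 1) := by
  obtain ⟨ι, _, p, ν, h1, h2, h3⟩ := ha
  refine ⟨ι, inferInstance, fun i => (p i).comp (X - 1), ν, h1, fun t ht i => ?_, fun t ht => ?_⟩
  · simpa using h2 _ (h t ht) i
  · simpa using h3 _ (h t ht)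

theorem PolyMix.congr {I : Set ℝ} {a b : ℝ → Measure EReal} (ha : PolyMix I a)
    (h : EqOn b a I) : PolyMix I b := by
  obtain ⟨ι, _, p, ν, h1, h2, h3⟩ := ha
  exact ⟨ι, inferInstance, p, ν, h1, h2, fun t ht => (h ht).trans (h3 t ht)⟩

theorem PolyMix.exists_integral_eq {I : Set ℝ} {a : ℝ → Measure EReal} (ha : PolyMix I a) :
    ∃ (ι : Type) (_ : Fintype ι) (p : ι → ℝ[X]) (ν : ι → Measure EReal), (∀ i, SymmLaw (ν i)) ∧
      ∀ f, SymmIntegrable f → ∀ t ∈ I,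
        ∫ x, f x ∂(a t) = ∑ i, (p i).eval t * ∫ x, f x ∂(ν i) := by
  obtain ⟨ι, _, p, ν, h1, h2, h3⟩ := ha
  refine ⟨ι, inferInstance, p, ν, h1, fun f hf t ht => ?_⟩
  rw [h3 t ht, integral_sum_smul _ _ _ (fun i _ => h2 t ht i) fun i _ => hf.integrable _ (h1 i)]

theorem PolyMix.continuousOn_integral {I : Set ℝ} {a : ℝ → Measure EReal} (ha : PolyMix I a)
    {f : EReal → ℝ} (hf : SymmIntegrable f) : ContinuousOn (fun t => ∫ x, f x ∂(a t)) I := by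
  obtain ⟨ι, _, p, ν, _, h⟩ := ha.exists_integral_eq
  refine ContinuousOn.congr (f := fun t => ∑ i, (p i).eval t * ∫ x, f x ∂(ν i)) ?_
    fun t ht => h f hf t ht
  fun_prop

/-- The two factors get independent parameters `s` and `t`, so that partial derivatives can be
compared with the derivative along the diagonal. -/
theorem PolyMix.exists_entropy_conv_eq {I : Set ℝ} {a b : ℝ → Measure EReal} (ha : PolyMix I a)
    (hb : PolyMix I b) : ∃ (ι κ : Type) (_ : Fintype ι) (_ : Fintype κ) (p : ι → ℝ[X])
      (q : κ → ℝ[X]) (h : ι → κ → ℝ), ∀ s ∈ I, ∀ t ∈ I,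
        entropy ((a s).conv (b t)) = ∑ i, ∑ j, (p i).eval s * (q j).eval t * h i j := by
  obtain ⟨ι, _, p, ν, h1, h2, h3⟩ := ha
  obtain ⟨κ, _, q, μ, k1, k2, k3⟩ := hb
  refine ⟨ι, κ, inferInstance, inferInstance, p, q, fun i j => entropy ((ν i).conv (μ j)),
    fun s hs t ht => ?_⟩
  have := fun j => (k1 j).isProbability
  rw [h3 s hs, k3 t ht, conv_eq_opConv, opConv_sum_smul measurable_add_ereal _ _ _ _
    fun j => ENNReal.ofReal_ne_top]
  simp only [← ENNReal.ofReal_mul (h2 s hs _)]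
  unfold entropy
  rw [integral_sum_smul _ _ _ (fun i _ => mul_nonneg (h2 s hs _) (k2 t ht _))
    fun i _ => symmIntegrable_exitKernel.integrable _ ((h1 i.1).conv (k1 i.2)),
    Fintype.sum_prod_type]
  rfl

/-- The product rule for the entropy of a variable node convolution. -/
theorem PolyMix.hasDerivWithinAt_entropy_conv {I S : Set ℝ} {a b : ℝ → Measure EReal}
    (ha : PolyMix I a) (hb : PolyMix I b) {t : ℝ} (ht : t ∈ I) (hI : I ∈ 𝓝[S] t)
    (hS : UniqueDiffWithinAt ℝ S t) {x y : ℝ}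
    (hx : HasDerivWithinAt (fun s => entropy ((a s).conv (b t))) x S t)
    (hy : HasDerivWithinAt (fun s => entropy ((a t).conv (b s))) y S t) :
    HasDerivWithinAt (fun s => entropy ((a s).conv (b s))) (x + y) S t := by
  obtain ⟨ι, κ, _, _, p, q, h, hh⟩ := ha.exists_entropy_conv_eq hb
  have hx' : HasDerivWithinAt (fun s => entropy ((a s).conv (b t)))
      (∑ i, ∑ j, (p i).derivative.eval t * (q j).eval t * h i j) S t := by
    refine HasDerivWithinAt.congr_of_eventuallyEq ?_
      (mem_of_superset hI fun s hs => hh s hs t ht) (hh t ht t ht)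
    exact HasDerivWithinAt.fun_sum fun i _ => HasDerivWithinAt.fun_sum fun j _ =>
      ((((p i).hasDerivAt t).mul_const _).mul_const _).hasDerivWithinAt
  have hy' : HasDerivWithinAt (fun s => entropy ((a t).conv (b s)))
      (∑ i, ∑ j, (p i).eval t * (q j).derivative.eval t * h i j) S t := by
    refine HasDerivWithinAt.congr_of_eventuallyEq ?_
      (mem_of_superset hI fun s hs => hh t ht s hs) (hh t ht t ht)
    exact HasDerivWithinAt.fun_sum fun i _ => HasDerivWithinAt.fun_sum fun j _ =>
      ((((q j).hasDerivAt t).const_mul _).mul_const _).hasDerivWithinAt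
  -- Uniqueness of derivatives within `S` identifies the given partial derivatives with the explicit
  -- sums.
  rw [hS.eq_deriv _ hx hx', hS.eq_deriv _ hy hy', ← Finset.sum_add_distrib]
  simp only [← Finset.sum_add_distrib, ← add_mul]
  refine HasDerivWithinAt.congr_of_eventuallyEq ?_
    (mem_of_superset hI fun s hs => hh s hs s hs) (hh t ht t ht)
  exact HasDerivWithinAt.fun_sum fun i _ => HasDerivWithinAt.fun_sum fun j _ =>
    ((((p i).hasDerivAt t).mul ((q j).hasDerivAt t)).mul_const _).hasDerivWithinAt

/-! ### Derivatives along a family -/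

/-- The derivatives at `t`, within `S`, of the functionals that occur in the GEXIT functional:
`e k` for the moments, `E` for the entropy, `κ` for the soft entropy, `D` for the entropy of
convolutions. -/
structure HasEntropyDerivs (a : ℝ → Measure EReal) (S : Set ℝ) (t : ℝ) (e : ℕ → ℝ) (E : ℝ)
    (κ : EReal → ℝ) (D : Measure EReal → ℝ) : Prop where
  gapMoment : ∀ k, HasDerivWithinAt (fun s => gapMoment k (a s)) (e k) S t
  entropy : HasDerivWithinAt (fun s => entropy (a s)) E S t
  hasSum_entropy : HasSum (fun k => entropyCoeff k * e k) E
  softEntropy : ∀ z, HasDerivWithinAt (fun s => softEntropy (a s) z) (κ z) S t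
  integrable : ∀ m, SymmLaw m → Integrable κ m
  integral : ∀ m, SymmLaw m → ∫ z, κ z ∂m = D m
  hasSum_conv : ∀ m, SymmLaw m → HasSum (fun k => entropyCoeff k * (e k * Gexit.gapMoment k m)) (D m)
  conv : ∀ m, SymmLaw m → HasDerivWithinAt (fun s => Gexit.entropy ((a s).conv m)) (D m) S t

/-- Every functional involved is linear in the law, so one differentiates the polynomial weights and
keeps the component laws. The sums over components are finite, hence exchanging the derivative with
integrals and moment series costs nothing. -/
theorem PolyMix.exists_derivs {I S : Set ℝ} {a : ℝ → Measure EReal} (ha : PolyMix I a)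
    (hsymm : ∀ s ∈ I, SymmLaw (a s)) {t : ℝ} (ht : t ∈ I) (hI : I ∈ 𝓝[S] t) :
    ∃ e E κ D, HasEntropyDerivs a S t e E κ D := by
  obtain ⟨ι, _, p, ν, hν, h⟩ := ha.exists_integral_eq
  have key : ∀ f, SymmIntegrable f → HasDerivWithinAt (fun s => ∫ x, f x ∂(a s))
      (∑ i, (p i).derivative.eval t * ∫ x, f x ∂(ν i)) S t := by
    intro f hf
    refine HasDerivWithinAt.congr_of_eventuallyEq ?_
      (mem_of_superset hI fun s hs => h f hf s hs) (h f hf t ht)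
    exact HasDerivWithinAt.fun_sum fun i _ => (((p i).hasDerivAt t).mul_const _).hasDerivWithinAt
  refine ⟨fun k => ∑ i, (p i).derivative.eval t * gapMoment k (ν i),
    ∑ i, (p i).derivative.eval t * entropy (ν i),
    fun z => ∑ i, (p i).derivative.eval t * softEntropy (ν i) z,
    fun m => ∑ i, (p i).derivative.eval t * entropy ((ν i).conv m),
    fun k => key _ (symmIntegrable_gap k), key _ symmIntegrable_exitKernel, ?_,
    fun z => key _ (symmIntegrable_exitKernel_add z), fun m hm => ?_, fun m hm => ?_,
    fun m hm => ?_, fun m hm => ?_⟩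
  · simp only [Finset.mul_sum, mul_left_comm (entropyCoeff _)]
    exact hasSum_sum fun i _ => (hν i).hasSum_entropy.mul_left _
  · exact integrable_finsetSum _ fun i _ =>
      ((hν i).symmIntegrable_softEntropy.integrable m hm).const_mul _
  · rw [integral_finsetSum _ fun i _ =>
      ((hν i).symmIntegrable_softEntropy.integrable m hm).const_mul _]
    refine Finset.sum_congr rfl fun i _ => ?_
    have := (hν i).isProbability
    have := hm.isProbability
    rw [integral_const_mul, Measure.conv_comm, hm.entropy_conv_eq_integral (hν i)]
  · simp only [Finset.mul_sum, Finset.sum_mul]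
    refine hasSum_sum fun i _ => ?_
    convert! ((hν i).hasSum_entropy_conv hm).mul_left ((p i).derivative.eval t) using 1
    funext k
    ring
  · have h1 := key _ hm.symmIntegrable_softEntropy
    simp only [← (hν _).entropy_conv_eq_integral hm] at h1
    exact h1.congr_of_eventuallyEq
      (mem_of_superset hI fun s hs => (hsymm s hs).entropy_conv_eq_integral hm)
      ((hsymm t ht).entropy_conv_eq_integral hm)

/-- Product rule by induction: split off one factor, absorb it into `m` when the other factors move,
and differentiate it with the other factors frozen. For `k = 0` the factor `k` makes the truncated
exponent `k - 1` irrelevant. -/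
theorem HasEntropyDerivs.convPow {I S : Set ℝ} {b : ℝ → Measure EReal} (hb : PolyMix I b)
    (hsymm : ∀ s ∈ I, SymmLaw (b s)) {t : ℝ} (ht : t ∈ I) (hI : I ∈ 𝓝[S] t)
    (hS : UniqueDiffWithinAt ℝ S t) {e : ℕ → ℝ} {E : ℝ} {κ : EReal → ℝ} {D : Measure EReal → ℝ}
    (h : HasEntropyDerivs b S t e E κ D) (k : ℕ) {m : Measure EReal} (hm : SymmLaw m) :
    HasDerivWithinAt (fun s => Gexit.entropy ((convPow (b s) k).conv m))
      (k * D ((Gexit.convPow (b t) (k - 1)).conv m)) S t := by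
  have hbt := hsymm t ht
  have := hm.isProbability
  have := hbt.isProbability
  rcases k with _ | k
  · rw [Nat.cast_zero, zero_mul]
    exact hasDerivWithinAt_const t S (Gexit.entropy ((Gexit.convPow (b t) 0).conv m))
  rw [Nat.add_sub_cancel]
  induction k generalizing m with
  | zero =>
    have h1 : (Gexit.convPow (b t) 0).conv m = m := Measure.dirac_zero_conv m
    have h2 : ∀ s ∈ I, Gexit.convPow (b s) (0 + 1) = b s := fun s hs =>
      have := (hsymm s hs).isProbability
      Measure.dirac_zero_conv (b s)
    rw [h1, zero_add, Nat.cast_one, one_mul]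
    exact (h.conv m hm).congr_of_eventuallyEq
      (mem_of_superset hI fun s hs => by simp only [mem_ofPred_eq]; rw [h2 s hs])
      (by rw [h2 t ht])
  | succ k ih =>
    have hassoc : ∀ s ∈ I, (Gexit.convPow (b s) (k + 1 + 1)).conv m =
        (Gexit.convPow (b s) (k + 1)).conv ((b s).conv m) := fun s hs =>
      have := (hsymm s hs).isProbability
      have := ((hsymm s hs).convPow (k + 1)).isProbability
      Measure.conv_assoc _ _ _
    have := (hbt.convPow k).isProbability
    have := (hbt.convPow (k + 1)).isProbability
    have hx := ih (hbt.conv hm) (hbt.conv hm).isProbability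
    rw [show (Gexit.convPow (b t) k).conv ((b t).conv m) = (Gexit.convPow (b t) (k + 1)).conv m from
      (Measure.conv_assoc _ _ _).symm] at hx
    have hcomm : ∀ s ∈ I, (Gexit.convPow (b t) (k + 1)).conv ((b s).conv m) =
        (b s).conv ((Gexit.convPow (b t) (k + 1)).conv m) := fun s hs => by
      have := (hsymm s hs).isProbability
      rw [← Measure.conv_assoc, Measure.conv_comm _ (b s), Measure.conv_assoc]
    have hy : HasDerivWithinAt
        (fun s => Gexit.entropy ((Gexit.convPow (b t) (k + 1)).conv ((b s).conv m)))
        (D ((Gexit.convPow (b t) (k + 1)).conv m)) S t :=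
      (h.conv _ ((hbt.convPow (k + 1)).conv hm)).congr_of_eventuallyEq
        (mem_of_superset hI fun s hs => by simp only [mem_ofPred_eq]; rw [hcomm s hs])
        (by rw [hcomm t ht])
    refine ((hb.convPow (k + 1)).hasDerivWithinAt_entropy_conv (hb.conv (PolyMix.const I hm)) ht hI
      hS hx hy).congr_of_eventuallyEq
        (mem_of_superset hI fun s hs => by simp only [mem_ofPred_eq]; rw [hassoc s hs])
        (by rw [hassoc t ht]) |>.congr_deriv ?_
    push_cast
    ring

theorem entropy_variableMap_conv {c b m : Measure EReal} (hc : SymmLaw c) (hb : SymmLaw b)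
    (hm : SymmLaw m) {lam : ℝ[X]} (hlam : IsDegreeDistribution lam) :
    entropy ((variableMap c lam b).conv m) =
      ∑ k ∈ lam.support, lam.coeff k * entropy ((convPow b k).conv (c.conv m)) := by
  have := hc.isProbability
  have := hm.isProbability
  rw [(hc.variableMap hb hlam).entropy_conv_eq_integral hm, variableMap,
    integral_sum_smul _ _ _ (fun k _ => hlam.coeff_nonneg k)
      fun k _ => hm.symmIntegrable_softEntropy.integrable _ (hc.conv (hb.convPow k))]
  refine Finset.sum_congr rfl fun k _ => ?_
  have := (hb.convPow k).isProbability
  -- The fixed factor `c` is moved next to `m`, leaving the power in front, where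
  -- `HasEntropyDerivs.convPow` applies.
  rw [← (hc.conv (hb.convPow k)).entropy_conv_eq_integral hm, Measure.conv_comm c,
    Measure.conv_assoc]

theorem HasEntropyDerivs.variableMap {I S : Set ℝ} {c : Measure EReal} (hc : SymmLaw c)
    {b : ℝ → Measure EReal} (hb : PolyMix I b)
    (hsymm : ∀ s ∈ I, SymmLaw (b s)) {t : ℝ} (ht : t ∈ I) (hI : I ∈ 𝓝[S] t)
    (hS : UniqueDiffWithinAt ℝ S t) {e : ℕ → ℝ} {E : ℝ} {κ : EReal → ℝ} {D : Measure EReal → ℝ}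
    (h : HasEntropyDerivs b S t e E κ D) {lam : ℝ[X]} (hlam : IsDegreeDistribution lam)
    {m : Measure EReal} (hm : SymmLaw m) :
    HasDerivWithinAt (fun s => Gexit.entropy ((variableMap c lam (b s)).conv m))
      (∑ k ∈ lam.support, lam.coeff k * (k * D ((Gexit.convPow (b t) (k - 1)).conv (c.conv m))))
      S t := by
  refine HasDerivWithinAt.congr_of_eventuallyEq ?_ (mem_of_superset hI fun s hs =>
    entropy_variableMap_conv hc (hsymm s hs) hm hlam)
    (entropy_variableMap_conv hc (hsymm t ht) hm hlam)
  exact HasDerivWithinAt.fun_sum fun k _ =>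
    (h.convPow hb hsymm ht hI hS k (hc.conv hm)).const_mul _

theorem SymmLaw.one_sub_gapMoment_checkPow {m : Measure EReal} (hm : SymmLaw m) (i k : ℕ) :
    1 - gapMoment i (Gexit.checkPow m k) = (1 - gapMoment i m) ^ k := by
  induction k with
  | zero => simp [Gexit.checkPow, gapMoment]
  | succ k ih => rw [Gexit.checkPow, (hm.checkPow k).gapMoment_checkConv hm, ih, pow_succ]

theorem SymmLaw.one_sub_gapMoment_checkMap {m : Measure EReal} (hm : SymmLaw m) (i : ℕ)
    {rho : ℝ[X]} (hrho : IsDegreeDistribution rho) :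
    1 - gapMoment i (Gexit.checkMap rho m) = rho.eval (1 - gapMoment i m) := by
  have h1 : gapMoment i (Gexit.checkMap rho m) =
      ∑ k ∈ rho.support, rho.coeff k * gapMoment i (Gexit.checkPow m k) :=
    integral_sum_smul _ _ _ (fun k _ => hrho.coeff_nonneg k)
      fun k _ => (symmIntegrable_gap i).integrable _ (hm.checkPow k)
  rw [h1, ← hrho.sum_coeff, ← Finset.sum_sub_distrib, hrho.sum_coeff, eval_eq_sum,
    Polynomial.sum_def]
  refine Finset.sum_congr rfl fun k _ => ?_
  rw [← hm.one_sub_gapMoment_checkPow]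
  ring

/-- The gap moments of the power are `1 - (1 - g)^(k+1)`. Termwise differentiation of the series
needs no justification here: the derivative and its expansion come from the mixture structure of the
power, and uniqueness identifies the terms. -/
theorem HasEntropyDerivs.checkPow {I S : Set ℝ} {a : ℝ → Measure EReal} (ha : PolyMix I a)
    (hsymm : ∀ s ∈ I, SymmLaw (a s)) {t : ℝ} (ht : t ∈ I) (hI : I ∈ 𝓝[S] t)
    (hS : UniqueDiffWithinAt ℝ S t) {e : ℕ → ℝ} {E : ℝ} {κ : EReal → ℝ} {D : Measure EReal → ℝ}
    (h : HasEntropyDerivs a S t e E κ D) (k : ℕ) :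
    ∃ P, HasDerivWithinAt (fun s => Gexit.entropy (Gexit.checkPow (a s) (k + 1))) P S t ∧
      HasSum (fun i => entropyCoeff i * ((k + 1) * (1 - Gexit.gapMoment i (a t)) ^ k * e i)) P := by
  obtain ⟨e', E', κ', D', h'⟩ :=
    (ha.checkPow (k + 1)).exists_derivs (fun s hs => (hsymm s hs).checkPow (k + 1)) ht hI
  refine ⟨E', h'.entropy, ?_⟩
  convert! h'.hasSum_entropy using 1
  funext i
  congr 1
  refine hS.eq_deriv S ?_ (h'.gapMoment i)
  have hg : ∀ s ∈ I, Gexit.gapMoment i (Gexit.checkPow (a s) (k + 1)) =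
      1 - (1 - Gexit.gapMoment i (a s)) ^ (k + 1) := fun s hs => by
    rw [← (hsymm s hs).one_sub_gapMoment_checkPow]; ring
  refine HasDerivWithinAt.congr_of_eventuallyEq ?_ (mem_of_superset hI hg) (hg t ht)
  refine ((((h.gapMoment i).const_sub 1).pow (k + 1)).const_sub 1).congr_deriv ?_
  push_cast
  ring

/-! ### The interpolating families -/

/-- The standing assumptions on the channel and the degree distributions. -/
structure Ensemble (c : Measure EReal) (lam rho : ℝ[X]) : Prop where
  channel : SymmLaw c
  lam_dist : IsDegreeDistribution lam
  rho_dist : IsDegreeDistribution rho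
  rho_zero : rho.coeff 0 = 0

theorem checkConv_dirac (x y : EReal) :
    checkConv (Measure.dirac x) (Measure.dirac y) = Measure.dirac (checkOp x y) := by
  unfold checkConv
  rw [Measure.dirac_prod_dirac, Measure.map_dirac' measurable_checkOp]

theorem checkPow_dirac_zero (k : ℕ) : checkPow (Measure.dirac 0) (k + 1) = Measure.dirac 0 := by
  have h0 : ∀ x, checkOp x 0 = 0 := fun x =>
    tanhHalf_eq_zero (by rw [tanhHalf_checkOp, tanhHalf_zero, mul_zero])
  cases k with
  | zero => rw [checkPow, checkPow, checkConv_dirac, h0]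
  | succ k => rw [checkPow, checkPow_dirac_zero k, checkConv_dirac, h0]

theorem convPow_dirac_zero (k : ℕ) : convPow (Measure.dirac 0) k = Measure.dirac 0 := by
  induction k with
  | zero => rfl
  | succ k ih => rw [convPow, ih, Measure.dirac_zero_conv]

theorem sum_ofReal_smul_const {p : ℝ[X]} (hp : IsDegreeDistribution p) (m : Measure EReal) :
    ∑ k ∈ p.support, ENNReal.ofReal (p.coeff k) • m = m := by
  rw [← Finset.sum_smul, ← ENNReal.ofReal_sum_of_nonneg fun k _ => hp.coeff_nonneg k,
    hp.sum_coeff, ENNReal.ofReal_one, one_smul]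

variable {c : Measure EReal} {lam rho : ℝ[X]}

/-- `Δ_0` is absorbing for nonempty check convolutions, and there are no empty ones since `rho` has
no constant term; it is neutral at variable nodes. Hence the step maps `a_{-1}` to `a_0 = c`, which
joins consecutive pieces of the family. -/
theorem Ensemble.deStep_dirac_zero (h : Ensemble c lam rho) :
    deStep c lam rho (Measure.dirac 0) = c := by
  have := h.channel.isProbability
  have h1 : checkMap rho (Measure.dirac 0) = Measure.dirac 0 := by
    refine Eq.trans (Finset.sum_congr rfl fun k hk => ?_) (sum_ofReal_smul_const h.rho_dist _)
    rcases k with _ | k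
    · exact absurd h.rho_zero (mem_support_iff.1 hk)
    · rw [checkPow_dirac_zero]
  unfold deStep
  rw [h1]
  refine Eq.trans (Finset.sum_congr rfl fun k _ => ?_) (sum_ofReal_smul_const h.lam_dist _)
  rw [convPow_dirac_zero, Measure.conv_dirac_zero]

theorem initialMix_eq_sum (c : Measure EReal) (t : ℝ) : initialMix c t =
    ∑ i : Bool, ENNReal.ofReal (bif i then -t else 1 + t) •
      (bif i then Measure.dirac 0 else c) := by
  simp [initialMix]

theorem interpA_zero (c : Measure EReal) (lam rho : ℝ[X]) : interpA c lam rho 0 = c := by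
  rw [interpA_of_nonpos c lam rho le_rfl]
  simp [initialMix]

theorem interpA_neg_one (c : Measure EReal) (lam rho : ℝ[X]) :
    interpA c lam rho (-1) = Measure.dirac 0 := by
  rw [interpA_of_nonpos c lam rho (by norm_num)]
  simp [initialMix]

theorem Ensemble.interpA_eq (h : Ensemble c lam rho) {t : ℝ} (ht : 0 ≤ t) :
    interpA c lam rho t = variableMap c lam (interpB c lam rho t) := by
  rcases eq_or_lt_of_le ht with h0 | h0
  · subst h0
    rw [interpA_zero, interpB, zero_sub, interpA_neg_one]
    exact h.deStep_dirac_zero.symm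
  · exact interpA_of_pos c lam rho h0

theorem interpA_natCast (c : Measure EReal) (lam rho : ℝ[X]) (n : ℕ) :
    interpA c lam rho n = densityEvolution c lam rho n := by
  unfold interpA densityEvolution
  rw [Nat.ceil_natCast, sub_self]
  simp [initialMix]

theorem interpB_add_one (c : Measure EReal) (lam rho : ℝ[X]) (t : ℝ) :
    interpB c lam rho (t + 1) = checkMap rho (interpA c lam rho t) := by
  rw [interpB, add_sub_cancel_right]

theorem exists_nat_mem_Ioc {t : ℝ} (ht : -1 < t) : ∃ n : ℕ, t ∈ Ioc ((n : ℝ) - 1) n := by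
  refine ⟨⌈t⌉₊, ?_, Nat.le_ceil t⟩
  rcases le_or_gt t 0 with h | h
  · rw [Nat.ceil_eq_zero.2 h]; simpa using ht
  · linarith [Nat.ceil_lt_add_one h.le]

theorem exists_nat_mem_Icc {t : ℝ} (ht : -1 ≤ t) : ∃ n : ℕ, t ∈ Icc ((n : ℝ) - 1) n := by
  rcases eq_or_lt_of_le ht with h | h
  · exact ⟨0, by rw [← h]; norm_num⟩
  · obtain ⟨n, hn⟩ := exists_nat_mem_Ioc h
    exact ⟨n, Ioc_subset_Icc_self hn⟩

theorem sub_one_mem_Icc {n : ℕ} {t : ℝ} (ht : t ∈ Icc (((n + 1 : ℕ) : ℝ) - 1) (n + 1 : ℕ)) :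
    t - 1 ∈ Icc ((n : ℝ) - 1) n ∧ 0 ≤ t := by
  push_cast at ht
  have : (0 : ℝ) ≤ n := n.cast_nonneg
  exact ⟨⟨by linarith [ht.1], by linarith [ht.2]⟩, by linarith [ht.1]⟩

theorem Ensemble.symmLaw_interpA (h : Ensemble c lam rho) {t : ℝ} (ht : -1 ≤ t) :
    SymmLaw (interpA c lam rho t) := by
  obtain ⟨n, hn⟩ := exists_nat_mem_Icc ht
  clear ht
  induction n generalizing t with
  | zero =>
    norm_num at hn
    rw [interpA_of_nonpos c lam rho hn.2, initialMix_eq_sum]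
    refine SymmLaw.sum_smul _ _ _ ?_ ?_ ?_
    · rintro (_ | _) _
      exacts [h.channel, symmLaw_dirac_zero]
    · rintro (_ | _) _ <;> simp <;> linarith [hn.1, hn.2]
    · simp
  | succ n ih =>
    obtain ⟨h1, h2⟩ := sub_one_mem_Icc hn
    rw [h.interpA_eq h2]
    exact h.channel.variableMap ((ih h1).checkMap h.rho_dist) h.lam_dist

theorem Ensemble.symmLaw_interpB (h : Ensemble c lam rho) {t : ℝ} (ht : 0 ≤ t) :
    SymmLaw (interpB c lam rho t) :=
  (h.symmLaw_interpA (by linarith)).checkMap h.rho_dist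

theorem Ensemble.polyMix_interpA (h : Ensemble c lam rho) (n : ℕ) :
    PolyMix (Icc ((n : ℝ) - 1) n) (interpA c lam rho) := by
  induction n with
  | zero =>
    refine ⟨Bool, inferInstance, fun i => bif i then -X else 1 + X,
      fun i => bif i then Measure.dirac 0 else c, ?_, ?_, ?_⟩
    · rintro (_ | _)
      exacts [h.channel, symmLaw_dirac_zero]
    · intro t ht
      norm_num at ht
      rintro (_ | _) <;> simp <;> linarith [ht.1, ht.2]
    · intro t ht
      norm_num at ht
      rw [interpA_of_nonpos c lam rho ht.2, initialMix_eq_sum]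
      simp
  | succ n ih =>
    have h1 : PolyMix (Icc (((n + 1 : ℕ) : ℝ) - 1) (n + 1 : ℕ))
        fun t => variableMap c lam (checkMap rho (interpA c lam rho (t - 1))) :=
      ((ih.comp_sub_one fun t ht => (sub_one_mem_Icc ht).1).checkMap h.rho_dist).variableMap
        h.channel h.lam_dist
    exact h1.congr fun t ht => h.interpA_eq (sub_one_mem_Icc ht).2

theorem Ensemble.polyMix_interpB (h : Ensemble c lam rho) (n : ℕ) :
    PolyMix (Icc (((n + 1 : ℕ) : ℝ) - 1) (n + 1 : ℕ)) (interpB c lam rho) :=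
  ((h.polyMix_interpA n).comp_sub_one fun _ ht => (sub_one_mem_Icc ht).1).checkMap h.rho_dist

/-- On `[-1, 0]` a larger parameter moves weight from `Δ_0` to `c`, and an even convex function is
least at `0`. A density evolution step preserves the order, which gives each later unit interval;
transitivity joins the intervals. -/
theorem Ensemble.degraded_interpA (h : Ensemble c lam rho) {s t : ℝ} (hs : -1 ≤ s) (hst : s ≤ t) :
    Degraded (interpA c lam rho s) (interpA c lam rho t) := by
  have piece : ∀ n : ℕ, ∀ s ∈ Icc ((n : ℝ) - 1) n, ∀ t ∈ Icc ((n : ℝ) - 1) n, s ≤ t →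
      Degraded (interpA c lam rho s) (interpA c lam rho t) := by
    intro n
    induction n with
    | zero =>
      intro s hs t ht hst φ hφ
      norm_num at hs ht
      have key : ∀ r : ℝ, -1 ≤ r → r ≤ 0 → ∫ x, φ (tanhHalf x) ∂(interpA c lam rho r) =
          -r * φ 0 + (1 + r) * ∫ x, φ (tanhHalf x) ∂c := by
        intro r h1 h2
        rw [interpA_of_nonpos c lam rho h2, initialMix_eq_sum, integral_sum_smul]
        · simp
        · rintro (_ | _) _ <;> simp <;> linarith
        · rintro (_ | _) _
          exacts [hφ.symmIntegrable.integrable _ h.channel,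
            hφ.symmIntegrable.integrable _ symmLaw_dirac_zero]
      have := h.channel.isProbability
      have h0 : φ 0 ≤ ∫ x, φ (tanhHalf x) ∂c := by
        have h1 := integral_mono (μ := c) (integrable_const (φ 0))
          (hφ.symmIntegrable.integrable _ h.channel) fun x => hφ.zero_le (tanhHalf_mem x)
        simpa using h1
      rw [key s hs.1 hs.2, key t ht.1 ht.2]
      nlinarith
    | succ n ih =>
      intro s hs t ht hst
      obtain ⟨h1, h2⟩ := sub_one_mem_Icc hs
      obtain ⟨k1, k2⟩ := sub_one_mem_Icc ht
      rw [h.interpA_eq h2, h.interpA_eq k2]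
      exact Degraded.variableMap h.channel ((ih _ h1 _ k1 (by linarith)).checkMap
        (h.symmLaw_interpA (by linarith)) (h.symmLaw_interpA (by linarith)) h.rho_dist)
        (h.symmLaw_interpB h2) (h.symmLaw_interpB k2) h.lam_dist
  obtain ⟨n, hn⟩ := exists_nat_mem_Icc (hs.trans hst)
  have main : ∀ n : ℕ, ∀ s t : ℝ, -1 ≤ s → s ≤ t → t ≤ n →
      Degraded (interpA c lam rho s) (interpA c lam rho t) := by
    intro n
    induction n with
    | zero =>
      intro s t hs hst ht
      refine piece 0 s ?_ t ?_ hst <;> norm_num at ht ⊢ <;> constructor <;> linarith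
    | succ n ih =>
      intro s t hs hst ht
      rcases le_total t n with h1 | h1
      · exact ih s t hs hst h1
      have e : (((n + 1 : ℕ) : ℝ) - 1) = n := by push_cast; ring
      have ht' : t ∈ Icc (((n + 1 : ℕ) : ℝ) - 1) (n + 1 : ℕ) := ⟨by rw [e]; exact h1, ht⟩
      rcases le_total (n : ℝ) s with h2 | h2
      · exact piece (n + 1) s ⟨by rw [e]; exact h2, hst.trans ht⟩ t ht' hst
      · refine (ih s n hs h2 le_rfl).trans (piece (n + 1) n ⟨e.le, ?_⟩ t ht' h1)
        push_cast; linarith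
  exact main n s t hs hst hn.2

theorem Ensemble.gapMoment_antitone (h : Ensemble c lam rho) (k : ℕ) {s t : ℝ} (hs : -1 ≤ s)
    (hst : s ≤ t) : gapMoment k (interpA c lam rho t) ≤ gapMoment k (interpA c lam rho s) :=
  (h.degraded_interpA hs hst).gapMoment_le (h.symmLaw_interpA hs)
    (h.symmLaw_interpA (hs.trans hst)) k

theorem entropy_le_of_gapMoment_le {m n : Measure EReal} (hm : SymmLaw m) (hn : SymmLaw n)
    (h : ∀ k, gapMoment k m ≤ gapMoment k n) : entropy m ≤ entropy n :=
  hasSum_le (fun k => mul_le_mul_of_nonneg_left (h k) (entropyCoeff_pos k).le)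
    hm.hasSum_entropy hn.hasSum_entropy

theorem Ensemble.entropy_antitone (h : Ensemble c lam rho) :
    AntitoneOn (fun t => entropy (interpA c lam rho t)) (Ici (-1)) := fun _ hs _ ht hst =>
  entropy_le_of_gapMoment_le (h.symmLaw_interpA ht) (h.symmLaw_interpA hs)
    fun k => h.gapMoment_antitone k hs hst

theorem continuousOn_Ici_of_pieces {f : ℝ → ℝ} {k : ℕ}
    (hf : ∀ n : ℕ, k ≤ n → ContinuousOn f (Icc ((n : ℝ) - 1) n)) :
    ContinuousOn f (Ici ((k : ℝ) - 1)) := by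
  have h : ∀ n : ℕ, ContinuousOn f (Icc ((k : ℝ) - 1) ((k + n : ℕ) : ℝ)) := by
    intro n
    induction n with
    | zero => exact hf k le_rfl
    | succ n ih =>
      have h1 := hf (k + (n + 1)) (by omega)
      have h2 := ih.union_of_isClosed h1 isClosed_Icc isClosed_Icc
      have hn : (0 : ℝ) ≤ n := n.cast_nonneg
      refine h2.mono fun x hx => ?_
      push_cast at hx ⊢
      rcases le_total x (k + n) with h | h
      · exact Or.inl ⟨hx.1, h⟩
      · exact Or.inr ⟨by linarith, hx.2⟩
  intro x hx
  obtain ⟨n, hn⟩ := exists_nat_gt x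
  have hk : (0 : ℝ) ≤ k := k.cast_nonneg
  have hx' : x < ((k + n : ℕ) : ℝ) := by push_cast; linarith
  refine (h n x ⟨hx, hx'.le⟩).mono_of_mem_nhdsWithin ?_
  filter_upwards [self_mem_nhdsWithin, mem_nhdsWithin_of_mem_nhds (Iio_mem_nhds hx')] with y h1 h2
  exact ⟨h1, h2.le⟩

theorem Ensemble.continuousOn_entropy (h : Ensemble c lam rho) :
    ContinuousOn (fun t => entropy (interpA c lam rho t)) (Ici (-1)) := by
  have h1 := continuousOn_Ici_of_pieces (f := fun t => entropy (interpA c lam rho t)) (k := 0)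
    fun n _ => (h.polyMix_interpA n).continuousOn_integral symmIntegrable_exitKernel
  simpa using h1

theorem entropy_dirac_zero : entropy (Measure.dirac 0) = 1 := by
  rw [symmLaw_dirac_zero.entropy_eq]
  simp [symEntropy]

theorem Ensemble.gapMoment_initial (h : Ensemble c lam rho) (k : ℕ) {t : ℝ} (h1 : -1 ≤ t)
    (h2 : t ≤ 0) : gapMoment k (interpA c lam rho t) = -t + (1 + t) * gapMoment k c := by
  rw [interpA_of_nonpos c lam rho h2, initialMix_eq_sum, gapMoment, integral_sum_smul]
  · simp [gapMoment]
  · rintro (_ | _) _ <;> simp <;> linarith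
  · rintro (_ | _) _
    exacts [(symmIntegrable_gap k).integrable _ h.channel,
      (symmIntegrable_gap k).integrable _ symmLaw_dirac_zero]

/-! ### Convergence to the perfect density -/

/-- Weak convergence cannot be applied to the unbounded entropy kernel. It applies to the
symmetrized kernel, which is continuous on the compact space `EReal`. -/
theorem ConvergesToPerfect.tendsto_entropy (h : Ensemble c lam rho)
    (hconv : ConvergesToPerfect c lam rho) :
    Tendsto (fun n : ℕ => entropy (interpA c lam rho n)) atTop (𝓝 0) := by
  have h1 := hconv (BoundedContinuousFunction.mkOfCompact
    ⟨fun x => symEntropy (tanhHalf x), continuous_symEntropy.comp continuous_tanhHalf⟩)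
  simp only [BoundedContinuousFunction.mkOfCompact_apply, ContinuousMap.coe_mk, tanhHalf_top,
    symEntropy_one] at h1
  refine h1.congr fun n => ?_
  rw [← interpA_natCast, (h.symmLaw_interpA (by linarith [n.cast_nonneg (α := ℝ)])).entropy_eq]

theorem eq_dirac_of_ae_eq {m : Measure EReal} [IsProbabilityMeasure m] {y : EReal}
    (h : ∀ᵐ x ∂m, x = y) : m = Measure.dirac y := by
  refine Measure.ext_of_lintegral _ fun f hf => ?_
  rw [lintegral_dirac, lintegral_congr_ae (g := fun _ => f y) (h.mono fun x hx => by rw [hx])]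
  simp

/-- Equality would force `D = 0` almost surely, so `c` would be the useless channel. That is a fixed
point of density evolution with entropy one. -/
theorem ConvergesToPerfect.gapMoment_lt_one (h : Ensemble c lam rho)
    (hconv : ConvergesToPerfect c lam rho) (k : ℕ) : gapMoment k c < 1 := by
  have hcp := h.channel.isProbability
  refine lt_of_le_of_ne (h.channel.gapMoment_le_one k) fun h1 => ?_
  rw [h.channel.gapMoment_eq, sub_eq_self, integral_eq_zero_iff_of_nonneg
    (fun x => (tanhHalf_pow_mem k x).1) ((symmIntegrable_pow k).integrable _ h.channel)] at h1
  have hc0 : c = Measure.dirac 0 := eq_dirac_of_ae_eq <| h1.mono fun x hx =>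
    tanhHalf_eq_zero (pow_eq_zero_iff (by omega) |>.1 hx)
  have hfix : ∀ n : ℕ, densityEvolution c lam rho n = c := by
    intro n
    refine Function.iterate_fixed ?_ n
    conv_lhs => rw [hc0]
    have h2 := h.deStep_dirac_zero
    rwa [hc0] at h2 ⊢
  have h3 := ConvergesToPerfect.tendsto_entropy h hconv
  simp only [interpA_natCast, hfix] at h3
  rw [hc0, entropy_dirac_zero] at h3
  exact one_ne_zero (tendsto_nhds_unique tendsto_const_nhds h3)

/-! ### Densities with nonzero entropy -/

theorem SymmLaw.gapMoment_pos {m : Measure EReal} (hm : SymmLaw m) (h : entropy m ≠ 0) (k : ℕ) :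
    0 < gapMoment k m := by
  have := hm.isProbability
  refine lt_of_le_of_ne (hm.gapMoment_nonneg k) fun h1 => h ?_
  have h2 : (fun x => 1 - tanhHalf x ^ (2 * (k + 1))) =ᵐ[m] 0 :=
    (integral_eq_zero_iff_of_nonneg (fun x => sub_nonneg.2 (tanhHalf_pow_mem k x).2)
      ((symmIntegrable_gap k).integrable m hm)).1 h1.symm
  rw [hm.entropy_eq]
  refine integral_eq_zero_of_ae (h2.mono fun x hx => ?_)
  have h3 : tanhHalf x ^ (2 * (k + 1)) = 1 := by
    simp only [Pi.zero_apply] at hx; linarith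
  -- A vanishing gap moment means `|D| = 1` almost surely, where the binary entropy is zero.
  have h4 : tanhHalf x = 1 ∨ tanhHalf x = -1 := by
    rw [pow_mul, pow_eq_one_iff_of_nonneg (sq_nonneg _) (by omega)] at h3
    have h5 : (tanhHalf x - 1) * (tanhHalf x + 1) = 0 := by linear_combination h3
    rcases mul_eq_zero.1 h5 with h5 | h5
    exacts [Or.inl (by linarith), Or.inr (by linarith)]
  rcases h4 with h4 | h4 <;> simp only [h4] <;> norm_num [symEntropy]

theorem SymmLaw.gapMoment_eq_zero {m : Measure EReal} (hm : SymmLaw m) (h : entropy m = 0)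
    (k : ℕ) : gapMoment k m = 0 := by
  have h1 := hm.hasSum_entropy
  rw [h, hasSum_zero_iff_of_nonneg
    fun k => mul_nonneg (entropyCoeff_pos k).le (hm.gapMoment_nonneg k)] at h1
  have h2 := congrFun h1 k
  exact (mul_eq_zero.1 h2).resolve_left (entropyCoeff_pos k).ne'

theorem SymmLaw.entropy_eq_zero {m : Measure EReal} (hm : SymmLaw m)
    (h : ∀ k, gapMoment k m = 0) : entropy m = 0 := by
  have h1 := hm.hasSum_entropy
  simp only [h, mul_zero] at h1
  exact h1.unique hasSum_zero

theorem SymmLaw.entropy_ne_zero {m : Measure EReal} (hm : SymmLaw m) {k : ℕ}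
    (h : 0 < gapMoment k m) : entropy m ≠ 0 := fun h1 => h.ne' (hm.gapMoment_eq_zero h1 k)

theorem SymmLaw.entropy_conv_ne_zero {m n : Measure EReal} (hm : SymmLaw m) (hn : SymmLaw n)
    (h : entropy m ≠ 0) (h' : entropy n ≠ 0) : entropy (m.conv n) ≠ 0 := by
  refine ne_of_gt (lt_of_lt_of_le ?_ (le_hasSum (hm.hasSum_entropy_conv hn) 0 fun k _ => ?_))
  · exact mul_pos (entropyCoeff_pos 0) (mul_pos (hm.gapMoment_pos h 0) (hn.gapMoment_pos h' 0))
  · exact mul_nonneg (entropyCoeff_pos k).le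
      (mul_nonneg (hm.gapMoment_nonneg k) (hn.gapMoment_nonneg k))

theorem SymmLaw.entropy_convPow_ne_zero {m : Measure EReal} (hm : SymmLaw m)
    (h : entropy m ≠ 0) (k : ℕ) : entropy (Gexit.convPow m k) ≠ 0 := by
  induction k with
  | zero => rw [Gexit.convPow, entropy_dirac_zero]; exact one_ne_zero
  | succ k ih => exact (hm.convPow k).entropy_conv_ne_zero hm ih h

theorem SymmLaw.entropy_conv_le_left {m n : Measure EReal} (hm : SymmLaw m) (hn : SymmLaw n) :
    entropy (m.conv n) ≤ entropy m := by
  refine hasSum_le (fun k => ?_) (hm.hasSum_entropy_conv hn) hm.hasSum_entropy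
  exact mul_le_mul_of_nonneg_left
    (mul_le_of_le_one_right (hm.gapMoment_nonneg k) (hn.gapMoment_le_one k))
    (entropyCoeff_pos k).le

theorem SymmLaw.entropy_conv_le_right {m n : Measure EReal} (hm : SymmLaw m) (hn : SymmLaw n) :
    entropy (m.conv n) ≤ entropy n := by
  have := hm.isProbability
  have := hn.isProbability
  rw [Measure.conv_comm]
  exact hn.entropy_conv_le_left hm

/-! ### Degree polynomials: positivity and monotonicity -/

theorem IsDegreeDistribution.exists_succ_coeff_pos {p : ℝ[X]} (hp : IsDegreeDistribution p)
    (h0 : p.coeff 0 = 0) : ∃ k ∈ p.support, 0 < k ∧ 0 < p.coeff k := by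
  by_contra! hcon
  have h1 : ∑ k ∈ p.support, p.coeff k ≤ 0 := Finset.sum_nonpos fun k hk => by
    rcases Nat.eq_zero_or_pos k with h | h
    · rw [h, h0]
    · exact hcon k hk h
  rw [hp.sum_coeff] at h1
  linarith

theorem eval_eq_sum_support (p : ℝ[X]) (x : ℝ) :
    p.eval x = ∑ k ∈ p.support, p.coeff k * x ^ k := by
  rw [eval_eq_sum, Polynomial.sum_def]

theorem IsDegreeDistribution.derivative_eval_pos {p : ℝ[X]} (hp : IsDegreeDistribution p)
    (h0 : p.coeff 0 = 0) {x : ℝ} (hx : 0 < x) : 0 < p.derivative.eval x := by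
  obtain ⟨k, hk, hk0, hkp⟩ := hp.exists_succ_coeff_pos h0
  rw [derivative_eval, Polynomial.sum_def]
  refine Finset.sum_pos' (fun j _ => ?_) ⟨k, hk, ?_⟩
  · have := hp.coeff_nonneg j
    positivity
  · have : (0 : ℝ) < k := by exact_mod_cast hk0
    positivity

theorem IsDegreeDistribution.eval_le_self {p : ℝ[X]} (hp : IsDegreeDistribution p)
    (h0 : p.coeff 0 = 0) {x : ℝ} (hx : 0 ≤ x) (hx1 : x ≤ 1) : p.eval x ≤ x := by
  rw [eval_eq_sum_support]
  calc _ ≤ ∑ k ∈ p.support, p.coeff k * x := by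
        refine Finset.sum_le_sum fun k _ => ?_
        rcases k with _ | k
        · simp [h0]
        · exact mul_le_mul_of_nonneg_left (pow_le_of_le_one hx hx1 (by omega)) (hp.coeff_nonneg _)
    _ = x := by rw [← Finset.sum_mul, hp.sum_coeff, one_mul]

theorem IsDegreeDistribution.eval_mono {p : ℝ[X]} (hp : IsDegreeDistribution p) {x y : ℝ}
    (hx : 0 ≤ x) (hxy : x ≤ y) : p.eval x ≤ p.eval y := by
  rw [eval_eq_sum_support, eval_eq_sum_support]
  exact Finset.sum_le_sum fun k _ =>
    mul_le_mul_of_nonneg_left (pow_le_pow_left₀ hx hxy k) (hp.coeff_nonneg _)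

theorem entropy_variableMap {c b : Measure EReal} (hc : SymmLaw c) (hb : SymmLaw b)
    {lam : ℝ[X]} (hlam : IsDegreeDistribution lam) :
    entropy (variableMap c lam b) =
      ∑ k ∈ lam.support, lam.coeff k * entropy ((convPow b k).conv c) := by
  have := hc.isProbability
  have := (hc.variableMap hb hlam).isProbability
  have h := entropy_variableMap_conv hc hb symmLaw_dirac_zero hlam
  rwa [Measure.conv_dirac_zero, Measure.conv_dirac_zero] at h

/-- Edges at variable nodes of degree one carry the bare channel output, so their share of its
entropy would persist in every iteration. -/
theorem Ensemble.lam_zero (h : Ensemble c lam rho) (hconv : ConvergesToPerfect c lam rho)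
    (hc0 : entropy c ≠ 0) : lam.coeff 0 = 0 := by
  have h1 : ∀ n : ℕ, lam.coeff 0 * entropy c ≤ entropy (interpA c lam rho (n + 1 : ℕ)) := by
    intro n
    have hn : (0 : ℝ) ≤ (n + 1 : ℕ) := Nat.cast_nonneg _
    have hb := h.symmLaw_interpB hn
    have := h.channel.isProbability
    rw [h.interpA_eq hn, entropy_variableMap h.channel hb h.lam_dist]
    by_cases h0 : 0 ∈ lam.support
    · have h2 : lam.coeff 0 * entropy c = lam.coeff 0 *
          entropy ((convPow (interpB c lam rho (n + 1 : ℕ)) 0).conv c) := by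
        rw [convPow, Measure.dirac_zero_conv]
      rw [h2]
      exact Finset.single_le_sum (f := fun k => lam.coeff k *
          entropy ((convPow (interpB c lam rho (n + 1 : ℕ)) k).conv c)) (fun k _ =>
        mul_nonneg (h.lam_dist.coeff_nonneg k) ((hb.convPow k).conv h.channel).entropy_nonneg) h0
    · rw [notMem_support_iff.1 h0, zero_mul]
      exact Finset.sum_nonneg fun k _ => mul_nonneg (h.lam_dist.coeff_nonneg k)
        ((hb.convPow k).conv h.channel).entropy_nonneg
  have h2 := (tendsto_add_atTop_iff_nat 1).2 (hconv.tendsto_entropy h)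
  have h3 := ge_of_tendsto' h2 h1
  have h4 := h.lam_dist.coeff_nonneg 0
  have h5 : 0 < entropy c := lt_of_le_of_ne h.channel.entropy_nonneg hc0.symm
  nlinarith

/-! ### Derivatives of the interpolating families -/

theorem Icc_mem_nhdsLE {n t : ℝ} (ht : t ∈ Ioc (n - 1) n) : Icc (n - 1) n ∈ 𝓝[Iic t] t := by
  filter_upwards [self_mem_nhdsWithin, mem_nhdsWithin_of_mem_nhds (Ioi_mem_nhds ht.1)] with s h1 h2
  exact ⟨h2.le, h1.trans ht.2⟩

theorem Icc_mem_nhdsWithin_univ {n t : ℝ} (ht : t ∈ Ioo (n - 1) n) :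
    Icc (n - 1) n ∈ 𝓝[univ] t := by
  rw [nhdsWithin_univ]; exact Icc_mem_nhds ht.1 ht.2

theorem neg_one_le_of_mem_Icc {n : ℕ} {t : ℝ} (ht : t ∈ Icc ((n : ℝ) - 1) n) : -1 ≤ t := by
  have : (0 : ℝ) ≤ n := n.cast_nonneg
  linarith [ht.1]

theorem Ensemble.exists_derivs (h : Ensemble c lam rho) {n : ℕ} {t : ℝ} {S : Set ℝ}
    (ht : t ∈ Icc ((n : ℝ) - 1) n) (hS : Icc ((n : ℝ) - 1) n ∈ 𝓝[S] t) :
    ∃ e E κ D, HasEntropyDerivs (interpA c lam rho) S t e E κ D :=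
  (h.polyMix_interpA n).exists_derivs (fun _ hs => h.symmLaw_interpA (neg_one_le_of_mem_Icc hs))
    ht hS

theorem Ensemble.exists_left_derivs (h : Ensemble c lam rho) {t : ℝ} (ht : -1 < t) :
    ∃ e E κ D, HasEntropyDerivs (interpA c lam rho) (Iic t) t e E κ D := by
  obtain ⟨n, hn⟩ := exists_nat_mem_Ioc ht
  exact h.exists_derivs (Ioc_subset_Icc_self hn) (Icc_mem_nhdsLE hn)

theorem HasEntropyDerivs.mono {a : ℝ → Measure EReal} {S S' : Set ℝ} {t : ℝ} {e : ℕ → ℝ} {E : ℝ}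
    {κ : EReal → ℝ} {D : Measure EReal → ℝ} (h : HasEntropyDerivs a S t e E κ D) (hS : S' ⊆ S) :
    HasEntropyDerivs a S' t e E κ D where
  gapMoment k := (h.gapMoment k).mono hS
  entropy := h.entropy.mono hS
  hasSum_entropy := h.hasSum_entropy
  softEntropy z := (h.softEntropy z).mono hS
  integrable := h.integrable
  integral := h.integral
  hasSum_conv := h.hasSum_conv
  conv m hm := (h.conv m hm).mono hS

theorem HasEntropyDerivs.leftDeriv_entropy {a : ℝ → Measure EReal} {t : ℝ} {e : ℕ → ℝ} {E : ℝ}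
    {κ : EReal → ℝ} {D : Measure EReal → ℝ} (h : HasEntropyDerivs a (Iic t) t e E κ D) :
    leftDeriv (fun s => Gexit.entropy (a s)) t = E :=
  h.entropy.derivWithin (uniqueDiffWithinAt_Iic t)

theorem HasEntropyDerivs.gexitKernel_eq {a : ℝ → Measure EReal} {t : ℝ} {e : ℕ → ℝ} {E : ℝ}
    {κ : EReal → ℝ} {D : Measure EReal → ℝ} (h : HasEntropyDerivs a (Iic t) t e E κ D) :
    gexitKernel a t = fun z => κ z / E := by
  funext z
  rw [gexitKernel, h.leftDeriv_entropy]
  congr 1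
  exact (h.softEntropy z).derivWithin (uniqueDiffWithinAt_Iic t)

theorem HasEntropyDerivs.integrable_gexitKernel {a : ℝ → Measure EReal} {t : ℝ} {e : ℕ → ℝ} {E : ℝ}
    {κ : EReal → ℝ} {D : Measure EReal → ℝ} (h : HasEntropyDerivs a (Iic t) t e E κ D)
    {m : Measure EReal} (hm : SymmLaw m) : Integrable (gexitKernel a t) m := by
  rw [h.gexitKernel_eq]
  exact (h.integrable m hm).div_const _

/-- Averaging the kernel over `m` produces the derivative of the entropy of `a ⋆ m`, to which the
moment expansion applies. -/
theorem HasEntropyDerivs.gexit_eq {a : ℝ → Measure EReal} {t : ℝ} {e : ℕ → ℝ} {E : ℝ}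
    {κ : EReal → ℝ} {D : Measure EReal → ℝ} (h : HasEntropyDerivs a (Iic t) t e E κ D)
    {m : Measure EReal} (hm : SymmLaw m) : gexit a t m = D m / E := by
  rw [gexit, h.gexitKernel_eq, integral_div, h.integral m hm]

theorem Ensemble.deriv_gapMoment_nonpos (h : Ensemble c lam rho) {t : ℝ} (ht : -1 < t)
    {e : ℕ → ℝ} {E : ℝ} {κ : EReal → ℝ} {D : Measure EReal → ℝ}
    (hd : HasEntropyDerivs (interpA c lam rho) (Iic t) t e E κ D) (k : ℕ) : e k ≤ 0 := by
  have h1 : AntitoneOn (fun s => gapMoment k (interpA c lam rho s)) (Icc (-1) t) :=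
    fun x hx y _ hxy => h.gapMoment_antitone k hx.1 hxy
  have h2 := ((hd.gapMoment k).mono (Icc_subset_Iic_self : Icc (-1) t ⊆ Iic t)).derivWithin
    (uniqueDiffOn_Icc ht t (right_mem_Icc.2 ht.le))
  rw [← h2]
  exact h1.derivWithin_nonpos

/-- By monotonicity it suffices to look at the initial segment, where any positive weight on `c`
gives strictness. This keeps the argument of `rho.derivative` positive later on. -/
theorem Ensemble.gapMoment_lt_one (h : Ensemble c lam rho) (hconv : ConvergesToPerfect c lam rho)
    (k : ℕ) {t : ℝ} (ht : -1 < t) : gapMoment k (interpA c lam rho t) < 1 := by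
  have h1 : -1 < min t 0 := lt_min ht (by norm_num)
  refine (h.gapMoment_antitone k h1.le (min_le_left t 0)).trans_lt ?_
  rw [h.gapMoment_initial k h1.le (min_le_right _ _)]
  have := hconv.gapMoment_lt_one h k
  nlinarith

theorem Ensemble.gapMoment_interpB (h : Ensemble c lam rho) (k : ℕ) {t : ℝ} (ht : 0 ≤ t) :
    gapMoment k (interpB c lam rho t) =
      1 - rho.eval (1 - gapMoment k (interpA c lam rho (t - 1))) := by
  have := (h.symmLaw_interpA (t := t - 1) (by linarith)).one_sub_gapMoment_checkMap k h.rho_dist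
  rw [← this, interpB]
  ring

/-- If the channel or the previous density is perfect, so is the next one. For the previous density
this uses that no variable node has degree one. -/
theorem Ensemble.entropy_interpA_sub_one_ne_zero (h : Ensemble c lam rho)
    (hconv : ConvergesToPerfect c lam rho) {t : ℝ} (ht : 0 ≤ t)
    (hne : entropy (interpA c lam rho t) ≠ 0) :
    entropy c ≠ 0 ∧ entropy (interpA c lam rho (t - 1)) ≠ 0 := by
  have hb := h.symmLaw_interpB ht
  have hsum := entropy_variableMap h.channel hb h.lam_dist
  rw [← h.interpA_eq ht] at hsum
  have hc0 : entropy c ≠ 0 := by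
    intro h0
    refine hne (hsum.trans (Finset.sum_eq_zero fun k _ => ?_))
    have h1 := (hb.convPow k).entropy_conv_le_right h.channel
    have h2 := ((hb.convPow k).conv h.channel).entropy_nonneg
    rw [h0] at h1
    rw [le_antisymm h1 h2, mul_zero]
  refine ⟨hc0, fun h0 => hne (hsum.trans (Finset.sum_eq_zero fun k _ => ?_))⟩
  have ha := h.symmLaw_interpA (t := t - 1) (by linarith)
  have hb0 : entropy (interpB c lam rho t) = 0 := hb.entropy_eq_zero fun i => by
    rw [h.gapMoment_interpB i ht, ha.gapMoment_eq_zero h0, sub_zero, h.rho_dist.eval_one, sub_self]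
  rcases k with _ | k
  · rw [h.lam_zero hconv hc0, zero_mul]
  · have h1 := (hb.convPow (k + 1)).entropy_conv_le_left h.channel
    have h2 := ((hb.convPow (k + 1)).conv h.channel).entropy_nonneg
    have h3 := (hb.convPow k).entropy_conv_le_right hb
    rw [hb0] at h3
    rw [le_antisymm (h1.trans h3) h2, mul_zero]

/-- Since `rho(x) ≤ x` on the unit interval, a check node does not decrease gap moments. -/
theorem Ensemble.entropy_interpB_ne_zero (h : Ensemble c lam rho) {t : ℝ} (ht : 0 ≤ t)
    (hne : entropy (interpA c lam rho (t - 1)) ≠ 0) : entropy (interpB c lam rho t) ≠ 0 := by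
  have ha := h.symmLaw_interpA (t := t - 1) (by linarith)
  refine (h.symmLaw_interpB ht).entropy_ne_zero (k := 0) ?_
  rw [h.gapMoment_interpB 0 ht]
  have h1 := ha.gapMoment_pos hne 0
  have h2 := ha.gapMoment_le_one 0
  have := h.rho_dist.eval_le_self h.rho_zero (x := 1 - gapMoment 0 (interpA c lam rho (t - 1)))
    (by linarith) (by linarith)
  linarith

theorem Ensemble.hasDerivWithinAt_gapMoment_interpB (h : Ensemble c lam rho) {t : ℝ} (ht : 0 < t)
    {k : ℕ} {e : ℝ}
    (he : HasDerivWithinAt (fun s => gapMoment k (interpA c lam rho s)) e (Iic (t - 1)) (t - 1)) :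
    HasDerivWithinAt (fun s => gapMoment k (interpB c lam rho s))
      (rho.derivative.eval (1 - gapMoment k (interpA c lam rho (t - 1))) * e) (Iic t) t := by
  have h1 : HasDerivWithinAt (fun s => gapMoment k (interpA c lam rho (s - 1))) (e * 1)
      (Iic t) t :=
    HasDerivWithinAt.comp (h := fun s : ℝ => s - 1) (s := Iic t) t he
      ((hasDerivAt_id t).sub_const 1).hasDerivWithinAt fun s hs =>
        mem_Iic.2 (sub_le_sub_right (mem_Iic.1 hs) (1 : ℝ))
  have h2 := ((rho.hasDerivAt _).comp_hasDerivWithinAt t (h1.const_sub 1)).const_sub 1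
  refine (h2.congr_of_eventuallyEq ?_ (h.gapMoment_interpB k ht.le)).congr_deriv (by ring)
  filter_upwards [mem_nhdsWithin_of_mem_nhds (Ioi_mem_nhds ht)] with s hs
  exact h.gapMoment_interpB k (le_of_lt hs)

/-- Strict decrease is carried from one unit interval to the next. Check nodes multiply the moment
derivatives by positive numbers. Variable nodes mix the moments, so the passage goes through the
entropy, and the index `k` may change at each step. -/
theorem Ensemble.exists_deriv_gapMoment_neg (h : Ensemble c lam rho)
    (hconv : ConvergesToPerfect c lam rho) (n : ℕ) {t : ℝ} (ht : t ∈ Ioc ((n : ℝ) - 1) n)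
    (hne : entropy (interpA c lam rho t) ≠ 0) {e : ℕ → ℝ} {E : ℝ} {κ : EReal → ℝ}
    {D : Measure EReal → ℝ} (hd : HasEntropyDerivs (interpA c lam rho) (Iic t) t e E κ D) :
    ∃ k, e k < 0 := by
  induction n generalizing t e E κ D with
  | zero =>
    norm_num at ht
    refine ⟨0, ?_⟩
    have h1 : HasDerivWithinAt (fun s : ℝ => -s + (1 + s) * gapMoment 0 c) (-1 + 1 * gapMoment 0 c)
        (Icc (-1) t) t :=
      (((hasDerivAt_id t).neg).add (((hasDerivAt_id t).const_add 1).mul_const _)).hasDerivWithinAt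
    have h2 := (hd.gapMoment 0).mono (Icc_subset_Iic_self : Icc (-1) t ⊆ Iic t)
    have h3 := h1.congr (f₁ := fun s => gapMoment 0 (interpA c lam rho s))
      (fun s hs => h.gapMoment_initial 0 hs.1 (hs.2.trans ht.2))
      (h.gapMoment_initial 0 ht.1.le ht.2)
    rw [(uniqueDiffOn_Icc ht.1 t (right_mem_Icc.2 ht.1.le)).eq_deriv _ h2 h3]
    linarith [hconv.gapMoment_lt_one h 0]
  | succ n ih =>
    have ht1 : t - 1 ∈ Ioc ((n : ℝ) - 1) n := by
      push_cast at ht; constructor <;> linarith [ht.1, ht.2]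
    have hn : (0 : ℝ) ≤ n := n.cast_nonneg
    have htpos : 0 < t := by linarith [ht1.1]
    obtain ⟨hc0, hne1⟩ := h.entropy_interpA_sub_one_ne_zero hconv htpos.le hne
    obtain ⟨e₁, E₁, κ₁, D₁, hd₁⟩ := h.exists_left_derivs (t := t - 1) (by linarith)
    obtain ⟨k, hk⟩ := ih ht1 hne1 hd₁
    have hI : Icc (((n + 1 : ℕ) : ℝ) - 1) (n + 1 : ℕ) ∈ 𝓝[Iic t] t := Icc_mem_nhdsLE ht
    have hsymmB : ∀ s ∈ Icc (((n + 1 : ℕ) : ℝ) - 1) (n + 1 : ℕ), SymmLaw (interpB c lam rho s) :=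
      fun s hs => h.symmLaw_interpB (sub_one_mem_Icc hs).2
    obtain ⟨e₂, E₂, κ₂, D₂, hd₂⟩ := (h.polyMix_interpB n).exists_derivs hsymmB
      (Ioc_subset_Icc_self ht) hI
    have hS := uniqueDiffWithinAt_Iic t
    have he₂ : ∀ i, e₂ i =
        rho.derivative.eval (1 - gapMoment i (interpA c lam rho (t - 1))) * e₁ i := fun i =>
      hS.eq_deriv _ (hd₂.gapMoment i) (h.hasDerivWithinAt_gapMoment_interpB htpos (hd₁.gapMoment i))
    have hpos : ∀ i, 0 < rho.derivative.eval (1 - gapMoment i (interpA c lam rho (t - 1))) :=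
      fun i => h.rho_dist.derivative_eval_pos h.rho_zero
        (sub_pos.2 (h.gapMoment_lt_one hconv i (by linarith)))
    have he₁ := fun i => h.deriv_gapMoment_nonpos (by linarith) hd₁ i
    -- All terms of the series are nonpositive. The one inherited from the previous interval is
    -- strictly negative because an imperfect `m` has positive gap moments.
    have hD₂ : ∀ m, SymmLaw m → entropy m ≠ 0 → D₂ m < 0 := by
      intro m hm hm0
      have h1 := hd₂.hasSum_conv m hm
      have h2 := le_hasSum h1.neg k fun j _ => ?_
      · have h3 : entropyCoeff k * (e₂ k * gapMoment k m) < 0 := by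
          rw [he₂]
          exact mul_neg_of_pos_of_neg (entropyCoeff_pos k) (mul_neg_of_neg_of_pos
            (mul_neg_of_pos_of_neg (hpos k) hk) (hm.gapMoment_pos hm0 k))
        linarith
      · rw [he₂, neg_nonneg]
        exact mul_nonpos_of_nonneg_of_nonpos (entropyCoeff_pos j).le
          (mul_nonpos_of_nonpos_of_nonneg
            (mul_nonpos_of_nonneg_of_nonpos (hpos j).le (he₁ j)) (hm.gapMoment_nonneg j))
    have hb := h.symmLaw_interpB htpos.le
    have hbne := h.entropy_interpB_ne_zero htpos.le hne1
    have hcp := h.channel.isProbability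
    have hE := hd₂.variableMap h.channel (h.polyMix_interpB n) hsymmB (Ioc_subset_Icc_self ht) hI hS
      h.lam_dist symmLaw_dirac_zero
    rw [Measure.conv_dirac_zero] at hE
    have hE' := hE.congr_of_eventuallyEq (f₁ := fun s => entropy (interpA c lam rho s))
      (mem_of_superset hI fun s hs => by
        have := (h.channel.variableMap (hsymmB s hs) h.lam_dist).isProbability
        simp only [mem_ofPred_eq]
        rw [Measure.conv_dirac_zero, h.interpA_eq (sub_one_mem_Icc hs).2])
      (by
        have := (h.channel.variableMap hb h.lam_dist).isProbability
        rw [Measure.conv_dirac_zero, h.interpA_eq htpos.le])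
    have hEneg : E < 0 := by
      rw [hS.eq_deriv _ hd.entropy hE']
      obtain ⟨j, hj, hj0, hjp⟩ := h.lam_dist.exists_succ_coeff_pos (h.lam_zero hconv hc0)
      have hterm : ∀ i, D₂ ((convPow (interpB c lam rho t) (i - 1)).conv c) < 0 := fun i =>
        hD₂ _ ((hb.convPow _).conv h.channel) ((hb.convPow _).entropy_conv_ne_zero h.channel
          (hb.entropy_convPow_ne_zero hbne _) hc0)
      refine Finset.sum_neg' (fun i _ => ?_) ⟨j, hj, ?_⟩
      · exact mul_nonpos_of_nonneg_of_nonpos (h.lam_dist.coeff_nonneg i)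
          (mul_nonpos_of_nonneg_of_nonpos i.cast_nonneg (hterm i).le)
      · exact mul_neg_of_pos_of_neg hjp
          (mul_neg_of_pos_of_neg (by exact_mod_cast hj0) (hterm j))
    -- The entropy derivative is a positive combination of the moment derivatives, so some moment
    -- must decrease strictly.
    by_contra! hcon
    exact hEneg.not_ge (hd.hasSum_entropy.nonneg fun i =>
      mul_nonneg (entropyCoeff_pos i).le (hcon i))

theorem Ensemble.deriv_entropy_neg (h : Ensemble c lam rho)
    (hconv : ConvergesToPerfect c lam rho) {t : ℝ} (ht : -1 < t)
    (hne : entropy (interpA c lam rho t) ≠ 0) {e : ℕ → ℝ} {E : ℝ} {κ : EReal → ℝ}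
    {D : Measure EReal → ℝ} (hd : HasEntropyDerivs (interpA c lam rho) (Iic t) t e E κ D) :
    E < 0 := by
  obtain ⟨n, hn⟩ := exists_nat_mem_Ioc ht
  obtain ⟨k, hk⟩ := h.exists_deriv_gapMoment_neg hconv n hn hne hd
  have h2 := le_hasSum hd.hasSum_entropy.neg k fun j _ => neg_nonneg.2
    (mul_nonpos_of_nonneg_of_nonpos (entropyCoeff_pos j).le (h.deriv_gapMoment_nonpos ht hd j))
  have h3 := mul_neg_of_pos_of_neg (entropyCoeff_pos k) hk
  linarith

/-! ### Bounds for the GEXIT functional -/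

theorem Ensemble.deriv_conv_nonpos (h : Ensemble c lam rho) {t : ℝ} (ht : -1 < t)
    {e : ℕ → ℝ} {E : ℝ} {κ : EReal → ℝ} {D : Measure EReal → ℝ}
    (hd : HasEntropyDerivs (interpA c lam rho) (Iic t) t e E κ D) {m : Measure EReal}
    (hm : SymmLaw m) : D m ≤ 0 :=
  (hd.hasSum_conv m hm).nonpos fun k => mul_nonpos_of_nonneg_of_nonpos (entropyCoeff_pos k).le
    (mul_nonpos_of_nonpos_of_nonneg (h.deriv_gapMoment_nonpos ht hd k) (hm.gapMoment_nonneg k))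

theorem Ensemble.deriv_entropy_le (h : Ensemble c lam rho) {t : ℝ} (ht : -1 < t)
    {e : ℕ → ℝ} {E : ℝ} {κ : EReal → ℝ} {D : Measure EReal → ℝ}
    (hd : HasEntropyDerivs (interpA c lam rho) (Iic t) t e E κ D) {m : Measure EReal}
    (hm : SymmLaw m) : E ≤ D m := by
  refine hasSum_le (fun k => ?_) hd.hasSum_entropy (hd.hasSum_conv m hm)
  refine mul_le_mul_of_nonneg_left ?_ (entropyCoeff_pos k).le
  nlinarith [h.deriv_gapMoment_nonpos ht hd k, hm.gapMoment_le_one k]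

/-- Gap moments in `[0, 1]` place the numerator between the denominator and zero. If the denominator
vanishes, the quotient is `0`. -/
theorem Ensemble.gexit_mem (h : Ensemble c lam rho) {t : ℝ} (ht : -1 < t) {m : Measure EReal}
    (hm : SymmLaw m) : gexit (interpA c lam rho) t m ∈ Icc (0 : ℝ) 1 := by
  obtain ⟨e, E, κ, D, hd⟩ := h.exists_left_derivs ht
  rw [hd.gexit_eq hm]
  have h1 := h.deriv_conv_nonpos ht hd hm
  have h2 := h.deriv_entropy_le ht hd hm
  refine ⟨div_nonneg_of_nonpos h1 (h2.trans h1), ?_⟩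
  rw [← neg_div_neg_eq]
  exact div_le_one_of_le₀ (by linarith) (by linarith)

/-- Equal values at `s < t` make the monotone entropy constant on `[s, t]`, contradicting its
negative left derivative at `t`. -/
theorem Ensemble.entropy_injOn (h : Ensemble c lam rho) (hconv : ConvergesToPerfect c lam rho)
    {s t : ℝ} (hs : -1 ≤ s) (ht : -1 ≤ t)
    (hst : entropy (interpA c lam rho s) = entropy (interpA c lam rho t))
    (hne : entropy (interpA c lam rho s) ≠ 0) : s = t := by
  wlog hlt : s < t generalizing s t
  · rcases eq_or_lt_of_le (not_lt.1 hlt) with h1 | h1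
    · exact h1.symm
    · exact (this ht hs hst.symm (hst ▸ hne) h1).symm
  exfalso
  have ht' : -1 < t := hs.trans_lt hlt
  obtain ⟨e, E, κ, D, hd⟩ := h.exists_left_derivs ht'
  have h1 := h.deriv_entropy_neg hconv ht' (hst ▸ hne) hd
  have h2 := hd.entropy.mono (Icc_subset_Iic_self : Icc s t ⊆ Iic t)
  have hconst : ∀ r ∈ Icc s t, entropy (interpA c lam rho r) = entropy (interpA c lam rho t) :=
    fun r hr => le_antisymm (hst ▸ h.entropy_antitone hs (hs.trans hr.1) hr.1)
      (h.entropy_antitone (hs.trans hr.1) ht hr.2)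
  have h3 : HasDerivWithinAt (fun r => entropy (interpA c lam rho r)) 0 (Icc s t) t :=
    (hasDerivWithinAt_const t _ (entropy (interpA c lam rho t))).congr hconst rfl
  have h4 := (uniqueDiffOn_Icc hlt t (right_mem_Icc.2 hlt.le)).eq_deriv _ h2 h3
  linarith

theorem Ensemble.gexit_le_gexit (h : Ensemble c lam rho) (hconv : ConvergesToPerfect c lam rho)
    {s t : ℝ} (hs : -1 < s) (ht : 0 ≤ t)
    (hst : entropy (interpA c lam rho s) = entropy (interpA c lam rho t)) :
    gexit (interpA c lam rho) s (interpB c lam rho (s + 1)) ≤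
      gexit (interpA c lam rho) t (interpB c lam rho t) := by
  have hb := h.symmLaw_interpB (t := s + 1) (by linarith)
  have hb' := h.symmLaw_interpB ht
  have ht' : -1 < t := by linarith
  by_cases hne : entropy (interpA c lam rho s) = 0
  -- At abscissa zero the parameters may differ. The check output is then perfect, so the left
  -- ordinate is zero.
  · refine le_trans (le_of_eq ?_) (h.gexit_mem ht' hb').1
    obtain ⟨e, E, κ, D, hd⟩ := h.exists_left_derivs hs
    have h1 := hd.hasSum_conv _ hb
    have hg : ∀ k, gapMoment k (interpB c lam rho (s + 1)) = 0 := fun k => by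
      rw [h.gapMoment_interpB k (by linarith), add_sub_cancel_right,
        (h.symmLaw_interpA hs.le).gapMoment_eq_zero hne, sub_zero, h.rho_dist.eval_one, sub_self]
    simp only [hg, mul_zero] at h1
    rw [hd.gexit_eq hb, h1.unique hasSum_zero, zero_div]
  · obtain rfl := h.entropy_injOn hconv hs.le ht'.le hst hne
    obtain ⟨e, E, κ, D, hd⟩ := h.exists_left_derivs hs
    rw [hd.gexit_eq hb, hd.gexit_eq hb']
    -- The denominators agree and are negative, so the larger numerator gives the smaller quotient.
    -- It belongs to `b_{s+1}`, whose gap moments are smaller, because these are weighted by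
    -- nonpositive derivatives.
    refine div_le_div_of_nonpos_of_le (h.deriv_entropy_neg hconv hs hne hd).le ?_
    refine hasSum_le (fun k => mul_le_mul_of_nonneg_left ?_ (entropyCoeff_pos k).le)
      (hd.hasSum_conv _ hb') (hd.hasSum_conv _ hb)
    refine mul_le_mul_of_nonpos_left ?_ (h.deriv_gapMoment_nonpos hs hd k)
    rw [h.gapMoment_interpB k ht, h.gapMoment_interpB k (by linarith), add_sub_cancel_right]
    have h1 := h.gapMoment_antitone k (s := s - 1) (t := s) (by linarith) (by linarith)
    have h2 := (h.symmLaw_interpA (t := s - 1) (by linarith)).gapMoment_le_one k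
    have h3 := h.rho_dist.eval_mono (sub_nonneg.2 h2) (sub_le_sub_left h1 1)
    linarith

theorem Ensemble.existsUnique_entropy_eq (h : Ensemble c lam rho)
    (hconv : ConvergesToPerfect c lam rho) {x : ℝ} (hx : x ∈ Ioc (0 : ℝ) 1) :
    ∃! t : ℝ, -1 ≤ t ∧ entropy (interpA c lam rho t) = x := by
  obtain ⟨n, hn⟩ := ((hconv.tendsto_entropy h).eventually (gt_mem_nhds hx.1)).exists
  have hn0 : (-1 : ℝ) ≤ n := by linarith [n.cast_nonneg (α := ℝ)]
  have h1 := intermediate_value_Icc' hn0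
    -- The entropy runs continuously from one at `-1` to a value below `x`.
    (h.continuousOn_entropy.mono Icc_subset_Ici_self)
  rw [interpA_neg_one, entropy_dirac_zero] at h1
  obtain ⟨t, ht, hxt⟩ := h1 ⟨hn.le, hx.2⟩
  refine ⟨t, ⟨ht.1, hxt⟩, fun s hs => ?_⟩
  have hxt' : entropy (interpA c lam rho t) = x := hxt
  exact h.entropy_injOn hconv hs.1 ht.1 (hs.2.trans hxt'.symm) (hs.2 ▸ hx.1.ne')

/-! ### Potentials -/

theorem polyIntegral_eq_sum (p : ℝ[X]) :
    polyIntegral p = ∑ k ∈ p.support, p.coeff k / (k + 1) := by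
  unfold polyIntegral
  simp only [eval_eq_sum_support]
  rw [intervalIntegral.integral_finsetSum fun k _ => by
    exact (continuous_const.mul (continuous_pow k)).intervalIntegrable _ _]
  refine Finset.sum_congr rfl fun k _ => ?_
  rw [intervalIntegral.integral_const_mul, integral_pow]
  simp [div_eq_mul_inv]

/-- An antiderivative for the area under the check node curve. -/
def checkPotential (c : Measure EReal) (lam rho : ℝ[X]) (t : ℝ) : ℝ :=
  -entropy (interpA c lam rho t) + ∑ k ∈ rho.support,
    rho.coeff k / (k + 1) * entropy (checkPow (interpA c lam rho t) (k + 1))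

/-- An antiderivative for the area to the left of the variable node curve. -/
def variablePotential (c : Measure EReal) (lam rho : ℝ[X]) (t : ℝ) : ℝ :=
  -entropy (interpA c lam rho t) + ∑ k ∈ lam.support,
    lam.coeff k * (k / (k + 1)) * entropy ((convPow (interpB c lam rho t) (k + 1)).conv c)

/-- Compare moment by moment. The factor `1 / (k + 1)` cancels the one from differentiating the
check power, leaving `-e (1 - ρ(1 - g))`, and `1 - ρ(1 - g)` is the gap moment of `b_{t+1}`. -/
theorem Ensemble.hasDerivAt_checkPotential (h : Ensemble c lam rho) {n : ℕ} {t : ℝ}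
    (ht : t ∈ Ioo ((n : ℝ) - 1) n) {e : ℕ → ℝ} {E : ℝ} {κ : EReal → ℝ} {D : Measure EReal → ℝ}
    (hd : HasEntropyDerivs (interpA c lam rho) univ t e E κ D) :
    HasDerivAt (checkPotential c lam rho) (-D (interpB c lam rho (t + 1))) t := by
  have ht1 : -1 ≤ t := neg_one_le_of_mem_Icc (Ioo_subset_Icc_self ht)
  choose P hP hsum using fun k => hd.checkPow (h.polyMix_interpA n)
    (fun s hs => h.symmLaw_interpA (neg_one_le_of_mem_Icc hs)) (Ioo_subset_Icc_self ht)
    (Icc_mem_nhdsWithin_univ ht) uniqueDiffWithinAt_univ k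
  have h1 : HasDerivWithinAt (checkPotential c lam rho)
      (-E + ∑ k ∈ rho.support, rho.coeff k / (k + 1) * P k) univ t :=
    hd.entropy.neg.add (HasDerivWithinAt.fun_sum fun k _ => (hP k).const_mul _)
  rw [hasDerivWithinAt_univ] at h1
  convert! h1 using 1
  have h2 := hd.hasSum_entropy.neg.add
    (hasSum_sum (s := rho.support) fun k _ => (hsum k).mul_left (rho.coeff k / ((k : ℝ) + 1)))
  refine ((hd.hasSum_conv _ (h.symmLaw_interpB (by linarith))).neg.unique ?_)
  convert! h2 using 1
  funext i
  rw [h.gapMoment_interpB i (by linarith), add_sub_cancel_right, eval_eq_sum_support, mul_sub,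
    mul_one, Finset.mul_sum, mul_sub, neg_sub, Finset.mul_sum, sub_eq_neg_add]
  congr 1
  refine Finset.sum_congr rfl fun k _ => ?_
  have : (k : ℝ) + 1 ≠ 0 := by positivity
  field_simp

/-- Differentiating the `(k+1)`-fold power gives `k + 1` equal terms, and the weight `k / (k + 1)`
reduces them to `k`. This is the product rule for `a_s ⋆ b_t` in `s`: the frozen `b_t` refills the
factor removed from the `k`-th power. -/
theorem Ensemble.hasDerivAt_variablePotential (h : Ensemble c lam rho) {n : ℕ} {t : ℝ}
    (ht : t ∈ Ioo (((n + 1 : ℕ) : ℝ) - 1) (n + 1 : ℕ)) {e : ℕ → ℝ} {E : ℝ} {κ : EReal → ℝ}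
    {D : Measure EReal → ℝ} (hd : HasEntropyDerivs (interpA c lam rho) univ t e E κ D) :
    HasDerivAt (variablePotential c lam rho) (-E + D (interpB c lam rho t)) t := by
  have htI := Ioo_subset_Icc_self ht
  have ht0 : 0 ≤ t := (sub_one_mem_Icc htI).2
  have hI := Icc_mem_nhdsWithin_univ ht
  have hS : UniqueDiffWithinAt ℝ univ t := uniqueDiffWithinAt_univ
  have hsymmB : ∀ s ∈ Icc (((n + 1 : ℕ) : ℝ) - 1) (n + 1 : ℕ), SymmLaw (interpB c lam rho s) :=
    fun s hs => h.symmLaw_interpB (sub_one_mem_Icc hs).2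
  have hb := h.symmLaw_interpB ht0
  have := h.channel.isProbability
  have := hb.isProbability
  obtain ⟨e₂, E₂, κ₂, D₂, hd₂⟩ := (h.polyMix_interpB n).exists_derivs hsymmB htI hI
  have h1 : HasDerivWithinAt (variablePotential c lam rho)
      (-E + ∑ k ∈ lam.support, lam.coeff k * (k / (k + 1)) *
        ((k + 1 : ℕ) * D₂ ((convPow (interpB c lam rho t) (k + 1 - 1)).conv c))) univ t :=
    hd.entropy.neg.add (HasDerivWithinAt.fun_sum fun k _ =>
      (hd₂.convPow (h.polyMix_interpB n) hsymmB htI hI hS (k + 1) h.channel).const_mul _)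
  rw [hasDerivWithinAt_univ] at h1
  convert! h1 using 2
  have h2 := (hd₂.variableMap h.channel (h.polyMix_interpB n) hsymmB htI hI hS h.lam_dist
    hb).congr_of_eventuallyEq
    (f₁ := fun s => entropy ((interpA c lam rho s).conv (interpB c lam rho t)))
    (mem_of_superset hI fun s hs => by
      simp only [mem_ofPred_eq]; rw [h.interpA_eq (sub_one_mem_Icc hs).2])
    (by rw [h.interpA_eq ht0])
  rw [hS.eq_deriv _ (hd.conv _ hb) h2]
  refine Finset.sum_congr rfl fun k _ => ?_
  rcases k with _ | k
  · simp
  · have := (hb.convPow k).isProbability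
    simp only [Nat.add_sub_cancel]
    rw [convPow, Measure.conv_assoc, Measure.conv_comm c]
    push_cast
    have : (k : ℝ) + 1 + 1 ≠ 0 := by positivity
    field_simp

theorem Ensemble.continuousOn_checkPotential (h : Ensemble c lam rho) :
    ContinuousOn (checkPotential c lam rho) (Ici (-1)) := by
  have h1 := continuousOn_Ici_of_pieces (f := checkPotential c lam rho) (k := 0) fun n _ =>
    ((h.polyMix_interpA n).continuousOn_integral symmIntegrable_exitKernel).neg.add
      (continuousOn_finsetSum _ fun k _ => continuousOn_const.mul
        (((h.polyMix_interpA n).checkPow (k + 1)).continuousOn_integral symmIntegrable_exitKernel))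
  simpa using h1

theorem Ensemble.continuousOn_variablePotential (h : Ensemble c lam rho) :
    ContinuousOn (variablePotential c lam rho) (Ici 0) := by
  have h1 := continuousOn_Ici_of_pieces (f := variablePotential c lam rho) (k := 1) fun n hn => by
    obtain ⟨n, rfl⟩ := Nat.exists_eq_add_of_le' hn
    exact ((h.polyMix_interpA (n + 1)).continuousOn_integral symmIntegrable_exitKernel).neg.add
      (continuousOn_finsetSum _ fun k _ => continuousOn_const.mul
        ((((h.polyMix_interpB n).convPow (k + 1)).conv
          (PolyMix.const _ h.channel)).continuousOn_integral symmIntegrable_exitKernel))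
  simpa using h1

theorem SymmLaw.entropy_checkPow_le {m : Measure EReal} (hm : SymmLaw m) (k : ℕ) :
    entropy (Gexit.checkPow m k) ≤ k * entropy m := by
  refine hasSum_le (fun i => ?_) (hm.checkPow k).hasSum_entropy (hm.hasSum_entropy.mul_left _)
  have h1 := hm.one_sub_gapMoment_checkPow i k
  -- Bernoulli's inequality `1 - (1 - g)^k ≤ k g`, a union bound over the check inputs.
  have h2 := one_add_mul_le_pow (a := -gapMoment i m) (by linarith [hm.gapMoment_le_one i]) k
  rw [← sub_eq_add_neg, ← h1] at h2
  have h3 : gapMoment i (Gexit.checkPow m k) ≤ k * gapMoment i m := by linarith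
  have := mul_le_mul_of_nonneg_left h3 (entropyCoeff_pos i).le
  linarith

theorem SymmLaw.entropy_checkMap {m : Measure EReal} (hm : SymmLaw m) {rho : ℝ[X]}
    (hrho : IsDegreeDistribution rho) : entropy (Gexit.checkMap rho m) =
      ∑ k ∈ rho.support, rho.coeff k * entropy (Gexit.checkPow m k) :=
  integral_sum_smul _ _ _ (fun k _ => hrho.coeff_nonneg k)
    fun k _ => symmIntegrable_exitKernel.integrable _ (hm.checkPow k)

theorem Ensemble.tendsto_entropy_checkPow (h : Ensemble c lam rho)
    (hconv : ConvergesToPerfect c lam rho) (k : ℕ) :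
    Tendsto (fun n : ℕ => entropy (checkPow (interpA c lam rho n) k)) atTop (𝓝 0) := by
  have hs : ∀ n : ℕ, SymmLaw (interpA c lam rho n) := fun n =>
    h.symmLaw_interpA (by linarith [n.cast_nonneg (α := ℝ)])
  have h1 := (hconv.tendsto_entropy h).const_mul (k : ℝ)
  rw [mul_zero] at h1
  exact squeeze_zero (fun n => ((hs n).checkPow k).entropy_nonneg)
    (fun n => (hs n).entropy_checkPow_le k) h1

theorem Ensemble.tendsto_checkPotential (h : Ensemble c lam rho)
    (hconv : ConvergesToPerfect c lam rho) :
    Tendsto (fun n : ℕ => checkPotential c lam rho n) atTop (𝓝 0) := by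
  have h1 := (hconv.tendsto_entropy h).neg.add (tendsto_finsetSum rho.support fun k _ =>
    (h.tendsto_entropy_checkPow hconv (k + 1)).const_mul (rho.coeff k / (k + 1)))
  unfold checkPotential
  simpa using h1

theorem Ensemble.tendsto_variablePotential (h : Ensemble c lam rho)
    (hconv : ConvergesToPerfect c lam rho) :
    Tendsto (fun n : ℕ => variablePotential c lam rho n) atTop (𝓝 0) := by
  rw [← tendsto_add_atTop_iff_nat 1]
  have hs : ∀ n : ℕ, SymmLaw (interpB c lam rho (n + 1 : ℕ)) := fun n =>
    h.symmLaw_interpB (Nat.cast_nonneg _)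
  have hB : Tendsto (fun n : ℕ => entropy (interpB c lam rho (n + 1 : ℕ))) atTop (𝓝 0) := by
    have h2 := tendsto_finsetSum rho.support fun k _ =>
      (h.tendsto_entropy_checkPow hconv k).const_mul (rho.coeff k)
    simp only [mul_zero, Finset.sum_const_zero] at h2
    refine h2.congr fun n => ?_
    push_cast
    rw [interpB_add_one, (h.symmLaw_interpA
      (by linarith [n.cast_nonneg (α := ℝ)])).entropy_checkMap h.rho_dist]
  -- Each power has at least one factor `b`, and convolution cannot increase the entropy of a
  -- factor.
  have hC : ∀ k : ℕ, Tendsto (fun n : ℕ =>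
      entropy ((convPow (interpB c lam rho (n + 1 : ℕ)) (k + 1)).conv c)) atTop (𝓝 0) := fun k =>
    squeeze_zero (fun n => (((hs n).convPow (k + 1)).conv h.channel).entropy_nonneg)
      (fun n => (((hs n).convPow (k + 1)).entropy_conv_le_left h.channel).trans
        (((hs n).convPow k).entropy_conv_le_right (hs n))) hB
  have h1 := ((tendsto_add_atTop_iff_nat 1).2 (hconv.tendsto_entropy h)).neg.add
    (tendsto_finsetSum lam.support fun k _ =>
      (hC k).const_mul (lam.coeff k * ((k : ℝ) / (k + 1))))
  unfold variablePotential
  simpa using h1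

theorem Ensemble.checkPotential_neg_one (_ : Ensemble c lam rho) :
    checkPotential c lam rho (-1) = polyIntegral rho - 1 := by
  unfold checkPotential
  rw [interpA_neg_one, entropy_dirac_zero, polyIntegral_eq_sum]
  simp only [checkPow_dirac_zero, entropy_dirac_zero, mul_one]
  ring

theorem Ensemble.variablePotential_zero (h : Ensemble c lam rho) :
    variablePotential c lam rho 0 = -(entropy c * polyIntegral lam) := by
  have := h.channel.isProbability
  have hB : interpB c lam rho 0 = Measure.dirac 0 := by
    rw [interpB, zero_sub, interpA_neg_one]
    refine Eq.trans (Finset.sum_congr rfl fun k hk => ?_) (sum_ofReal_smul_const h.rho_dist _)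
    rcases k with _ | k
    · exact absurd h.rho_zero (mem_support_iff.1 hk)
    · rw [checkPow_dirac_zero]
  unfold variablePotential
  rw [interpA_zero, polyIntegral_eq_sum, hB]
  simp only [convPow_dirac_zero, Measure.dirac_zero_conv]
  rw [← Finset.sum_mul]
  -- The incoming density is `Δ_0`, so every convolution reduces to `c`. The complementary weights
  -- `1 / (k + 1)` sum to `∫λ`.
  have h1 : ∑ k ∈ lam.support, lam.coeff k * ((k : ℝ) / (k + 1)) =
      1 - ∑ k ∈ lam.support, lam.coeff k / ((k : ℝ) + 1) := by
    rw [eq_sub_iff_add_eq, ← Finset.sum_add_distrib]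
    refine Eq.trans (Finset.sum_congr rfl fun k _ => ?_) h.lam_dist.sum_coeff
    have : (k : ℝ) + 1 ≠ 0 := by positivity
    field_simp
  rw [h1]
  ring

/-! ### Areas of regions in the plane -/

theorem measurableSet_ordinate_mem_Icc {E : Set ℝ} {l u : ℝ → ℝ} (hE : MeasurableSet E)
    (hl : Measurable l) (hu : Measurable u) :
    MeasurableSet {p : ℝ × ℝ | p.1 ∈ E ∧ p.2 ∈ Icc (l p.1) (u p.1)} :=
  (measurable_fst hE).inter ((measurableSet_le (hl.comp measurable_fst) measurable_snd).inter
    (measurableSet_le measurable_snd (hu.comp measurable_fst)))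

theorem volume_ordinate_mem_Icc {E : Set ℝ} {l u : ℝ → ℝ} (hE : MeasurableSet E)
    (hl : Measurable l) (hu : Measurable u) :
    volume {p : ℝ × ℝ | p.1 ∈ E ∧ p.2 ∈ Icc (l p.1) (u p.1)} =
      ∫⁻ x in E, ENNReal.ofReal (u x - l x) := by
  rw [Measure.volume_eq_prod, Measure.prod_apply (measurableSet_ordinate_mem_Icc hE hl hu),
    ← lintegral_indicator hE]
  refine lintegral_congr fun x => ?_
  by_cases hx : x ∈ E
  · rw [indicator_of_mem hx, ← Real.volume_Icc]
    congr 1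
    ext y
    simp [hx]
  · rw [indicator_of_notMem hx]
    simp [hx]

/-- The points of the plane over `X '' s` whose ordinate over `X t` is between `l t` and `u t`. -/
def paramRegion (s : Set ℝ) (X l u : ℝ → ℝ) : Set (ℝ × ℝ) :=
  {p | ∃ t ∈ s, p.1 = X t ∧ p.2 ∈ Icc (l t) (u t)}

/-- Heights are known as functions of the parameter, whereas Fubini needs them as functions of the
abscissa. An injective continuous map on a measurable set is a measurable embedding, so they
transfer measurably. -/
theorem exists_measurable_comp_eqOn {s : Set ℝ} {X : ℝ → ℝ} (hs : MeasurableSet s)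
    (hX : ContinuousOn X s) (hinj : InjOn X s) {g : ℝ → ℝ} (hg : Measurable g) :
    ∃ g' : ℝ → ℝ, Measurable g' ∧ ∀ t ∈ s, g' (X t) = g t := by
  obtain ⟨g', hg', h⟩ := (hX.measurableEmbedding hs hinj).exists_measurable_extend
    (hg.comp measurable_subtype_coe) fun _ => ⟨0⟩
  exact ⟨g', hg', fun t ht => congrFun h ⟨t, ht⟩⟩

theorem measurableSet_volume_paramRegion {s : Set ℝ} {X X' l u : ℝ → ℝ} (hs : MeasurableSet s)
    (hX : ∀ t ∈ s, HasDerivAt X (X' t) t) (hinj : InjOn X s) (hl : Measurable l)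
    (hu : Measurable u) : MeasurableSet (paramRegion s X l u) ∧
      volume (paramRegion s X l u) = ∫⁻ t in s, ENNReal.ofReal (|X' t| * (u t - l t)) := by
  have hcont : ContinuousOn X s := fun t ht => (hX t ht).continuousAt.continuousWithinAt
  obtain ⟨l', hl', hll⟩ := exists_measurable_comp_eqOn hs hcont hinj hl
  obtain ⟨u', hu', huu⟩ := exists_measurable_comp_eqOn hs hcont hinj hu
  have himage : MeasurableSet (X '' s) := hs.image_of_continuousOn_injOn hcont hinj
  have heq : paramRegion s X l u =
      {p : ℝ × ℝ | p.1 ∈ X '' s ∧ p.2 ∈ Icc (l' p.1) (u' p.1)} := by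
    ext ⟨x, y⟩
    constructor
    · rintro ⟨t, ht, hx, hy⟩
      simp only at hx hy
      subst hx
      refine ⟨mem_image_of_mem X ht, ?_⟩
      simpa only [hll t ht, huu t ht] using hy
    · rintro ⟨⟨t, ht, hx⟩, hy⟩
      simp only at hx hy
      subst hx
      exact ⟨t, ht, rfl, by simpa only [hll t ht, huu t ht] using hy⟩
  rw [heq]
  refine ⟨measurableSet_ordinate_mem_Icc himage hl' hu', ?_⟩
  rw [volume_ordinate_mem_Icc himage hl' hu', lintegral_image_eq_lintegral_abs_deriv_mul hs
    (fun t ht => (hX t ht).hasDerivWithinAt) hinj]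
  refine setLIntegral_congr_fun hs fun t ht => ?_
  simp only [hll t ht, huu t ht]
  rw [ENNReal.ofReal_mul (abs_nonneg _)]

/-- The union of the open unit intervals `(x, x + 1), (x + 1, x + 2), …`. -/
def unitIntervals (x : ℝ) : Set ℝ := ⋃ n : ℕ, Ioo (x + n) (x + (n + 1 : ℕ))

theorem isOpen_unitIntervals (x : ℝ) : IsOpen (unitIntervals x) := isOpen_iUnion fun _ => isOpen_Ioo

theorem lintegral_deriv_unitIntervals {F F' : ℝ → ℝ} {x L : ℝ} (hcont : ContinuousOn F (Ici x))
    (hF : ∀ t ∈ unitIntervals x, HasDerivAt F (F' t) t) (hpos : ∀ t ∈ unitIntervals x, 0 ≤ F' t)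
    (hlim : Tendsto (fun n : ℕ => F (x + n)) atTop (𝓝 L)) :
    ∫⁻ t in unitIntervals x, ENNReal.ofReal (F' t) = ENNReal.ofReal (L - F x) := by
  have hdisj : Pairwise (Function.onFun Disjoint
      fun n : ℕ => Ioo (x + n) (x + (n + 1 : ℕ))) := by
    refine (pairwise_disjoint_on _).2 fun m n hmn => Set.disjoint_left.2 fun t hm hn => ?_
    have : ((m + 1 : ℕ) : ℝ) ≤ n := by exact_mod_cast hmn
    linarith [hm.2, hn.1]
  have hstep : ∀ n : ℕ, ∫⁻ t in Ioo (x + n) (x + (n + 1 : ℕ)), ENNReal.ofReal (F' t) =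
      ENNReal.ofReal (F (x + (n + 1 : ℕ)) - F (x + n)) ∧ 0 ≤ F (x + (n + 1 : ℕ)) - F (x + n) := by
    intro n
    have hle : x + n ≤ x + (n + 1 : ℕ) := by push_cast; linarith
    have hsub : Ioo (x + n) (x + (n + 1 : ℕ)) ⊆ unitIntervals x :=
      subset_iUnion (fun n : ℕ => Ioo (x + n) (x + (n + 1 : ℕ))) n
    have hc : ContinuousOn F (Icc (x + n) (x + (n + 1 : ℕ))) :=
      hcont.mono fun t ht => le_trans (by simp) ht.1
    -- Continuity up to the endpoints and the sign of the derivative give integrability. Kinks of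
    -- `F` at the endpoints are harmless, and the contributions telescope.
    have hint := intervalIntegral.integrableOn_deriv_of_nonneg hc (fun t ht => hF t (hsub ht))
      (fun t ht => hpos t (hsub ht))
    have h1 := intervalIntegral.integral_eq_sub_of_hasDerivAt_of_le hle hc
      (fun t ht => hF t (hsub ht)) ((intervalIntegrable_iff_integrableOn_Ioc_of_le hle).2 hint)
    have hae : 0 ≤ᵐ[volume.restrict (Ioo (x + n) (x + (n + 1 : ℕ)))] F' :=
      (ae_restrict_iff' measurableSet_Ioo).2 (Eventually.of_forall fun t ht => hpos t (hsub ht))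
    rw [intervalIntegral.integral_of_le hle, integral_Ioc_eq_integral_Ioo] at h1
    rw [← h1]
    exact ⟨(ofReal_integral_eq_lintegral_ofReal (hint.mono_set Ioo_subset_Ioc_self) hae).symm,
      integral_nonneg_of_ae hae⟩
  rw [unitIntervals, lintegral_iUnion (fun _ => measurableSet_Ioo) hdisj]
  simp only [fun n => (hstep n).1]
  have hsum : HasSum (fun n : ℕ => F (x + (n + 1 : ℕ)) - F (x + n)) (L - F x) := by
    rw [hasSum_iff_tendsto_nat_of_nonneg fun n => (hstep n).2]
    simp only [Finset.sum_range_sub fun n : ℕ => F (x + n)]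
    simpa using hlim.sub_const (F x)
  rw [← ENNReal.ofReal_tsum_of_nonneg (fun n => (hstep n).2) hsum.summable, hsum.tsum_eq]

/-! ### The areas of the two regions -/

theorem exists_mem_Ioo_of_mem_unitIntervals {k : ℕ} {t : ℝ} (ht : t ∈ unitIntervals ((k : ℝ) - 1)) :
    ∃ n : ℕ, t ∈ Ioo (((n + k : ℕ) : ℝ) - 1) (n + k : ℕ) := by
  obtain ⟨n, hn⟩ := mem_iUnion.1 ht
  push_cast at hn
  refine ⟨n, ?_⟩
  push_cast
  exact ⟨by linarith [hn.1], by linarith [hn.2]⟩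

theorem exists_mem_Ioo_or_eq_natCast {t : ℝ} (ht : -1 < t) :
    (∃ n : ℕ, t ∈ Ioo ((n : ℝ) - 1) n) ∨ ∃ n : ℕ, t = n := by
  obtain ⟨n, hn⟩ := exists_nat_mem_Ioc ht
  rcases hn.2.eq_or_lt with h | h
  · exact Or.inr ⟨n, h⟩
  · exact Or.inl ⟨n, hn.1, h⟩

theorem mem_unitIntervals_or_eq_natCast {k : ℕ} {t : ℝ} (ht : (k : ℝ) - 1 < t) :
    t ∈ unitIntervals ((k : ℝ) - 1) ∨ ∃ n : ℕ, t = n := by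
  rcases exists_mem_Ioo_or_eq_natCast (t := t) (by linarith [k.cast_nonneg (α := ℝ)]) with
    ⟨n, hn⟩ | h
  · refine Or.inl (mem_iUnion.2 ⟨n - k, ?_⟩)
    have h1 : k ≤ n := by
      have : (k : ℝ) < n + 1 := by linarith [hn.2]
      exact Nat.lt_succ_iff.1 (by exact_mod_cast this)
    push_cast [h1]
    exact ⟨by linarith [hn.1], by linarith [hn.2]⟩
  · exact Or.inr h

/-- The abscissae at which a GEXIT curve may have a kink or a vertical segment. -/
def exceptionalStrip (c : Measure EReal) (lam rho : ℝ[X]) : Set (ℝ × ℝ) :=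
  insert 0 (range fun n : ℕ => entropy (interpA c lam rho n)) ×ˢ univ

theorem volume_exceptionalStrip (c : Measure EReal) (lam rho : ℝ[X]) :
    volume (exceptionalStrip c lam rho) = 0 := by
  rw [exceptionalStrip, Measure.volume_eq_prod, Measure.prod_prod,
    ((countable_range _).insert 0).measure_zero, zero_mul]

/-- Entropy is nonnegative, so each of its zeros is a minimum. Parameters with zero entropy thus
contribute nothing to the areas. -/
theorem Ensemble.deriv_entropy_eq_zero (h : Ensemble c lam rho) {n : ℕ} {t : ℝ}
    (ht : t ∈ Ioo ((n : ℝ) - 1) n) (h0 : entropy (interpA c lam rho t) = 0) {E : ℝ}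
    (hE : HasDerivAt (fun s => entropy (interpA c lam rho s)) E t) : E = 0 := by
  refine IsLocalMin.hasDerivAt_eq_zero ?_ hE
  filter_upwards [Icc_mem_nhds ht.1 ht.2] with s hs
  rw [h0]
  exact (h.symmLaw_interpA (neg_one_le_of_mem_Icc hs)).entropy_nonneg

/-- The parameters in `unitIntervals x` at which the entropy does not vanish. -/
def regularParams (c : Measure EReal) (lam rho : ℝ[X]) (x : ℝ) : Set ℝ :=
  unitIntervals x ∩ {t | entropy (interpA c lam rho t) ≠ 0}

/-- The height over `H(a_t)` of the region that is described by the potential `F`. -/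
def potentialHeight (c : Measure EReal) (lam rho : ℝ[X]) (F : ℝ → ℝ) (t : ℝ) : ℝ :=
  -deriv F t / deriv (fun s => entropy (interpA c lam rho s)) t

/-- Writing heights with `deriv` makes measurability automatic; they are identified with GEXIT
values only at the parameters that matter. -/
theorem measurable_potentialHeight (c : Measure EReal) (lam rho : ℝ[X]) (F : ℝ → ℝ) :
    Measurable (potentialHeight c lam rho F) :=
  (measurable_deriv F).neg.div (measurable_deriv _)

theorem Ensemble.exists_univ_derivs (h : Ensemble c lam rho) {n : ℕ} {t : ℝ}
    (ht : t ∈ Ioo ((n : ℝ) - 1) n) :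
    ∃ e E κ D, HasEntropyDerivs (interpA c lam rho) univ t e E κ D :=
  h.exists_derivs (Ioo_subset_Icc_self ht) (Icc_mem_nhdsWithin_univ ht)

theorem neg_one_lt_of_mem_Ioo {n : ℕ} {t : ℝ} (ht : t ∈ Ioo ((n : ℝ) - 1) n) : -1 < t := by
  linarith [ht.1, n.cast_nonneg (α := ℝ)]

theorem HasEntropyDerivs.hasDerivAt_entropy {a : ℝ → Measure EReal} {t : ℝ} {e : ℕ → ℝ} {E : ℝ}
    {κ : EReal → ℝ} {D : Measure EReal → ℝ} (h : HasEntropyDerivs a univ t e E κ D) :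
    HasDerivAt (fun s => Gexit.entropy (a s)) E t := by
  simpa only [hasDerivWithinAt_univ] using h.entropy

/-- The part of the plane over the regular parameters between the graphs of `l` and `u` has the
area that is given by a potential whose derivative is the height `u - l` times that of `-H`. -/
theorem Ensemble.measurableSet_volume_paramRegion (h : Ensemble c lam rho)
    (hconv : ConvergesToPerfect c lam rho) (k : ℕ) {F l u : ℝ → ℝ} {L : ℝ}
    (hcont : ContinuousOn F (Ici ((k : ℝ) - 1)))
    (hder : ∀ t ∈ unitIntervals ((k : ℝ) - 1), ∃ E F' : ℝ,
      HasDerivAt (fun s => entropy (interpA c lam rho s)) E t ∧ HasDerivAt F F' t ∧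
        0 ≤ F' ∧ F' ≤ -E)
    (hlim : Tendsto (fun n : ℕ => F n) atTop (𝓝 L)) (hl : Measurable l) (hu : Measurable u)
    (hul : ∀ t, u t - l t = potentialHeight c lam rho F t) :
    MeasurableSet (paramRegion (regularParams c lam rho ((k : ℝ) - 1))
        (fun s => entropy (interpA c lam rho s)) l u) ∧
      volume (paramRegion (regularParams c lam rho ((k : ℝ) - 1))
        (fun s => entropy (interpA c lam rho s)) l u) = ENNReal.ofReal (L - F ((k : ℝ) - 1)) := by
  set U := unitIntervals ((k : ℝ) - 1) with hU
  have hX : ∀ t ∈ U, HasDerivAt (fun s => entropy (interpA c lam rho s))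
      (deriv (fun s => entropy (interpA c lam rho s)) t) t := fun t ht => by
    obtain ⟨_, _, h1, -⟩ := hder t ht
    exact h1.differentiableAt.hasDerivAt
  have hF : ∀ t ∈ U, HasDerivAt F (deriv F t) t ∧ 0 ≤ deriv F t ∧
      deriv F t ≤ -deriv (fun s => entropy (interpA c lam rho s)) t := fun t ht => by
    obtain ⟨E, F', h1, h2, h3⟩ := hder t ht
    rw [h1.deriv, h2.deriv]
    exact ⟨h2, h3⟩
  have hs : MeasurableSet (regularParams c lam rho ((k : ℝ) - 1)) :=
    (ContinuousOn.isOpen_inter_preimage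
      (fun t ht => (hX t ht).continuousAt.continuousWithinAt)
      (isOpen_unitIntervals _) isOpen_ne).measurableSet
  have hge : ∀ t ∈ U, -1 < t := fun t ht => by
    obtain ⟨n, hn⟩ := exists_mem_Ioo_of_mem_unitIntervals ht
    exact neg_one_lt_of_mem_Ioo hn
  have hinj : InjOn (fun s => entropy (interpA c lam rho s))
      (regularParams c lam rho ((k : ℝ) - 1)) := fun s hs t ht hst =>
    h.entropy_injOn hconv (hge s hs.1).le (hge t ht.1).le hst hs.2
  obtain ⟨h1, h2⟩ := Gexit.measurableSet_volume_paramRegion hs (fun t ht => hX t ht.1) hinj hl hu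
  refine ⟨h1, ?_⟩
  have hlim' : Tendsto (fun n : ℕ => F ((k : ℝ) - 1 + n)) atTop (𝓝 L) := by
    rw [← tendsto_add_atTop_iff_nat 1]
    refine (hlim.comp (tendsto_add_atTop_nat k)).congr fun n => ?_
    simp only [Function.comp]
    congr 1
    push_cast
    ring
  rw [h2, ← lintegral_deriv_unitIntervals hcont (fun t ht => (hF t ht).1)
    (fun t ht => (hF t ht).2.1) hlim', ← lintegral_indicator hs,
    ← lintegral_indicator (isOpen_unitIntervals _).measurableSet]
  refine lintegral_congr fun t => ?_
  by_cases htU : t ∈ U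
  · rw [indicator_of_mem htU]
    obtain ⟨n, hn⟩ := exists_mem_Ioo_of_mem_unitIntervals htU
    by_cases ht0 : entropy (interpA c lam rho t) = 0
    -- Where the entropy vanishes, `0 ≤ F' ≤ -E = 0`, so omitting this parameter does not change the
    -- integral.
    · have h3 := (hF t htU).2.2
      rw [h.deriv_entropy_eq_zero hn ht0 (hX t htU), neg_zero] at h3
      rw [indicator_of_notMem fun h' => h'.2 ht0, le_antisymm h3 (hF t htU).2.1,
        ENNReal.ofReal_zero]
    · obtain ⟨e, E, κ, D, hd⟩ := h.exists_univ_derivs hn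
      have hE := h.deriv_entropy_neg hconv (hge t htU) ht0 (hd.mono (subset_univ (Iic t)))
      have hts : t ∈ regularParams c lam rho ((k : ℝ) - 1) := ⟨htU, ht0⟩
      rw [indicator_of_mem hts, hul, potentialHeight, hd.hasDerivAt_entropy.deriv,
        abs_of_neg hE]
      congr 1
      field_simp [hE.ne]
  · rw [indicator_of_notMem htU, indicator_of_notMem fun h' => htU h'.1]

/-- The region under the check node curve without the abscissae of the exceptional strip. -/
def checkCore (c : Measure EReal) (lam rho : ℝ[X]) : Set (ℝ × ℝ) :=
  paramRegion (regularParams c lam rho (((0 : ℕ) : ℝ) - 1))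
    (fun s => entropy (interpA c lam rho s)) (fun _ => 0)
    (potentialHeight c lam rho (checkPotential c lam rho))

/-- The region to the left of the variable node curve without the abscissae of the exceptional
strip. -/
def variableCore (c : Measure EReal) (lam rho : ℝ[X]) : Set (ℝ × ℝ) :=
  paramRegion (regularParams c lam rho (((1 : ℕ) : ℝ) - 1))
    (fun s => entropy (interpA c lam rho s))
    (fun t => 1 - potentialHeight c lam rho (variablePotential c lam rho) t) (fun _ => 1)

theorem Ensemble.potentialHeight_check (h : Ensemble c lam rho) {t : ℝ}
    (ht : t ∈ unitIntervals (((0 : ℕ) : ℝ) - 1)) :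
    potentialHeight c lam rho (checkPotential c lam rho) t =
      gexit (interpA c lam rho) t (interpB c lam rho (t + 1)) := by
  obtain ⟨n, hn⟩ := exists_mem_Ioo_of_mem_unitIntervals ht
  obtain ⟨e, E, κ, D, hd⟩ := h.exists_univ_derivs hn
  rw [potentialHeight, (h.hasDerivAt_checkPotential hn hd).deriv, hd.hasDerivAt_entropy.deriv,
    (hd.mono (subset_univ (Iic t))).gexit_eq
      (h.symmLaw_interpB (by linarith [neg_one_lt_of_mem_Ioo hn])), neg_neg]

theorem Ensemble.potentialHeight_variable (h : Ensemble c lam rho)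
    (hconv : ConvergesToPerfect c lam rho) {t : ℝ}
    (ht : t ∈ regularParams c lam rho (((1 : ℕ) : ℝ) - 1)) :
    1 - potentialHeight c lam rho (variablePotential c lam rho) t =
      gexit (interpA c lam rho) t (interpB c lam rho t) := by
  obtain ⟨n, hn⟩ := exists_mem_Ioo_of_mem_unitIntervals ht.1
  obtain ⟨e, E, κ, D, hd⟩ := h.exists_univ_derivs hn
  have hd' := hd.mono (subset_univ (Iic t))
  have hE := (h.deriv_entropy_neg hconv (neg_one_lt_of_mem_Ioo hn) ht.2 hd').ne
  rw [potentialHeight, (h.hasDerivAt_variablePotential hn hd).deriv, hd.hasDerivAt_entropy.deriv,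
    hd'.gexit_eq (h.symmLaw_interpB (sub_one_mem_Icc (Ioo_subset_Icc_self hn)).2)]
  -- Unlike on the check side, `E ≠ 0` is needed: `1 - (E - D) / E = D / E` fails for a vanishing
  -- denominator.
  field_simp
  ring

theorem Ensemble.checkCore_area (h : Ensemble c lam rho) (hconv : ConvergesToPerfect c lam rho) :
    MeasurableSet (checkCore c lam rho) ∧
      volume (checkCore c lam rho) = ENNReal.ofReal (1 - polyIntegral rho) := by
  have h1 := h.measurableSet_volume_paramRegion hconv 0 (F := checkPotential c lam rho)
    (by simpa using h.continuousOn_checkPotential) (fun t ht => ?_)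
    (h.tendsto_checkPotential hconv) measurable_const
    (measurable_potentialHeight c lam rho (checkPotential c lam rho)) (fun t => sub_zero _)
  · simpa [checkCore, h.checkPotential_neg_one] using h1
  · obtain ⟨n, hn⟩ := exists_mem_Ioo_of_mem_unitIntervals ht
    obtain ⟨e, E, κ, D, hd⟩ := h.exists_univ_derivs hn
    have hb := h.symmLaw_interpB (t := t + 1) (by linarith [neg_one_lt_of_mem_Ioo hn])
    have hd' := hd.mono (subset_univ (Iic t))
    exact ⟨_, _, hd.hasDerivAt_entropy, h.hasDerivAt_checkPotential hn hd,
      neg_nonneg.2 (h.deriv_conv_nonpos (neg_one_lt_of_mem_Ioo hn) hd' hb),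
      neg_le_neg (h.deriv_entropy_le (neg_one_lt_of_mem_Ioo hn) hd' hb)⟩

theorem Ensemble.variableCore_area (h : Ensemble c lam rho)
    (hconv : ConvergesToPerfect c lam rho) :
    MeasurableSet (variableCore c lam rho) ∧
      volume (variableCore c lam rho) = ENNReal.ofReal (entropy c * polyIntegral lam) := by
  have h1 := h.measurableSet_volume_paramRegion hconv 1 (F := variablePotential c lam rho)
    (by simpa using h.continuousOn_variablePotential) (fun t ht => ?_)
    (h.tendsto_variablePotential hconv)
    ((measurable_potentialHeight c lam rho (variablePotential c lam rho)).const_sub 1)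
    (measurable_const (a := 1)) (fun t => sub_sub_cancel _ _)
  · simpa [variableCore, h.variablePotential_zero] using h1
  · obtain ⟨n, hn⟩ := exists_mem_Ioo_of_mem_unitIntervals ht
    obtain ⟨e, E, κ, D, hd⟩ := h.exists_univ_derivs hn
    have hb := h.symmLaw_interpB (sub_one_mem_Icc (Ioo_subset_Icc_self hn)).2
    have hd' := hd.mono (subset_univ (Iic t))
    have h2 := h.deriv_conv_nonpos (neg_one_lt_of_mem_Ioo hn) hd' hb
    have h3 := h.deriv_entropy_le (neg_one_lt_of_mem_Ioo hn) hd' hb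
    exact ⟨_, _, hd.hasDerivAt_entropy, h.hasDerivAt_variablePotential hn hd,
      by linarith, by linarith⟩

theorem Ensemble.mem_regularParams_or_mem_strip {k : ℕ} {t : ℝ}
    (ht : (k : ℝ) - 1 < t) (y : ℝ) : t ∈ regularParams c lam rho ((k : ℝ) - 1) ∨
      (entropy (interpA c lam rho t), y) ∈ exceptionalStrip c lam rho := by
  rcases mem_unitIntervals_or_eq_natCast ht with h1 | ⟨n, rfl⟩
  · by_cases h0 : entropy (interpA c lam rho t) = 0
    · exact Or.inr ⟨Or.inl h0, mem_univ _⟩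
    · exact Or.inl ⟨h1, h0⟩
  · exact Or.inr ⟨Or.inr ⟨n, rfl⟩, mem_univ _⟩

theorem lt_of_mem_unitIntervals {x t : ℝ} (ht : t ∈ unitIntervals x) : x < t := by
  obtain ⟨n, hn⟩ := mem_iUnion.1 ht
  linarith [hn.1, n.cast_nonneg (α := ℝ)]

theorem Ensemble.checkCore_subset (h : Ensemble c lam rho) :
    checkCore c lam rho ⊆ regionUnder (checkCurve c lam rho) := by
  rintro ⟨x, y⟩ ⟨t, ht, hx, hy⟩
  refine ⟨hy.1, _, ⟨t, ?_, rfl⟩, hx, ?_⟩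
  · simpa using lt_of_mem_unitIntervals ht.1
  · exact hy.2.trans_eq (h.potentialHeight_check ht.1)

theorem Ensemble.regionUnder_subset (h : Ensemble c lam rho) :
    regionUnder (checkCurve c lam rho) ⊆ checkCore c lam rho ∪ exceptionalStrip c lam rho := by
  rintro ⟨x, y⟩ ⟨hy, _, ⟨t, ht, rfl⟩, hx, hy'⟩
  simp only at hx
  subst hx
  refine (mem_regularParams_or_mem_strip (k := 0) (by simpa using ht) y).imp_left fun hs => ?_
  exact ⟨t, hs, rfl, hy, hy'.trans_eq (h.potentialHeight_check hs.1).symm⟩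

theorem Ensemble.variableCore_subset (h : Ensemble c lam rho)
    (hconv : ConvergesToPerfect c lam rho) :
    variableCore c lam rho ⊆ regionLeft (variableCurve c lam rho) := by
  rintro ⟨x, y⟩ ⟨t, ht, hx, hy⟩
  refine ⟨hy.2, _, ⟨t, ?_, rfl⟩, hx, ?_⟩
  · simpa using (lt_of_mem_unitIntervals ht.1).le
  · exact (h.potentialHeight_variable hconv ht).symm.trans_le hy.1

theorem Ensemble.regionLeft_subset (h : Ensemble c lam rho)
    (hconv : ConvergesToPerfect c lam rho) :
    regionLeft (variableCurve c lam rho) ⊆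
      variableCore c lam rho ∪ exceptionalStrip c lam rho := by
  rintro ⟨x, y⟩ ⟨hy, _, ⟨t, ht, rfl⟩, hx, hy'⟩
  simp only at hx
  subst hx
  have ht' : 0 ≤ t := ht
  rcases ht'.eq_or_lt with rfl | h0
  · exact Or.inr ⟨Or.inr ⟨0, by simp⟩, mem_univ _⟩
  refine (mem_regularParams_or_mem_strip (k := 1) (by simpa using h0) y).imp_left fun hs => ?_
  exact ⟨t, hs, rfl, (h.potentialHeight_variable hconv hs).trans_le hy', hy⟩

theorem ae_eq_of_subset_union_null {α : Type*} [MeasurableSpace α] {μ : Measure α} {s t z : Set α}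
    (h1 : s ⊆ t) (h2 : t ⊆ s ∪ z) (hz : μ z = 0) : s =ᵐ[μ] t :=
  h1.eventuallyLE.antisymm (h2.eventuallyLE.trans (union_ae_eq_left_of_ae_eq_empty
    (ae_eq_empty.2 hz)).le)

theorem Ensemble.checkCore_ae_eq (h : Ensemble c lam rho) :
    checkCore c lam rho =ᵐ[volume] regionUnder (checkCurve c lam rho) :=
  ae_eq_of_subset_union_null h.checkCore_subset h.regionUnder_subset
    (volume_exceptionalStrip c lam rho)

theorem Ensemble.variableCore_ae_eq (h : Ensemble c lam rho)
    (hconv : ConvergesToPerfect c lam rho) :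
    variableCore c lam rho =ᵐ[volume] regionLeft (variableCurve c lam rho) :=
  ae_eq_of_subset_union_null (h.variableCore_subset hconv) (h.regionLeft_subset hconv)
    (volume_exceptionalStrip c lam rho)

theorem Ensemble.volume_regionUnder (h : Ensemble c lam rho)
    (hconv : ConvergesToPerfect c lam rho) :
    volume (regionUnder (checkCurve c lam rho)) = ENNReal.ofReal (1 - polyIntegral rho) := by
  rw [← measure_congr h.checkCore_ae_eq, (h.checkCore_area hconv).2]

theorem Ensemble.volume_regionLeft (h : Ensemble c lam rho)
    (hconv : ConvergesToPerfect c lam rho) :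
    volume (regionLeft (variableCurve c lam rho)) =
      ENNReal.ofReal (entropy c * polyIntegral lam) := by
  rw [← measure_congr (h.variableCore_ae_eq hconv), (h.variableCore_area hconv).2]

/-! ### The gap between the curves -/

theorem Ensemble.entropy_mem (h : Ensemble c lam rho) {t : ℝ} (ht : -1 ≤ t) :
    entropy (interpA c lam rho t) ∈ Icc (0 : ℝ) 1 :=
  ⟨(h.symmLaw_interpA ht).entropy_nonneg, (h.symmLaw_interpA ht).entropy_le_one⟩

theorem Ensemble.regionUnder_subset_box (h : Ensemble c lam rho) :
    regionUnder (checkCurve c lam rho) ⊆ Icc (0 : ℝ) 1 ×ˢ Icc (0 : ℝ) 1 := by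
  rintro ⟨x, y⟩ ⟨hy, _, ⟨t, ht, rfl⟩, hx, hy'⟩
  have ht' : -1 < t := ht
  have h1 := h.entropy_mem ht'.le
  simp only at hx
  rw [← hx] at h1
  exact ⟨h1, hy, hy'.trans (h.gexit_mem ht' (h.symmLaw_interpB (by linarith))).2⟩

theorem Ensemble.regionLeft_subset_box (h : Ensemble c lam rho) :
    regionLeft (variableCurve c lam rho) ⊆ Icc (0 : ℝ) 1 ×ˢ Icc (0 : ℝ) 1 := by
  rintro ⟨x, y⟩ ⟨hy, _, ⟨t, ht, rfl⟩, hx, hy'⟩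
  have ht' : 0 ≤ t := ht
  have h1 := h.entropy_mem (t := t) (by linarith)
  simp only at hx
  rw [← hx] at h1
  exact ⟨h1, (h.gexit_mem (by linarith) (h.symmLaw_interpB ht')).1.trans hy', hy⟩

theorem Ensemble.aedisjoint_regions (h : Ensemble c lam rho)
    (hconv : ConvergesToPerfect c lam rho) :
    AEDisjoint volume (regionUnder (checkCurve c lam rho))
      (regionLeft (variableCurve c lam rho)) := by
  set w := potentialHeight c lam rho (checkPotential c lam rho) with hw
  -- The check curve itself is a region of height zero, which corresponds to the constant potential.
  -- By non-crossing, the two regions can only meet on this curve or over exceptional abscissae.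
  have hgraph : volume (paramRegion (regularParams c lam rho (((0 : ℕ) : ℝ) - 1))
      (fun s => entropy (interpA c lam rho s)) w w) = 0 := by
    have hw' : Measurable w := measurable_potentialHeight c lam rho _
    have h1 := h.measurableSet_volume_paramRegion hconv 0 (F := fun _ => 0) (L := 0)
      continuousOn_const (fun t ht => ?_) tendsto_const_nhds hw' hw'
      (fun t => by simp [potentialHeight])
    · rw [h1.2, sub_zero, ENNReal.ofReal_zero]
    · obtain ⟨n, hn⟩ := exists_mem_Ioo_of_mem_unitIntervals ht
      obtain ⟨e, E, κ, D, hd⟩ := h.exists_univ_derivs hn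
      have hd' := hd.mono (subset_univ (Iic t))
      have ht1 := neg_one_lt_of_mem_Ioo hn
      exact ⟨E, 0, hd.hasDerivAt_entropy, hasDerivAt_const t 0, le_rfl, neg_nonneg.2
        ((h.deriv_entropy_le ht1 hd' h.channel).trans (h.deriv_conv_nonpos ht1 hd' h.channel))⟩
  refine measure_mono_null ?_ (measure_union_null hgraph (volume_exceptionalStrip c lam rho))
  rintro ⟨x, y⟩ ⟨⟨-, _, ⟨t, ht, rfl⟩, hx, hy⟩, -, _, ⟨s, hs, rfl⟩, hx', hy'⟩
  simp only at hx hx'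
  subst hx
  have ht' : -1 < t := ht
  have h1 := h.gexit_le_gexit hconv ht' hs hx'
  refine (mem_regularParams_or_mem_strip (k := 0) (by simpa using ht) y).imp_left fun hr => ?_
  have h2 : y = w t := by
    rw [hw, h.potentialHeight_check hr.1]
    exact le_antisymm hy (h1.trans hy')
  exact ⟨t, hr, rfl, h2.ge, h2.le⟩

theorem Ensemble.volume_union_regions (h : Ensemble c lam rho)
    (hconv : ConvergesToPerfect c lam rho) :
    volume (regionUnder (checkCurve c lam rho) ∪ regionLeft (variableCurve c lam rho)) =
      ENNReal.ofReal (1 - polyIntegral rho) + ENNReal.ofReal (entropy c * polyIntegral lam) := by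
  rw [measure_union₀ ((h.variableCore_area hconv).1.nullMeasurableSet.congr
    (h.variableCore_ae_eq hconv)) (h.aedisjoint_regions hconv), h.volume_regionUnder hconv,
    h.volume_regionLeft hconv]

theorem volume_unit_box : volume (Icc (0 : ℝ) 1 ×ˢ Icc (0 : ℝ) 1) = 1 := by
  rw [Measure.volume_eq_prod, Measure.prod_prod, Real.volume_Icc]
  simp

theorem IsDegreeDistribution.polyIntegral_pos {p : ℝ[X]} (hp : IsDegreeDistribution p) :
    0 < polyIntegral p := by
  rw [polyIntegral_eq_sum]
  have hnn : ∀ k ∈ p.support, 0 ≤ p.coeff k / ((k : ℝ) + 1) := fun k _ =>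
    div_nonneg (hp.coeff_nonneg k) (by positivity)
  refine (Finset.sum_nonneg hnn).lt_of_ne fun h0 => ?_
  have h1 := (Finset.sum_eq_zero_iff_of_nonneg hnn).1 h0.symm
  have h2 : ∑ k ∈ p.support, p.coeff k = 0 := Finset.sum_eq_zero fun k hk =>
    (div_eq_zero_iff.1 (h1 k hk)).resolve_right (by positivity)
  rw [hp.sum_coeff] at h2
  exact one_ne_zero h2

theorem IsDegreeDistribution.polyIntegral_le_one {p : ℝ[X]} (hp : IsDegreeDistribution p) :
    polyIntegral p ≤ 1 := by
  rw [polyIntegral_eq_sum]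
  exact (Finset.sum_le_sum fun k _ => div_le_self (hp.coeff_nonneg k) (by simp)).trans_eq
    hp.sum_coeff

/-- Two almost disjoint regions of the unit box have total area at most one. -/
theorem Ensemble.entropy_mul_polyIntegral_le (h : Ensemble c lam rho)
    (hconv : ConvergesToPerfect c lam rho) :
    entropy c * polyIntegral lam ≤ polyIntegral rho := by
  have h1 := measure_mono (μ := volume) (union_subset h.regionUnder_subset_box h.regionLeft_subset_box)
  have h2 := mul_nonneg h.channel.entropy_nonneg h.lam_dist.polyIntegral_pos.le
  rw [h.volume_union_regions hconv, volume_unit_box, ← ENNReal.ofReal_add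
    (sub_nonneg.2 h.rho_dist.polyIntegral_le_one) h2, ENNReal.ofReal_le_one] at h1
  linarith

theorem Ensemble.designRate_le (h : Ensemble c lam rho) (hconv : ConvergesToPerfect c lam rho) :
    designRate lam rho ≤ 1 - entropy c :=
  sub_le_sub_left ((le_div_iff₀ h.lam_dist.polyIntegral_pos).2
    (h.entropy_mul_polyIntegral_le hconv)) 1

theorem Ensemble.volume_gap (h : Ensemble c lam rho) (hconv : ConvergesToPerfect c lam rho) :
    volume ((Icc (0 : ℝ) 1 ×ˢ Icc (0 : ℝ) 1) \
        (regionUnder (checkCurve c lam rho) ∪ regionLeft (variableCurve c lam rho))) =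
      ENNReal.ofReal (polyIntegral lam * (1 - entropy c - designRate lam rho)) := by
  have h1 := h.volume_union_regions hconv
  have h2 := mul_nonneg h.channel.entropy_nonneg h.lam_dist.polyIntegral_pos.le
  have h3 := sub_nonneg.2 h.rho_dist.polyIntegral_le_one
  rw [← ENNReal.ofReal_add h3 h2] at h1
  rw [measure_sdiff (union_subset h.regionUnder_subset_box h.regionLeft_subset_box)
    (((h.checkCore_area hconv).1.nullMeasurableSet.congr h.checkCore_ae_eq).union
      ((h.variableCore_area hconv).1.nullMeasurableSet.congr (h.variableCore_ae_eq hconv)))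
    (h1 ▸ ENNReal.ofReal_ne_top), h1, volume_unit_box, ← ENNReal.ofReal_one,
    ← ENNReal.ofReal_sub _ (add_nonneg h3 h2)]
  congr 1
  -- The remaining area is `∫ρ - H(c) ∫λ`; substituting the design rate requires dividing by `∫λ`.
  have := h.lam_dist.polyIntegral_pos.ne'
  rw [designRate]
  field_simp
  ring

theorem Ensemble.differentiableAt_softEntropy (h : Ensemble c lam rho) {t : ℝ} (ht : -1 < t)
    (hint : ∀ k : ℤ, t ≠ k) (z : EReal) :
    DifferentiableAt ℝ (fun s => softEntropy (interpA c lam rho s) z) t := by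
  rcases exists_mem_Ioo_or_eq_natCast ht with ⟨n, hn⟩ | ⟨n, hn⟩
  · obtain ⟨e, E, κ, D, hd⟩ := h.exists_univ_derivs hn
    exact (hasDerivWithinAt_univ.1 (hd.softEntropy z)).differentiableAt
  · exact absurd (by exact_mod_cast hn) (hint n)

end Gexit

end

/-! ### Assembly of the statement -/

theorem mainTheorem6 (c : Measure EReal) (hc : Gexit.IsSymmetricLDensity c)
    (lam rho : ℝ[X]) (hlam : Gexit.IsDegreeDistribution lam)
    (hrho : Gexit.IsDegreeDistribution rho) (hrho_one : rho.coeff 0 = 0)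
    (hconv : Gexit.ConvergesToPerfect c lam rho)
    (a b : ℝ → Measure EReal) (ha : a = Gexit.interpA c lam rho)
    (hb : b = Gexit.interpB c lam rho) :
    -- the functional is well defined along the curves
    ((∀ α : ℝ, -1 < α → ∀ z : EReal,
        DifferentiableWithinAt ℝ (fun t => Gexit.softEntropy (a t) z) (Iic α) α ∧
        ((∀ k : ℤ, α ≠ k) → DifferentiableAt ℝ (fun t => Gexit.softEntropy (a t) z) α)) ∧
      (∀ α : ℝ, -1 < α → Gexit.entropy (a α) ≠ 0 →
        Gexit.leftDeriv (fun t => Gexit.entropy (a t)) α < 0) ∧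
      (∀ α : ℝ, -1 < α → Integrable (Gexit.gexitKernel a α) (b (α + 1))) ∧
      (∀ α : ℝ, 0 ≤ α → Integrable (Gexit.gexitKernel a α) (b α))) ∧
    -- the curves do not cross
    (∀ p ∈ Gexit.checkCurve c lam rho, ∀ q ∈ Gexit.variableCurve c lam rho,
      p.1 = q.1 → p.2 ≤ q.2) ∧
    -- the curves represent density evolution faithfully
    ((∀ n : ℕ, a n = Gexit.densityEvolution c lam rho n) ∧
      (∀ α : ℝ, -1 ≤ α → b (α + 1) = Gexit.checkMap rho (a α)) ∧
      (∀ α : ℝ, 0 ≤ α → a α = Gexit.variableMap c lam (b α)) ∧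
      ContinuousOn (fun α => Gexit.entropy (a α)) (Ici (-1)) ∧
      AntitoneOn (fun α => Gexit.entropy (a α)) (Ici (-1)) ∧
      (∀ x ∈ Ioc (0 : ℝ) 1, ∃! α : ℝ, -1 ≤ α ∧ Gexit.entropy (a α) = x)) ∧
    -- the areas
    volume (Gexit.regionUnder (Gexit.checkCurve c lam rho)) =
      ENNReal.ofReal (1 - Gexit.polyIntegral rho) ∧
    volume (Gexit.regionLeft (Gexit.variableCurve c lam rho)) =
      ENNReal.ofReal (Gexit.entropy c * Gexit.polyIntegral lam) ∧
    -- the Shannon limit, and the area between the curves as the gap to it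
    Gexit.designRate lam rho ≤ 1 - Gexit.entropy c ∧
    volume ((Icc (0 : ℝ) 1 ×ˢ Icc (0 : ℝ) 1) \
        (Gexit.regionUnder (Gexit.checkCurve c lam rho) ∪
          Gexit.regionLeft (Gexit.variableCurve c lam rho))) =
      ENNReal.ofReal
        (Gexit.polyIntegral lam * (1 - Gexit.entropy c - Gexit.designRate lam rho)) := by
  subst ha hb
  have h : Gexit.Ensemble c lam rho := ⟨hc.symmLaw, hlam, hrho, hrho_one⟩
  refine ⟨⟨fun α hα z => ⟨?_, fun hint => h.differentiableAt_softEntropy hα hint z⟩,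
    fun α hα hne => ?_, fun α hα => ?_, fun α hα => ?_⟩, ?_,
    ⟨Gexit.interpA_natCast c lam rho, fun α _ => Gexit.interpB_add_one c lam rho α,
      fun α hα => h.interpA_eq hα, h.continuousOn_entropy, h.entropy_antitone,
      fun x hx => h.existsUnique_entropy_eq hconv hx⟩,
    h.volume_regionUnder hconv, h.volume_regionLeft hconv, h.designRate_le hconv,
    h.volume_gap hconv⟩
  · obtain ⟨e, E, κ, D, hd⟩ := h.exists_left_derivs hα
    exact (hd.softEntropy z).differentiableWithinAt
  · obtain ⟨e, E, κ, D, hd⟩ := h.exists_left_derivs hα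
    exact hd.leftDeriv_entropy.trans_lt (h.deriv_entropy_neg hconv hα hne hd)
  · obtain ⟨e, E, κ, D, hd⟩ := h.exists_left_derivs hα
    exact hd.integrable_gexitKernel (h.symmLaw_interpB (by linarith))
  · obtain ⟨e, E, κ, D, hd⟩ := h.exists_left_derivs (t := α) (by linarith)
    exact hd.integrable_gexitKernel (h.symmLaw_interpB hα)
  · rintro _ ⟨s, hs, rfl⟩ _ ⟨t, ht, rfl⟩ hst
    exact h.gexit_le_gexit hconv hs ht hst
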